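/- **Setting.** Fix $\rho>1$. Let $\mathcal W^{\ge0}_{\mathbb R}$ be the Banach space of real power series $h=\sum_{k\ge0}h_k\lambda^k$ with norm $\sum_k|h_k|\rho^k<\infty$. For $\varphi\in(0,\frac\pi2)$ put $p_1=e^{i\varphi}$, $p_2=-e^{-i\varphi}$, $p_3=-e^{i\varphi}$, $p_4=e^{-i\varphi}$ and $$\underline a=\tfrac12(\lambda^{-1}-\lambda),\quad \underline b=-\tfrac12\sin\varphi\,(\lambda^{-1}+\lambda),\quad \underline c=-\tfrac12\cos\varphi\,(\lambda^{-1}+\lambda).$$ For a parameter vector $\mathbf x=(\tilde a,\tilde b,\tilde c,r,\theta)\in(\mathcal W^{\ge0}_{\mathbb R})^3\times\mathbb R^2$ let $a=\underline a+\tilde a$, $b=\underline b+\tilde b$, $c=\underline c+\tilde c$, and for $t\in\mathbb R$ let $\eta=r\,t\sum_{k=1}^4A_k(\lambda)\frac{dz}{z-p_k}$ with $$A_1=\begin{pmatrix}ia&b+ic\\b-ic&-ia\end{pmatrix},\ A_2=\begin{pmatrix}-ia&-b+ic\\-b-ic&ia\end{pmatrix},\ A_3=\begin{pmatrix}ia&-b-ic\\-b+ic&-ia\end{pmatrix},\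 A_4=\begin{pmatrix}-ia&b-ic\\b+ic&ia\end{pmatrix}.$$ Let $\Phi$ solve $d\Phi=\Phi\eta$, $\Phi(0)=\mathrm{Id}$, and let $\mathcal P=\Phi(1)$, $\mathcal Q=\Phi(i)$ be its values obtained along the segments from $0$ to $1$ and from $0$ to $i$. Put $\mathfrak p=\mathcal P_{11}\mathcal P_{21}-\mathcal P_{12}\mathcal P_{22}$, $\mathfrak q=i(\mathcal Q_{11}\mathcal Q_{21}+\mathcal Q_{12}\mathcal Q_{22})$, and, for fixed $\mathbf x$, $\widehat{\mathfrak p}(t)=(\mathfrak p(t)-\mathfrak p(0))/t$ for $t\ne0$, $\widehat{\mathfrak p}(0)=\mathfrak p'(0)$; likewise $\widehat{\mathfrak q}$. With $h^*(\lambda)=\overline{h(1/\overline\lambda)}$, the pair $(t,\mathbf x)$ solves the *monodromy problem* if $\widehat{\mathfrak p}=\widehat{\mathfrak p}^*$, $\widehat{\mathfrak q}=\widehat{\mathfrak q}^*$ and $\det(rA_1)=-1$ on the unit circle, $\theta\in(0,\pi)$, and $\widehat{\mathfrak p}=\widehat{\mathfrak q}=0$ at $\lambda=e^{i\theta}$.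 **Statement.** Let $\varphi=\frac\pi4$. There is a family $t\mapsto\mathbf x(t)$, $C^\infty$ near $t=0$, with $\mathbf x(0)=(0,0,0,1,\frac\pi2)$, such that $(t,\mathbf x(t))$ solves the monodromy problem for all $t$ near $0$. For every such family, write $f^{(n)}$ for the $n$-th $t$-derivative at $t=0$ along the family, and $\mathbf x_1=a$, $\mathbf x_2=b$, $\mathbf x_3=c$. Then for each $\lambda$ with $\rho^{-1}\le|\lambda|\le\rho$ the matrix $\mathcal P$ is $C^\infty$ in $t$ near $0$, and for every $n\ge1$: 1. $a^{(n)},b^{(n)},c^{(n)}$ are (real) polynomials in $\lambda$ of degree at most $n+1$; 2. the entries of $\mathcal P^{(n+1)}$ are Laurent polynomials in $\lambda$ of degree at most $n+1$, i.e. involve only $\lambda^k$ with $|k|\le n+1$; 3. $\theta^{(n)}=0$, and $a^{(n)},b^{(n)},c^{(n)},r^{(n)},\mathcal P^{(n+1)}$ are determined by the data of lower order through the following recursion. Let $\omega_j=\sum_k\epsilon_{jk}\frac{dz}{z-p_k}$ with sign vectors $\epsilon_1=(+,-,+,-)$, $\epsilon_2=(+,-,-,+)$, $\epsilon_3=(+,+,-,-)$;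 let $\Omega_{j}(z)=\int_0^z\omega_{j}$, $\Omega_{j_1,\dots,j_\ell}(z)=\int_0^z\Omega_{j_1,\dots,j_{\ell-1}}\omega_{j_\ell}$; let $$\mathfrak m_1=\begin{pmatrix}i&0\\0&-i\end{pmatrix},\quad\mathfrak m_2=\begin{pmatrix}0&1\\1&0\end{pmatrix},\quad\mathfrak m_3=\begin{pmatrix}0&i\\-i&0\end{pmatrix},$$ and $\mathfrak m_{j_1,\dots,j_\ell}=\prod_s\mathfrak m_{j_s}$, $\mathbf y_j=r\mathbf x_j$, $\mathbf y_{j_1,\dots,j_\ell}=\prod_s\mathbf y_{j_s}$, the derivatives of $\mathbf y$ being expanded by the Leibniz rule. Initially $\mathbf x_1^{(0)}=\underline a$, $\mathbf x_2^{(0)}=\underline b$, $\mathbf x_3^{(0)}=\underline c$, $r^{(0)}=1$ and $\mathcal P^{(1)}=\sum_j\mathbf x_j^{(0)}\Omega_j(1)\mathfrak m_j$. Put $$\mathcal P^{(n+1)}_{\rm lower}=(n+1)\sum_{j=1}^3\sum_{\ell=1}^{n-1}\tbinom n\ell r^{(n-\ell)}\mathbf x_j^{(\ell)}\Omega_j(1)\mathfrak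 m_j+\sum_{\ell=2}^{n+1}\tfrac{(n+1)!}{(n+1-\ell)!}\sum_{j_1,\dots,j_\ell}\mathbf y^{(n+1-\ell)}_{j_1,\dots,j_\ell}\Omega_{j_1,\dots,j_\ell}(1)\,\mathfrak m_{j_1,\dots,j_\ell},$$ $$L=(\mathcal P^{(n+1)}_{\rm lower})_{21}-(\mathcal P^{(n+1)}_{\rm lower})_{12}+\sum_{k=1}^n\tbinom{n+1}k\bigl(\mathcal P^{(k)}_{11}\mathcal P^{(n+1-k)}_{21}-\mathcal P^{(k)}_{12}\mathcal P^{(n+1-k)}_{22}\bigr)=\sum_kL_k\lambda^k.$$ Then - $c^{(n)}=\sum_{k\ge0}c^{(n)}_k\lambda^k$ with $c^{(n)}_k=\frac{1}{2\pi(n+1)}(\overline{L_{-k}}-L_k)$ for $k\ge1$ and $c^{(n)}_0=-\sum_{k\ge1}c^{(n)}_k\,i^k-\frac{1}{2\pi(n+1)}L(i)$; - $b^{(n)}=(-1)^nc^{(n)}$; - $\lambda\,\mathcal K^{(n)}_{\rm lower}=(\lambda^2-1)\,a^{(n)}+2r^{(n)}\lambda$ (division with remainder by $\lambda^2-1$),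 where, with $\langle u,v\rangle=u_1v_1-u_2v_2-u_3v_3$, $$\mathcal K^{(n)}_{\rm lower}=-2\underline b\,b^{(n)}-2\underline c\,c^{(n)}+2\sum_{k=1}^{n-1}\tbinom nkr^{(k)}\langle\mathbf x^{(0)},\mathbf x^{(n-k)}\rangle+\sum_{k=1}^{n-1}\tbinom nk\langle\mathbf y^{(k)},\mathbf y^{(n-k)}\rangle;$$ - $\mathcal P^{(n+1)}=(n+1)\sum_{j=1}^3\bigl(\mathbf x_j^{(n)}+r^{(n)}\mathbf x_j^{(0)}\bigr)\Omega_j(1)\mathfrak m_j+\mathcal P^{(n+1)}_{\rm lower}$. -/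

import Mathlib

open scoped LaurentPolynomial Polynomial ContDiff Topology

noncomputable section

namespace DPW

/-! ### The loop space -/

/-- Real Fourier series `∑_{k ≥ 0} h_k λ^k` with `∑ |h_k| ρ^k < ∞`. -/
def plusLoopSubmodule (ρ : ℝ) : Submodule ℝ (ℕ → ℝ) where
  carrier := {h | Summable fun k => |h k| * |ρ| ^ k}
  zero_mem' := by simp
  add_mem' := by
    intro f g hf hg
    refine Summable.of_nonneg_of_le (fun k => by positivity) (fun k => ?_) (Summable.add hf hg)
    have := abs_add_le (f k) (g k)
    have h2 : (0 : ℝ) ≤ |ρ| ^ k := by positivity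
    simpa [add_mul] using mul_le_mul_of_nonneg_right this h2
  smul_mem' := by
    intro c f hf
    have : Summable fun k => |c| * (|f k| * |ρ| ^ k) := Summable.mul_left _ hf
    simpa [abs_mul, mul_assoc] using this

/-- The space `W_{ℝ,ρ}^{≥ 0}`; an element is given by its sequence of Fourier coefficients. -/
def PlusLoop (ρ : ℝ) : Type := plusLoopSubmodule ρ

namespace PlusLoop

variable {ρ : ℝ}

instance : AddCommGroup (PlusLoop ρ) := inferInstanceAs (AddCommGroup (plusLoopSubmodule ρ))

instance : Module ℝ (PlusLoop ρ) := inferInstanceAs (Module ℝ (plusLoopSubmodule ρ))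

/-- The `k`-th Fourier coefficient. -/
def coeff (h : PlusLoop ρ) (k : ℕ) : ℝ := h.1 k

theorem summable_coeff (h : PlusLoop ρ) : Summable fun k => |h.coeff k| * |ρ| ^ k := h.2

theorem coeff_add (f g : PlusLoop ρ) (k : ℕ) : (f + g).coeff k = f.coeff k + g.coeff k := rfl

theorem coeff_smul (c : ℝ) (f : PlusLoop ρ) (k : ℕ) : (c • f).coeff k = c * f.coeff k := rfl

theorem coeff_zero (k : ℕ) : (0 : PlusLoop ρ).coeff k = 0 := rfl

theorem ext {f g : PlusLoop ρ} (h : ∀ k, f.coeff k = g.coeff k) : f = g :=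
  Subtype.ext (funext h)

instance : Norm (PlusLoop ρ) := ⟨fun h => ∑' k, |h.coeff k| * |ρ| ^ k⟩

theorem norm_def (h : PlusLoop ρ) : ‖h‖ = ∑' k, |h.coeff k| * |ρ| ^ k := rfl

theorem normCore [Fact (1 < ρ)] : NormedSpace.Core ℝ (PlusLoop ρ) where
  norm_nonneg h := tsum_nonneg fun k => by positivity
  norm_smul c h := by
    simp only [norm_def, coeff_smul, abs_mul, mul_assoc, tsum_mul_left, Real.norm_eq_abs]
  norm_triangle f g := by
    rw [norm_def, norm_def, norm_def, ← f.summable_coeff.tsum_add g.summable_coeff]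
    refine (f + g).summable_coeff.tsum_le_tsum (fun k => ?_)
      (f.summable_coeff.add g.summable_coeff)
    rw [coeff_add, ← add_mul]
    exact mul_le_mul_of_nonneg_right (abs_add_le _ _) (by positivity)
  norm_eq_zero_iff f := by
    have hρ : (0 : ℝ) < |ρ| := abs_pos.2 (by have := Fact.out (p := 1 < ρ); linarith)
    constructor
    · intro h
      have h0 := (f.summable_coeff.hasSum_iff.2 h)
      rw [hasSum_zero_iff_of_nonneg (fun k => by positivity)] at h0
      refine ext fun k => ?_
      have := congrFun h0 k
      simpa [hρ.ne', coeff_zero] using this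
    · rintro rfl
      simp [norm_def, coeff_zero]

instance [Fact (1 < ρ)] : NormedAddCommGroup (PlusLoop ρ) := NormedAddCommGroup.ofCore normCore

instance [Fact (1 < ρ)] : NormedSpace ℝ (PlusLoop ρ) := NormedSpace.ofCore normCore

/-- The value of the loop at `lam`. -/
def eval (h : PlusLoop ρ) (lam : ℂ) : ℂ := ∑' k, (h.coeff k : ℂ) * lam ^ k

end PlusLoop

/-- The value of a Laurent polynomial at `lam`. -/
def evalLaurent (f : ℂ[T;T⁻¹]) (lam : ℂ) : ℂ := f.coeff.sum fun k c => c * lam ^ k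

/-- A Laurent polynomial of degree at most `d`: only the powers `λ^k` with `|k| ≤ d` occur. -/
def LaurentDegreeLE (d : ℕ) (f : ℂ[T;T⁻¹]) : Prop := ∀ k : ℤ, (d : ℤ) < |k| → f.coeff k = 0

/-! ### The potential -/

/-- The parameter vectors `(ã, b̃, c̃, r, θ)`. -/
abbrev Param (ρ : ℝ) : Type := PlusLoop ρ × PlusLoop ρ × PlusLoop ρ × ℝ × ℝ

namespace Param

variable {ρ : ℝ}

/-- `ã`, `b̃`, `c̃` for the indices `0`, `1`, `2`. -/
def tilde (x : Param ρ) : Fin 3 → PlusLoop ρ := ![x.1, x.2.1, x.2.2.1]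

def r (x : Param ρ) : ℝ := x.2.2.2.1

def theta (x : Param ρ) : ℝ := x.2.2.2.2

end Param

/-- The central values of `a`, `b`, `c`. -/
def central (φ : ℝ) : Fin 3 → ℂ[T;T⁻¹] :=
  ![LaurentPolynomial.C (1 / 2) * (LaurentPolynomial.T (-1) - LaurentPolynomial.T 1),
    LaurentPolynomial.C (-(Real.sin φ : ℂ) / 2) *
      (LaurentPolynomial.T (-1) + LaurentPolynomial.T 1),
    LaurentPolynomial.C (-(Real.cos φ : ℂ) / 2) *
      (LaurentPolynomial.T (-1) + LaurentPolynomial.T 1)]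

/-- The central value of the parameter vector. -/
def centralParam (ρ : ℝ) : Param ρ := (0, 0, 0, 1, Real.pi / 2)

/-- The values at `lam` of `a = a̲ + ã`, `b = b̲ + b̃`, `c = c̲ + c̃`. -/
def abc {ρ : ℝ} (φ : ℝ) (x : Param ρ) (lam : ℂ) (i : Fin 3) : ℂ :=
  evalLaurent (central φ i) lam + (x.tilde i).eval lam

/-- The punctures `p_1, …, p_4`. -/
def puncture (φ : ℝ) : Fin 4 → ℂ :=
  ![Complex.exp (Complex.I * φ), -Complex.exp (-(Complex.I * φ)),
    -Complex.exp (Complex.I * φ), Complex.exp (-(Complex.I * φ))]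

/-- The residue matrices `A_1, …, A_4`. -/
def residue (a b c : ℂ) : Fin 4 → Matrix (Fin 2) (Fin 2) ℂ :=
  ![!![Complex.I * a, b + Complex.I * c; b - Complex.I * c, -(Complex.I * a)],
    !![-(Complex.I * a), -b + Complex.I * c; -b - Complex.I * c, Complex.I * a],
    !![Complex.I * a, -b - Complex.I * c; -b + Complex.I * c, -(Complex.I * a)],
    !![-(Complex.I * a), b - Complex.I * c; b + Complex.I * c, Complex.I * a]]

/-- The coefficient of `dz` in the potential `r t ∑_k A_k(λ) dz / (z - p_k)`. -/
def potential {ρ : ℝ} (φ t : ℝ) (x : Param ρ) (lam z : ℂ) : Matrix (Fin 2) (Fin 2) ℂ :=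
  ((x.r * t : ℝ) : ℂ) • ∑ k : Fin 4, (z - puncture φ k)⁻¹ •
    residue (abc φ x lam 0) (abc φ x lam 1) (abc φ x lam 2) k

/-- The value at `w` of the solution of `dΦ = Φ η`, `Φ(0) = Id`, along the segment from `0`
to `w`, where `η = N(z) dz`. -/
def principalSolution (N : ℂ → Matrix (Fin 2) (Fin 2) ℂ) (w : ℂ) : Matrix (Fin 2) (Fin 2) ℂ :=
  Classical.epsilon fun M => ∃ Ψ : ℝ → Matrix (Fin 2) (Fin 2) ℂ, Ψ 0 = 1 ∧ Ψ 1 = M ∧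
    ∀ s ∈ Set.Icc (0 : ℝ) 1, ∀ i j, HasDerivWithinAt (fun u => Ψ u i j)
      (w * (Ψ s * N (s * w)) i j) (Set.Icc 0 1) s

/-- `𝒫 = Φ(1)`. -/
def calP {ρ : ℝ} (φ t : ℝ) (x : Param ρ) (lam : ℂ) : Matrix (Fin 2) (Fin 2) ℂ :=
  principalSolution (potential φ t x lam) 1

/-- `𝒬 = Φ(i)`. -/
def calQ {ρ : ℝ} (φ t : ℝ) (x : Param ρ) (lam : ℂ) : Matrix (Fin 2) (Fin 2) ℂ :=
  principalSolution (potential φ t x lam) Complex.I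

/-- `𝔭 = 𝒫₁₁ 𝒫₂₁ - 𝒫₁₂ 𝒫₂₂`. -/
def frakP {ρ : ℝ} (φ t : ℝ) (x : Param ρ) (lam : ℂ) : ℂ :=
  calP φ t x lam 0 0 * calP φ t x lam 1 0 - calP φ t x lam 0 1 * calP φ t x lam 1 1

/-- `𝔮 = i (𝒬₁₁ 𝒬₂₁ + 𝒬₁₂ 𝒬₂₂)`. -/
def frakQ {ρ : ℝ} (φ t : ℝ) (x : Param ρ) (lam : ℂ) : ℂ :=
  Complex.I *
    (calQ φ t x lam 0 0 * calQ φ t x lam 1 0 + calQ φ t x lam 0 1 * calQ φ t x lam 1 1)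

/-- `(𝔭(t) - 𝔭(0)) / t` for `t ≠ 0` and `𝔭'(0)` for `t = 0`, for a fixed parameter vector. -/
def hatP {ρ : ℝ} (φ t : ℝ) (x : Param ρ) (lam : ℂ) : ℂ :=
  dslope (fun s : ℝ => frakP φ s x lam) 0 t

/-- `(𝔮(t) - 𝔮(0)) / t` for `t ≠ 0` and `𝔮'(0)` for `t = 0`, for a fixed parameter vector. -/
def hatQ {ρ : ℝ} (φ t : ℝ) (x : Param ρ) (lam : ℂ) : ℂ :=
  dslope (fun s : ℝ => frakQ φ s x lam) 0 t

/-- `h*(λ)`, the complex conjugate of `h(1 / λ̄)`. -/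
def loopStar (h : ℂ → ℂ) (lam : ℂ) : ℂ := star (h (1 / star lam))

/-- `𝒦 = det (r A_1)`. -/
def calK {ρ : ℝ} (φ : ℝ) (x : Param ρ) (lam : ℂ) : ℂ :=
  ((x.r : ℂ) • residue (abc φ x lam 0) (abc φ x lam 1) (abc φ x lam 2) 0).det

/-- The monodromy problem. -/
structure MonodromyProblem {ρ : ℝ} (φ t : ℝ) (x : Param ρ) : Prop where
  calF_eq : ∀ lam : ℂ, ‖lam‖ = 1 → hatP φ t x lam - loopStar (hatP φ t x) lam = 0
  calG_eq : ∀ lam : ℂ, ‖lam‖ = 1 → hatQ φ t x lam - loopStar (hatQ φ t x) lam = 0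
  calK_eq : ∀ lam : ℂ, ‖lam‖ = 1 → calK φ x lam = -1
  theta_mem : x.theta ∈ Set.Ioo 0 Real.pi
  calH₁_eq : hatP φ t x (Complex.exp (Complex.I * x.theta)) = 0
  calH₂_eq : hatQ φ t x (Complex.exp (Complex.I * x.theta)) = 0

/-- A smooth family `t ↦ 𝐱(t)`, `t ∼ 0`, of solutions of the monodromy problem which starts at
the central value. -/
structure IsSolutionFamily {ρ : ℝ} [Fact (1 < ρ)] (φ : ℝ) (x : ℝ → Param ρ) : Prop where
  initial : x 0 = centralParam ρ
  smooth : ContDiffAt ℝ ∞ x 0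
  solves : ∀ᶠ t in 𝓝 (0 : ℝ), MonodromyProblem φ t (x t)

/-! ### The ingredients of the recursion -/

/-- The coefficients of `dz` in `ω_a`, `ω_b`, `ω_c`. -/
def omega (φ : ℝ) (i : Fin 3) (z : ℂ) : ℂ :=
  ![(z - puncture φ 0)⁻¹ - (z - puncture φ 1)⁻¹ + (z - puncture φ 2)⁻¹ - (z - puncture φ 3)⁻¹,
    (z - puncture φ 0)⁻¹ - (z - puncture φ 1)⁻¹ - (z - puncture φ 2)⁻¹ + (z - puncture φ 3)⁻¹,
    (z - puncture φ 0)⁻¹ + (z - puncture φ 1)⁻¹ - (z - puncture φ 2)⁻¹ - (z - puncture φ 3)⁻¹] i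

/-- The matrices `𝔪_a`, `𝔪_b`, `𝔪_c`. -/
def frakM : Fin 3 → Matrix (Fin 2) (Fin 2) ℂ :=
  ![!![Complex.I, 0; 0, -Complex.I], !![0, 1; 1, 0], !![0, Complex.I; -Complex.I, 0]]

/-- The iterated integral `Ω_{i_1,…,i_n}(s)`, `0 ≤ s ≤ 1`, as a function of the reversed list
`[i_n, …, i_1]`. -/
def iteratedIntegral (φ : ℝ) : List (Fin 3) → ℝ → ℂ
  | [], _ => 1
  | i :: w, s => ∫ u in (0 : ℝ)..s, iteratedIntegral φ w u * omega φ i u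

/-- `Ω_{i_1,…,i_l}(1)`. -/
def omegaValue (φ : ℝ) {l : ℕ} (I : Fin l → Fin 3) : ℂ :=
  iteratedIntegral φ (List.ofFn I).reverse 1

/-- `𝔪_{i_1,…,i_l} = 𝔪_{i_1} ⋯ 𝔪_{i_l}`. -/
def frakMWord {l : ℕ} (I : Fin l → Fin 3) : Matrix (Fin 2) (Fin 2) ℂ :=
  (List.ofFn fun j => frakM (I j)).prod

/-- Given `X k i = 𝐱_i^{(k)}` and `R k = r^{(k)}`, the derivative `𝐲_i^{(k)}` of `𝐲_i = r 𝐱_i`. -/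
def yDeriv (X : ℕ → Fin 3 → ℂ[T;T⁻¹]) (R : ℕ → ℝ) (k : ℕ) (i : Fin 3) : ℂ[T;T⁻¹] :=
  ∑ l ∈ Finset.range (k + 1), ((k.choose l * R (k - l) : ℝ) : ℂ) • X l i

/-- The derivative `𝐲_{i_1,…,i_l}^{(k)}` of the product `𝐲_{i_1} ⋯ 𝐲_{i_l}`, by Leibniz' rule. -/
def yWordDeriv (X : ℕ → Fin 3 → ℂ[T;T⁻¹]) (R : ℕ → ℝ) : List (Fin 3) → ℕ → ℂ[T;T⁻¹]
  | [], k => if k = 0 then 1 else 0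
  | i :: w, k => ∑ j ∈ Finset.range (k + 1),
      (k.choose j : ℂ) • (yDeriv X R j i * yWordDeriv X R w (k - j))

/-- The matrix `f · M` for a scalar Laurent polynomial `f` and a constant matrix `M`. -/
def scaledMatrix (f : ℂ[T;T⁻¹]) (M : Matrix (Fin 2) (Fin 2) ℂ) :
    Matrix (Fin 2) (Fin 2) ℂ[T;T⁻¹] :=
  Matrix.of fun i j => M i j • f

/-- `𝒫_lower^{(n+1)}`, which involves `𝐱^{(k)}` and `r^{(k)}` for `k < n` only. -/
def calPLower (φ : ℝ) (X : ℕ → Fin 3 → ℂ[T;T⁻¹]) (R : ℕ → ℝ) (n : ℕ) :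
    Matrix (Fin 2) (Fin 2) ℂ[T;T⁻¹] :=
  (∑ i : Fin 3, ∑ l ∈ Finset.Icc 1 (n - 1),
    scaledMatrix ((((n + 1) * n.choose l * R (n - l) : ℝ) : ℂ) • X l i)
      (omegaValue φ ![i] • frakM i)) +
  ∑ l ∈ Finset.Icc 2 (n + 1), ∑ I : Fin l → Fin 3,
    scaledMatrix (((n + 1).descFactorial l : ℂ) • yWordDeriv X R (List.ofFn I) (n + 1 - l))
      (omegaValue φ I • frakMWord I)

/-- `𝔭_lower^{(n+1)}`, which involves moreover `𝒫^{(k)}` for `1 ≤ k ≤ n` only. -/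
def frakPLower (φ : ℝ) (X : ℕ → Fin 3 → ℂ[T;T⁻¹]) (R : ℕ → ℝ)
    (P : ℕ → Matrix (Fin 2) (Fin 2) ℂ[T;T⁻¹]) (n : ℕ) : ℂ[T;T⁻¹] :=
  calPLower φ X R n 1 0 - calPLower φ X R n 0 1 +
    ∑ k ∈ Finset.Icc 1 n, ((n + 1).choose k : ℂ) •
      (P k 0 0 * P (n + 1 - k) 1 0 - P k 0 1 * P (n + 1 - k) 1 1)

/-- The quadratic form `u_1 v_1 - u_2 v_2 - u_3 v_3`. -/
def lorentz (u v : Fin 3 → ℂ[T;T⁻¹]) : ℂ[T;T⁻¹] := u 0 * v 0 - u 1 * v 1 - u 2 * v 2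

/-- `𝒦_lower^{(n)}`, which involves `b^{(n)}`, `c^{(n)}`, and `𝐱^{(k)}`, `r^{(k)}` for `k < n`
only. -/
def calKLower (X : ℕ → Fin 3 → ℂ[T;T⁻¹]) (R : ℕ → ℝ) (n : ℕ) : ℂ[T;T⁻¹] :=
  (-2 : ℂ) • (X 0 1 * X n 1) + (-2 : ℂ) • (X 0 2 * X n 2) +
    (2 : ℂ) • (∑ k ∈ Finset.Icc 1 (n - 1),
      ((n.choose k * R k : ℝ) : ℂ) • lorentz (X 0) (X (n - k))) +
    ∑ k ∈ Finset.Icc 1 (n - 1),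
      (n.choose k : ℂ) • lorentz (yDeriv X R k) (yDeriv X R (n - k))

/-- The central values in order `0`, and the given polynomials in the orders `≥ 1`. -/
def coeffJet (φ : ℝ) (p : Fin 3 → ℕ → ℝ[X]) : ℕ → Fin 3 → ℂ[T;T⁻¹]
  | 0, i => central φ i
  | n + 1, i => Polynomial.toLaurent ((p i (n + 1)).map (algebraMap ℝ ℂ))

/-- The `n`-th step of the recursion for `φ = π/4`: it gives `c^{(n)}`, `b^{(n)}`, then `a^{(n)}`
and `r^{(n)}` (quotient and remainder of a division by `λ² - 1`), then `𝒫^{(n+1)}`, in terms of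
the data of lower order. -/
structure RecursionStep (φ : ℝ) (p : Fin 3 → ℕ → ℝ[X]) (R : ℕ → ℝ)
    (P : ℕ → Matrix (Fin 2) (Fin 2) ℂ[T;T⁻¹]) (n : ℕ) : Prop where
  c_pos : ∀ k : ℕ, 1 ≤ k → (((p 2 n).coeff k : ℝ) : ℂ) =
    1 / (2 * Real.pi * (n + 1)) *
      (star ((frakPLower φ (coeffJet φ p) R P n).coeff (-(k : ℤ))) -
        (frakPLower φ (coeffJet φ p) R P n).coeff (k : ℤ))
  c_zero : (((p 2 n).coeff 0 : ℝ) : ℂ) =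
    -(∑ k ∈ Finset.Icc 1 (n + 1), (((p 2 n).coeff k : ℝ) : ℂ) * Complex.I ^ k) -
      1 / (2 * Real.pi * (n + 1)) *
        evalLaurent (frakPLower φ (coeffJet φ p) R P n) Complex.I
  b_eq : p 1 n = (-1) ^ n * p 2 n
  a_r_eq : LaurentPolynomial.T 1 * calKLower (coeffJet φ p) R n =
    (LaurentPolynomial.T 2 - 1) * coeffJet φ p n 0 +
      LaurentPolynomial.C ((2 * R n : ℝ) : ℂ) * LaurentPolynomial.T 1
  P_eq : P (n + 1) = (∑ i : Fin 3,
      scaledMatrix (((n + 1 : ℕ) : ℂ) • (coeffJet φ p n i + (R n : ℂ) • central φ i))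
        (omegaValue φ ![i] • frakM i)) + calPLower φ (coeffJet φ p) R n

end DPW

end

open DPW

/-! A loop is encoded by its real Fourier coefficients, normalised so that the weighted norm becomes
the `ℓ¹` norm: `L1 ℕ` for power series, `L1 ℤ` for Laurent series on the annulus `ρ⁻¹ ≤ |λ| ≤ ρ`.
Evaluation at a point of the annulus is a continuous algebra homomorphism, and a loop is determined
by its values on the unit circle.

Existence and uniqueness. For `φ = π/4` the potential on `[0, 1]` is a combination of real matrix
functions with loop coefficients, so the differential equation can be solved once and for all with
values in `L1 ℤ`, by inverting `1 - volterra ρ w`; the solution is smooth in `w`. On the segment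
from `0` to `i` a diagonal conjugation gives the same equation with `b`, `c` exchanged and `t`
replaced by `-t`, so `𝔮` needs no separate treatment. Real coefficients turn `h = h*` into symmetry
of the coefficients, and the monodromy problem becomes one smooth equation `monF = 0` between Banach
spaces (`monF_eq_zero_iff`). Its partial differential at the central value is bijective
(`lin_injective`, `lin_surjective`): antisymmetry fixes the nonconstant coefficients of `b` and `c`,
division by `λ² - 1` fixes `a`, `r` and the sum of the constant terms of `b` and `c`, and the two
conditions at `i` fix the remaining constants and `θ`. The implicit function theorem gives a family
and the uniqueness of its germ.

Symmetry. By uniqueness, every symmetry of the problem that fixes the central value and reverses `t`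
is a symmetry of the family. Exchanging `b` and `c` gives `b(t) = c(-t)` and `θ(t) = θ(-t)`; the
substitution `λ ↦ -λ` gives `θ(t) = π - θ(-t)`. Hence `θ = π/2` near `t = 0`.

Recursion. The finite Neumann expansion writes `𝒫` as a sum over words of `t^ℓ 𝐲_I Ω_I 𝔪_I`, up to a
smooth multiple of a high power of `t`. Leibniz' rule then isolates the unknowns of order `n`:
`𝔭^{(n+1)} = 2π(n+1)(c^{(n)} + r^{(n)} c̲) + L` (`IsSolutionFamily.iteratedDeriv_frakP`). Reality of
`𝔭^{(n+1)}` on the circle gives the coefficients of `c^{(n)}` of index at least `1`, its vanishing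
at `i` the constant one, the symmetry gives `b^{(n)}`, and the derivative of `𝒦 = -1` gives
`a^{(n)}` and `r^{(n)}`. The degree bounds follow by strong induction on `n`
(`IsSolutionFamily.coeff_eq_zero`). -/

noncomputable section

namespace DPW

/-! ### Absolutely summable families and maps defined on their standard basis. -/

/-- The Banach space of absolutely summable real families. -/
abbrev L1 (ι : Type) : Type := lp (fun _ : ι => ℝ) 1

namespace L1

variable {ι : Type} {X : Type*} [NormedAddCommGroup X] [NormedSpace ℝ X]

theorem summable_abs (f : L1 ι) : Summable fun i => |f i| := by
  simpa using (lp.hasSum_norm (p := 1) (by simp) f).summable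

theorem norm_eq (f : L1 ι) : ‖f‖ = ∑' i, |f i| := by
  simpa using lp.norm_eq_tsum_rpow (p := 1) (by simp) f

variable [DecidableEq ι]

/-- The standard basis. -/
def basis (i : ι) : L1 ι := lp.single 1 i 1

theorem basis_apply (i j : ι) : basis i j = if j = i then (1 : ℝ) else 0 := by
  simp [basis, lp.single_apply, Pi.single_apply]

theorem norm_basis (i : ι) : ‖basis i‖ = 1 := by
  simp [basis, lp.norm_single]

theorem hasSum_basis (f : L1 ι) : HasSum (fun i => f i • basis i) f := by
  convert lp.hasSum_single (p := 1) (by simp) f using 2 with i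
  rw [basis, ← lp.single_smul]; simp

/-- Every element is the sum of its multiples of basis vectors, so continuity reduces identities
between linear or bilinear maps to the basis. This replaces manipulations of series in the algebra
of loops below. -/
theorem clm_ext {Y : Type*} [AddCommMonoid Y] [Module ℝ Y] [TopologicalSpace Y] [T2Space Y]
    {f g : L1 ι →L[ℝ] Y} (h : ∀ i, f (basis i) = g (basis i)) : f = g := by
  ext u
  have hf := (hasSum_basis u).mapL f
  have hg := (hasSum_basis u).mapL g
  simp only [map_smul, h] at hf hg
  exact hf.unique hg

theorem clm_congr {Y : Type*} [AddCommMonoid Y] [Module ℝ Y] [TopologicalSpace Y] [T2Space Y]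
    {f g : L1 ι →L[ℝ] Y} (h : ∀ i, f (basis i) = g (basis i)) (u : L1 ι) : f u = g u := by
  rw [clm_ext h]

theorem clm_congr₂ {κ : Type} [DecidableEq κ] {Y : Type*} [NormedAddCommGroup Y] [NormedSpace ℝ Y]
    {f g : L1 ι →L[ℝ] L1 κ →L[ℝ] Y} (h : ∀ i j, f (basis i) (basis j) = g (basis i) (basis j))
    (u : L1 ι) (v : L1 κ) : f u v = g u v := by
  have : f = g := clm_ext fun i => clm_ext fun j => h i j
  rw [this]

omit [DecidableEq ι] in
theorem summable_smul [CompleteSpace X] {x : ι → X} {C : ℝ} (hx : ∀ i, ‖x i‖ ≤ C) (f : L1 ι) :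
    Summable fun i => f i • x i := by
  refine Summable.of_norm_bounded (g := fun i => |f i| * C) (f.summable_abs.mul_right C) fun i => ?_
  rw [norm_smul, Real.norm_eq_abs]
  exact mul_le_mul_of_nonneg_left (hx i) (abs_nonneg _)

omit [DecidableEq ι] in
theorem norm_tsum_smul_le [CompleteSpace X] {x : ι → X} {C : ℝ} (hx : ∀ i, ‖x i‖ ≤ C)
    (f : L1 ι) : ‖∑' i, f i • x i‖ ≤ C * ‖f‖ := by
  rw [norm_eq, ← tsum_mul_left]
  refine tsum_of_norm_bounded ((f.summable_abs.mul_left C).hasSum) fun i => ?_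
  rw [norm_smul, Real.norm_eq_abs, mul_comm]
  exact mul_le_mul_of_nonneg_right (hx i) (abs_nonneg _)

/-- The continuous linear map which maps the standard basis to a given bounded family. -/
def lift [CompleteSpace X] (x : ι → X) (C : ℝ) (hx : ∀ i, ‖x i‖ ≤ C) : L1 ι →L[ℝ] X :=
  LinearMap.mkContinuous
    { toFun := fun f => ∑' i, f i • x i
      map_add' := fun f g => by
        rw [← (summable_smul hx f).tsum_add (summable_smul hx g)]
        simp [add_smul]
      map_smul' := fun c f => by
        rw [RingHom.id_apply, ← (summable_smul hx f).tsum_const_smul]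
        simp [mul_smul] } C (norm_tsum_smul_le hx)

omit [DecidableEq ι] in
theorem lift_apply [CompleteSpace X] (x : ι → X) (C : ℝ) (hx : ∀ i, ‖x i‖ ≤ C) (f : L1 ι) :
    lift x C hx f = ∑' i, f i • x i := rfl

theorem lift_basis [CompleteSpace X] (x : ι → X) (C : ℝ) (hx : ∀ i, ‖x i‖ ≤ C) (i : ι) :
    lift x C hx (basis i) = x i := by
  rw [lift_apply, tsum_eq_single i]
  · simp [basis_apply]
  · intro j hj
    simp [basis_apply, hj]

omit [DecidableEq ι] in
theorem norm_lift_le [CompleteSpace X] (x : ι → X) {C : ℝ} (hC : 0 ≤ C) (hx : ∀ i, ‖x i‖ ≤ C) :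
    ‖lift x C hx‖ ≤ C :=
  LinearMap.mkContinuous_norm_le _ hC _

/-- The coordinate functionals. -/
def coord (i : ι) : L1 ι →L[ℝ] ℝ :=
  lift (fun j => if j = i then 1 else 0) 1 fun j => by split_ifs <;> simp

theorem coord_apply (i : ι) (f : L1 ι) : coord i f = f i := by
  rw [coord, lift_apply, tsum_eq_single i]
  · simp
  · intro j hj
    simp [hj]

end L1

/-! ### Loops as absolutely summable families -/

/-- The annulus `ρ⁻¹ ≤ |λ| ≤ ρ`. -/
def annulus (ρ : ℝ) : Set ℂ := {lam | ρ⁻¹ ≤ ‖lam‖ ∧ ‖lam‖ ≤ ρ}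

section Weight

variable {ρ : ℝ} [hρ : Fact (1 < ρ)]

theorem rho_pos : 0 < ρ := zero_lt_one.trans hρ.out

theorem mem_annulus_of_norm_eq_one {lam : ℂ} (h : ‖lam‖ = 1) : lam ∈ annulus ρ := by
  refine ⟨?_, ?_⟩ <;> rw [h]
  · exact inv_le_one_of_one_le₀ hρ.out.le
  · exact hρ.out.le

theorem ne_zero_of_mem_annulus {lam : ℂ} (h : lam ∈ annulus ρ) : lam ≠ 0 := by
  rintro rfl
  have := h.1
  rw [norm_zero] at this
  exact absurd this (not_le.2 (inv_pos.2 rho_pos))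

/-- The norm of the `k`-th normalised basis vector, as a loop. -/
def wt (ρ : ℝ) (k : ℤ) : ℝ := (ρ ^ k.natAbs)⁻¹

theorem wt_pos (k : ℤ) : 0 < wt ρ k := inv_pos.2 (pow_pos rho_pos _)

theorem norm_zpow_le {lam : ℂ} (h : lam ∈ annulus ρ) (k : ℤ) : ‖lam ^ k‖ ≤ ρ ^ k.natAbs := by
  have h0 : 0 < ‖lam‖ := norm_pos_iff.2 (ne_zero_of_mem_annulus h)
  rcases Int.natAbs_eq k with hk | hk
  · rw [hk, zpow_natCast, norm_pow, Int.natAbs_natCast]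
    exact pow_le_pow_left₀ h0.le h.2 _
  · rw [hk, zpow_neg, zpow_natCast, norm_inv, norm_pow, Int.natAbs_neg, Int.natAbs_natCast,
      ← inv_pow]
    exact pow_le_pow_left₀ (inv_nonneg.2 h0.le) (inv_le_of_inv_le₀ rho_pos h.1) _

theorem norm_wt_smul_zpow_le {lam : ℂ} (h : lam ∈ annulus ρ) (k : ℤ) :
    ‖(wt ρ k : ℂ) * lam ^ k‖ ≤ 1 := by
  rw [norm_mul, Complex.norm_real, Real.norm_eq_abs, abs_of_pos (wt_pos k), wt]
  have hp : 0 < ρ ^ k.natAbs := pow_pos rho_pos _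
  rw [inv_mul_le_iff₀ hp, mul_one]
  exact norm_zpow_le h k

/-- Evaluation of the loop with normalised coefficients `u` at a point of the annulus. -/
def evalV {lam : ℂ} (h : lam ∈ annulus ρ) : L1 ℤ →L[ℝ] ℂ :=
  L1.lift (fun k => (wt ρ k : ℂ) * lam ^ k) 1 (norm_wt_smul_zpow_le h)

theorem evalV_basis {lam : ℂ} (h : lam ∈ annulus ρ) (k : ℤ) :
    evalV h (L1.basis k) = wt ρ k * lam ^ k := L1.lift_basis _ _ _ _

theorem evalV_apply {lam : ℂ} (h : lam ∈ annulus ρ) (u : L1 ℤ) :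
    evalV h u = ∑' k, ((u k * wt ρ k : ℝ) : ℂ) * lam ^ k := by
  simp [evalV, L1.lift_apply, mul_assoc]

/-- The loop `λ ^ k`. -/
def monV (ρ : ℝ) (k : ℤ) : L1 ℤ := (wt ρ k)⁻¹ • L1.basis k

theorem evalV_monV {lam : ℂ} (h : lam ∈ annulus ρ) (k : ℤ) : evalV h (monV ρ k) = lam ^ k := by
  have : (wt ρ k : ℂ) ≠ 0 := by exact_mod_cast (wt_pos k).ne'
  rw [monV, map_smul, evalV_basis, Complex.real_smul, Complex.ofReal_inv,
    inv_mul_cancel_left₀ this]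

/-- The triangle inequality for exponents and `1 < ρ` make the weight `ρ ^ |k|` submultiplicative;
this is what makes the product of loops bounded. -/
theorem wt_mul_wt_div_le (j k : ℤ) : wt ρ j * wt ρ k / wt ρ (j + k) ≤ 1 := by
  rw [div_le_one (wt_pos _), wt, wt, wt, ← mul_inv, ← pow_add]
  exact inv_anti₀ (pow_pos rho_pos _) (pow_le_pow_right₀ hρ.out.le (Int.natAbs_add_le j k))

theorem norm_mulV_aux (j k : ℤ) :
    ‖(wt ρ j * wt ρ k / wt ρ (j + k)) • L1.basis (j + k)‖ ≤ 1 := by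
  rw [norm_smul, L1.norm_basis, mul_one, Real.norm_eq_abs, abs_of_pos]
  · exact wt_mul_wt_div_le j k
  · have := wt_pos (ρ := ρ) j; have := wt_pos (ρ := ρ) k; have := wt_pos (ρ := ρ) (j + k)
    positivity

/-- Multiplication of loops. -/
def mulV (ρ : ℝ) [Fact (1 < ρ)] : L1 ℤ →L[ℝ] L1 ℤ →L[ℝ] L1 ℤ :=
  L1.lift (fun j => L1.lift (fun k => (wt ρ j * wt ρ k / wt ρ (j + k)) • L1.basis (j + k)) 1
    (norm_mulV_aux j)) 1 fun j => L1.norm_lift_le _ zero_le_one (norm_mulV_aux j)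

theorem mulV_basis (j k : ℤ) : mulV ρ (L1.basis j) (L1.basis k) =
    (wt ρ j * wt ρ k / wt ρ (j + k)) • L1.basis (j + k) := by
  rw [mulV, L1.lift_basis, L1.lift_basis]

theorem evalV_mulV {lam : ℂ} (h : lam ∈ annulus ρ) (u v : L1 ℤ) :
    evalV h (mulV ρ u v) = evalV h u * evalV h v := by
  have := L1.clm_congr₂ (f := (ContinuousLinearMap.compL ℝ _ _ _ (evalV h)).comp (mulV ρ))
    (g := (ContinuousLinearMap.mul ℝ ℂ).bilinearComp (evalV h) (evalV h)) (fun j k => by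
      simp only [ContinuousLinearMap.comp_apply, ContinuousLinearMap.compL_apply, mulV_basis,
        map_smul, evalV_basis, ContinuousLinearMap.bilinearComp_apply,
        ContinuousLinearMap.mul_apply', Complex.real_smul]
      have h1 : (wt ρ (j + k) : ℂ) ≠ 0 := by exact_mod_cast (wt_pos _).ne'
      rw [zpow_add₀ (ne_zero_of_mem_annulus h)]
      push_cast
      field_simp) u v
  simpa using this

/-- The coefficients are real, so conjugation acts on `λ` alone. -/
theorem conj_evalV {lam : ℂ} (h : lam ∈ annulus ρ) (h' : star lam ∈ annulus ρ) (u : L1 ℤ) :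
    evalV h' u = star (evalV h u) := by
  rw [evalV_apply, evalV_apply, tsum_star]
  refine tsum_congr fun k => ?_
  simp

/-! ### Power series -/

theorem norm_inv_pow_mul_pow_le {lam : ℂ} (h : ‖lam‖ ≤ ρ) (k : ℕ) :
    ‖((ρ ^ k)⁻¹ : ℂ) * lam ^ k‖ ≤ 1 := by
  have hp : 0 < ρ ^ k := pow_pos rho_pos _
  rw [norm_mul, norm_inv, norm_pow, norm_pow, Complex.norm_real, Real.norm_eq_abs,
    abs_of_pos rho_pos, inv_mul_le_iff₀ hp, mul_one]
  exact pow_le_pow_left₀ (norm_nonneg _) h _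

/-- Evaluation of the power series with normalised coefficients `u`. -/
def evalU {lam : ℂ} (h : ‖lam‖ ≤ ρ) : L1 ℕ →L[ℝ] ℂ :=
  L1.lift (fun k => ((ρ ^ k)⁻¹ : ℂ) * lam ^ k) 1 (norm_inv_pow_mul_pow_le h)

theorem evalU_basis {lam : ℂ} (h : ‖lam‖ ≤ ρ) (k : ℕ) :
    evalU h (L1.basis k) = (ρ ^ k : ℂ)⁻¹ * lam ^ k := L1.lift_basis _ _ _ _

/-- The power series `λ ^ k`. -/
def monU (ρ : ℝ) (k : ℕ) : L1 ℕ := ρ ^ k • L1.basis k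

theorem evalU_monU {lam : ℂ} (h : ‖lam‖ ≤ ρ) (k : ℕ) : evalU h (monU ρ k) = lam ^ k := by
  have : (ρ : ℂ) ^ k ≠ 0 := pow_ne_zero _ (by exact_mod_cast (rho_pos (ρ := ρ)).ne')
  rw [monU, map_smul, evalU_basis, Complex.real_smul, Complex.ofReal_pow,
    mul_inv_cancel_left₀ this]

/-- Multiplication of power series. -/
def mulU : L1 ℕ →L[ℝ] L1 ℕ →L[ℝ] L1 ℕ :=
  L1.lift (fun j => L1.lift (fun k => L1.basis (j + k)) 1 fun k => (L1.norm_basis (j + k)).le) 1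
    fun _ => L1.norm_lift_le _ zero_le_one _

theorem mulU_basis (j k : ℕ) : mulU (L1.basis j) (L1.basis k) = L1.basis (j + k) := by
  rw [mulU, L1.lift_basis, L1.lift_basis]

theorem evalU_mulU {lam : ℂ} (h : ‖lam‖ ≤ ρ) (u v : L1 ℕ) :
    evalU h (mulU u v) = evalU h u * evalU h v := by
  have := L1.clm_congr₂ (f := (ContinuousLinearMap.compL ℝ _ _ _ (evalU h)).comp mulU)
    (g := (ContinuousLinearMap.mul ℝ ℂ).bilinearComp (evalU h) (evalU h)) (fun j k => by
      simp only [ContinuousLinearMap.comp_apply, ContinuousLinearMap.compL_apply, mulU_basis,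
        evalU_basis, ContinuousLinearMap.bilinearComp_apply,
        ContinuousLinearMap.mul_apply', pow_add, mul_inv]
      ring) u v
  simpa using this

/-- Power series as loops. -/
def embV : L1 ℕ →L[ℝ] L1 ℤ :=
  L1.lift (fun k => L1.basis (k : ℤ)) 1 fun _ => (L1.norm_basis _).le

theorem embV_basis (k : ℕ) : embV (L1.basis k) = L1.basis (k : ℤ) := L1.lift_basis _ _ _ _

theorem evalV_embV {lam : ℂ} (h : lam ∈ annulus ρ) (u : L1 ℕ) :
    evalV h (embV u) = evalU h.2 u := by
  refine L1.clm_congr (f := (evalV h).comp embV) (g := evalU h.2) (fun k => ?_) u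
  simp [embV_basis, evalV_basis, evalU_basis, wt]

/-- The coefficients of a power series are those of its image among the loops. -/
theorem embV_apply_natCast (u : L1 ℕ) (k : ℕ) : embV u (k : ℤ) = u k := by
  rw [← L1.coord_apply, ← L1.coord_apply]
  refine L1.clm_congr (f := (L1.coord (k : ℤ)).comp embV) (g := L1.coord k) (fun j => ?_) u
  simp [embV_basis, L1.coord_apply, L1.basis_apply]

/-! ### Uniqueness of Fourier coefficients -/

-- Absolute convergence makes the series converge uniformly on the circle, hence in `L²`; the inner
-- product with the `k`-th monomial then extracts `d k` by orthonormality.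
omit hρ in
theorem fourier_coeff_eq_zero {d : ℤ → ℂ} (hd : Summable fun k => ‖d k‖)
    (h : ∀ lam : ℂ, ‖lam‖ = 1 → ∑' k, d k * lam ^ k = 0) (k : ℤ) : d k = 0 := by
  have : Fact (0 < 2 * Real.pi) := ⟨by positivity⟩
  have hs : Summable fun k => d k • (fourier k : C(AddCircle (2 * Real.pi), ℂ)) := by
    refine Summable.of_norm ?_
    simpa [norm_smul, fourier_norm] using hd
  have h0 : HasSum (fun k => d k • (fourier k : C(AddCircle (2 * Real.pi), ℂ))) 0 := by
    convert hs.hasSum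
    ext x
    rw [← ContinuousMap.tsum_apply hs]
    have := h (fourier 1 x) (by simp [Circle.norm_coe])
    rw [ContinuousMap.zero_apply, ← this]
    refine tsum_congr fun k => ?_
    simp [fourier_apply, AddCircle.toCircle_zsmul]
  have h1 := (h0.mapL (ContinuousMap.toLp (E := ℂ) 2 AddCircle.haarAddCircle ℂ)).mapL
    (innerSL ℂ (fourierLp (T := 2 * Real.pi) 2 k))
  simp only [map_zero, map_smul, innerSL_apply_apply, smul_eq_mul] at h1
  have h2 : ∀ j, inner ℂ (fourierLp (T := 2 * Real.pi) 2 k)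
      (ContinuousMap.toLp (E := ℂ) 2 AddCircle.haarAddCircle ℂ
        (fourier j : C(AddCircle (2 * Real.pi), ℂ))) = if k = j then (1 : ℂ) else 0 :=
    fun j => orthonormal_iff_ite.1 orthonormal_fourier k j
  simp only [h2] at h1
  have h3 := h1.tsum_eq
  rw [tsum_eq_single k] at h3
  · simpa using h3
  · intro j hj
    simp [hj.symm]

theorem norm_coe_mul_wt_le (u : L1 ℤ) (k : ℤ) : ‖((u k * wt ρ k : ℝ) : ℂ)‖ ≤ |u k| := by
  rw [Complex.norm_real, Real.norm_eq_abs, abs_mul, abs_of_pos (wt_pos k)]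
  exact mul_le_of_le_one_right (abs_nonneg _) (inv_le_one_of_one_le₀ (one_le_pow₀ hρ.out.le))

theorem summable_norm_coe_mul_wt (u : L1 ℤ) : Summable fun k => ‖((u k * wt ρ k : ℝ) : ℂ)‖ :=
  Summable.of_nonneg_of_le (fun _ => norm_nonneg _) (norm_coe_mul_wt_le u) u.summable_abs

theorem eq_zero_of_evalV_eq_zero {u : L1 ℤ}
    (h : ∀ lam : ℂ, ∀ hl : ‖lam‖ = 1, evalV (ρ := ρ) (mem_annulus_of_norm_eq_one hl) u = 0) :
    u = 0 := by
  ext k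
  have := fourier_coeff_eq_zero (d := fun k => ((u k * wt ρ k : ℝ) : ℂ))
    (summable_norm_coe_mul_wt u) (fun lam hl => by rw [← h lam hl, evalV_apply]) k
  rw [Complex.ofReal_eq_zero, mul_eq_zero] at this
  simpa [(wt_pos (ρ := ρ) k).ne'] using this

theorem eq_zero_of_evalU_eq_zero {u : L1 ℕ}
    (h : ∀ lam : ℂ, ∀ hl : ‖lam‖ = 1, evalU (ρ := ρ) (hl.le.trans hρ.out.le) u = 0) : u = 0 := by
  have h1 : embV u = 0 := eq_zero_of_evalV_eq_zero (ρ := ρ) fun lam hl => by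
    rw [evalV_embV]; exact h lam hl
  ext k
  rw [← embV_apply_natCast, h1]
  rfl

/-! ### The loop space -/

/-- The coefficients of a loop, normalised, as a summable family. -/
def PlusLoop.toL1 : PlusLoop ρ ≃ₗᵢ[ℝ] L1 ℕ where
  toFun h := ⟨fun k => h.coeff k * ρ ^ k, by
    refine memℓp_gen ?_
    simpa [abs_mul] using h.summable_coeff⟩
  invFun f := ⟨fun k => f k * (ρ ^ k)⁻¹, by
    have := f.summable_abs
    refine this.congr fun k => ?_
    have hk : 0 < ρ ^ k := pow_pos rho_pos k
    rw [abs_mul, ← abs_pow, mul_assoc, ← abs_mul, inv_mul_cancel₀ hk.ne', abs_one, mul_one]⟩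
  map_add' f g := by
    ext k
    exact add_mul (f.coeff k) (g.coeff k) (ρ ^ k)
  map_smul' c f := by
    ext k
    exact mul_assoc c (f.coeff k) (ρ ^ k)
  left_inv h := PlusLoop.ext fun k =>
    mul_inv_cancel_right₀ (pow_pos rho_pos k).ne' (h.coeff k)
  right_inv f := by
    ext k
    exact inv_mul_cancel_right₀ (pow_pos rho_pos k).ne' (f k)
  norm_map' h := by
    rw [L1.norm_eq, PlusLoop.norm_def]
    refine tsum_congr fun k => ?_
    change |h.coeff k * ρ ^ k| = _
    rw [abs_mul, abs_pow]

theorem PlusLoop.toL1_apply (h : PlusLoop ρ) (k : ℕ) : toL1 h k = h.coeff k * ρ ^ k := rfl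

theorem PlusLoop.eval_eq (h : PlusLoop ρ) {lam : ℂ} (hl : ‖lam‖ ≤ ρ) :
    h.eval lam = evalU hl (toL1 h) := by
  rw [evalU, L1.lift_apply, PlusLoop.eval]
  refine tsum_congr fun k => ?_
  have : (ρ : ℂ) ^ k ≠ 0 := pow_ne_zero _ (by exact_mod_cast (rho_pos (ρ := ρ)).ne')
  rw [PlusLoop.toL1_apply, Complex.real_smul]
  push_cast
  field_simp

instance : CompleteSpace (PlusLoop ρ) :=
  (completeSpace_congr (e := (PlusLoop.toL1 (ρ := ρ)).toEquiv)
    PlusLoop.toL1.isometry.isUniformEmbedding).2 inferInstance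

end Weight

/-! ### Linear differential equations on the unit interval -/

/-- `Ψ` solves `Ψ' = Ψ A` on `[0, 1]`, with initial value `1`. -/
def IsPrincipal (A Ψ : ℝ → Matrix (Fin 2) (Fin 2) ℂ) : Prop :=
  Ψ 0 = 1 ∧ ∀ s ∈ Set.Icc (0 : ℝ) 1, ∀ i j,
    HasDerivWithinAt (fun u => Ψ u i j) ((Ψ s * A s) i j) (Set.Icc 0 1) s

theorem IsPrincipal.unique {A Ψ Ψ' : ℝ → Matrix (Fin 2) (Fin 2) ℂ}
    (hA : ∀ i j, Continuous fun s => A s i j) (h : IsPrincipal A Ψ) (h' : IsPrincipal A Ψ') :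
    Ψ 1 = Ψ' 1 := by
  have hb : ∀ i j, ∃ C, ∀ s ∈ Set.Icc (0 : ℝ) 1, ‖A s i j‖ ≤ C := fun i j =>
    isCompact_Icc.exists_bound_of_continuousOn (hA i j).continuousOn
  choose C hC using hb
  let K : ℝ := ∑ i, ∑ j, |C i j|
  have hK : ∀ s ∈ Set.Icc (0 : ℝ) 1, ∀ i j, ‖A s i j‖ ≤ K := fun s hs i j =>
    ((hC i j s hs).trans (le_abs_self _)).trans <|
      (Finset.single_le_sum (f := fun j => |C i j|) (fun _ _ => abs_nonneg _)
        (Finset.mem_univ j)).trans <|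
      Finset.single_le_sum (f := fun i => ∑ j, |C i j|)
        (fun _ _ => Finset.sum_nonneg fun _ _ => abs_nonneg _) (Finset.mem_univ i)
  have hK0 : 0 ≤ K := Finset.sum_nonneg fun _ _ => Finset.sum_nonneg fun _ _ => abs_nonneg _
  -- The equation is read in `Fin 2 → Fin 2 → ℂ` with the sup norm. An entry of the product has two
  -- summands, each bounded through `K`, which explains the Lipschitz constant `2 * K`.
  let v : ℝ → (Fin 2 → Fin 2 → ℂ) → Fin 2 → Fin 2 → ℂ := fun s M i j => ∑ k, M i k * A s k j
  have hv : ∀ s ∈ Set.Ico (0 : ℝ) 1,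
      LipschitzOnWith (Real.toNNReal (2 * K)) (v s) Set.univ := by
    intro s hs
    rw [lipschitzOnWith_univ]
    refine LipschitzWith.of_dist_le_mul fun M M' => ?_
    rw [dist_eq_norm, dist_eq_norm, Real.coe_toNNReal _ (by positivity)]
    refine (pi_norm_le_iff_of_nonneg (by positivity)).2 fun i => ?_
    refine (pi_norm_le_iff_of_nonneg (by positivity)).2 fun j => ?_
    have : (v s M - v s M') i j = ∑ k, (M - M') i k * A s k j := by
      simp [v, sub_mul, Finset.sum_sub_distrib]
    rw [this]
    refine (norm_sum_le _ _).trans ?_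
    have : ∀ k ∈ Finset.univ, ‖(M - M') i k * A s k j‖ ≤ ‖M - M'‖ * K := fun k _ => by
      rw [norm_mul]
      exact mul_le_mul ((norm_le_pi_norm _ k).trans (norm_le_pi_norm (M - M') i))
        (hK s ⟨hs.1, hs.2.le⟩ k j) (norm_nonneg _) (norm_nonneg _)
    refine (Finset.sum_le_sum this).trans (le_of_eq ?_)
    simp
    ring
  have aux : ∀ Ψ, IsPrincipal A Ψ →
      ContinuousOn (fun s => (fun i j => Ψ s i j : Fin 2 → Fin 2 → ℂ)) (Set.Icc 0 1) ∧
      ∀ s ∈ Set.Ico (0 : ℝ) 1, HasDerivWithinAt (fun s => (fun i j => Ψ s i j : Fin 2 → Fin 2 → ℂ))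
        (v s (fun i j => Ψ s i j)) (Set.Ici s) s := by
    intro Ψ hΨ
    have hd : ∀ s ∈ Set.Icc (0 : ℝ) 1,
        HasDerivWithinAt (fun s => (fun i j => Ψ s i j : Fin 2 → Fin 2 → ℂ))
        (v s (fun i j => Ψ s i j)) (Set.Icc 0 1) s := fun s hs => by
      rw [hasDerivWithinAt_pi]
      intro i
      rw [hasDerivWithinAt_pi]
      intro j
      have := hΨ.2 s hs i j
      rwa [Matrix.mul_apply] at this
    refine ⟨fun s hs => (hd s hs).continuousWithinAt, fun s hs => ?_⟩
    exact (hd s ⟨hs.1, hs.2.le⟩).mono_of_mem_nhdsWithin (Icc_mem_nhdsGE_of_mem hs)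
  have := ODE_solution_unique_of_mem_Icc_right hv (aux Ψ h).1 (aux Ψ h).2 (fun _ _ => trivial)
    (aux Ψ' h').1 (aux Ψ' h').2 (fun _ _ => trivial) (by simp [h.1, h'.1])
    (Set.right_mem_Icc.2 zero_le_one)
  ext i j
  exact congrFun (congrFun this i) j

/-- `principalSolution` is a choice among possible end values: an explicit solution shows that the
choice is made from a nonempty set, and uniqueness identifies it. -/
theorem principalSolution_eq {A Ψ : ℝ → Matrix (Fin 2) (Fin 2) ℂ}
    {N : ℂ → Matrix (Fin 2) (Fin 2) ℂ} {w : ℂ} (hA : ∀ i j, Continuous fun s => A s i j)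
    (hN : ∀ s : ℝ, w • N (s * w) = A s) (h : IsPrincipal A Ψ) :
    principalSolution N w = Ψ 1 := by
  have key : ∀ Ψ : ℝ → Matrix (Fin 2) (Fin 2) ℂ, ∀ s i j,
      w * (Ψ s * N (s * w)) i j = (Ψ s * A s) i j := fun Ψ s i j => by
    rw [← hN, Matrix.mul_smul, Matrix.smul_apply, smul_eq_mul]
  have hex : ∃ M, ∃ Ψ : ℝ → Matrix (Fin 2) (Fin 2) ℂ, Ψ 0 = 1 ∧ Ψ 1 = M ∧
      ∀ s ∈ Set.Icc (0 : ℝ) 1, ∀ i j, HasDerivWithinAt (fun u => Ψ u i j)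
        (w * (Ψ s * N (s * w)) i j) (Set.Icc 0 1) s :=
    ⟨_, Ψ, h.1, rfl, fun s hs i j => by rw [key]; exact h.2 s hs i j⟩
  obtain ⟨Ψ', h0, h1, h2⟩ := Classical.epsilon_spec hex
  rw [principalSolution, ← h1]
  exact IsPrincipal.unique hA ⟨h0, fun s hs i j => by rw [← key]; exact h2 s hs i j⟩ h

/-! ### The potential in real form, for `φ = π / 4` -/

/-- `ω_a 𝔪_a = α_1 μ_1`, `ω_b 𝔪_b = α_2 μ_2`, `ω_c 𝔪_c = α_3 μ_3` on `[0, 1]`. -/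
def alpha : Fin 3 → ℝ → ℝ :=
  ![fun s => 4 * s / (1 + s ^ 4), fun s => 2 * √2 * (s ^ 2 - 1) / (1 + s ^ 4),
    fun s => 2 * √2 * (s ^ 2 + 1) / (1 + s ^ 4)]

/-- The real matrices `μ_1`, `μ_2`, `μ_3`. -/
def mu : Fin 3 → Matrix (Fin 2) (Fin 2) ℝ :=
  ![!![-1, 0; 0, 1], !![0, 1; 1, 0], !![0, -1; 1, 0]]

theorem continuous_alpha (l : Fin 3) : Continuous (alpha l) := by
  have h : ∀ s : ℝ, 1 + s ^ 4 ≠ 0 := fun s => by positivity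
  fin_cases l <;> simp only [alpha] <;> exact Continuous.div (by fun_prop) (by fun_prop) h

/-- `∑_l w_l α_l μ_l`. -/
def realPotential (w : Fin 3 → ℂ) (s : ℝ) : Matrix (Fin 2) (Fin 2) ℂ :=
  Matrix.of fun i j => ∑ l, w l * (alpha l s : ℂ) * (mu l i j : ℂ)

theorem realPotential_apply (w : Fin 3 → ℂ) (s : ℝ) (i j : Fin 2) :
    realPotential w s i j = ∑ l, w l * (alpha l s : ℂ) * (mu l i j : ℂ) := rfl

theorem continuous_realPotential (w : Fin 3 → ℂ) (i j : Fin 2) :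
    Continuous fun s => realPotential w s i j := by
  have := continuous_alpha
  simp only [realPotential, Matrix.of_apply]
  fun_prop

theorem sqrt_two_sq : ((√2 : ℝ) : ℂ) ^ 2 = 2 := by
  rw [← Complex.ofReal_pow, Real.sq_sqrt zero_le_two]; simp

theorem exp_I_mul_pi_div_four :
    Complex.exp (Complex.I * ((Real.pi / 4 : ℝ) : ℂ)) = ((√2 : ℝ) : ℂ) / 2 * (1 + Complex.I) := by
  rw [mul_comm, Complex.exp_mul_I, ← Complex.ofReal_cos, ← Complex.ofReal_sin, Real.cos_pi_div_four,
    Real.sin_pi_div_four]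
  push_cast
  ring

theorem exp_neg_I_mul_pi_div_four :
    Complex.exp (-(Complex.I * ((Real.pi / 4 : ℝ) : ℂ))) =
      ((√2 : ℝ) : ℂ) / 2 * (1 - Complex.I) := by
  rw [← mul_neg, mul_comm, ← Complex.ofReal_neg, Complex.exp_mul_I, ← Complex.ofReal_cos,
    ← Complex.ofReal_sin, Real.cos_neg, Real.sin_neg, Real.cos_pi_div_four,
    Real.sin_pi_div_four]
  push_cast
  ring

/-- For `φ = π/4` the punctures are the four roots of `u⁴ = -1`, so all the partial fractions share
the denominator `z⁴ + 1`. -/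
theorem inv_sub_eq {z u : ℂ} (hz : z ^ 4 + 1 ≠ 0) (hu : u ^ 4 = -1) :
    (z - u)⁻¹ = (z + u) * (z ^ 2 + u ^ 2) / (z ^ 4 + 1) := by
  have h : (z - u) * ((z + u) * (z ^ 2 + u ^ 2)) = z ^ 4 + 1 := by linear_combination -hu
  rw [← h] at hz ⊢
  have h1 := left_ne_zero_of_mul hz
  have h2 := right_ne_zero_of_mul hz
  rw [eq_div_iff hz, inv_mul_cancel_left₀ h1]

theorem omega_eq {z : ℂ} (hz : z ^ 4 + 1 ≠ 0) (l : Fin 3) :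
    omega (Real.pi / 4) l z = ![4 * Complex.I * z, 2 * (√2 : ℝ) * (z ^ 2 - 1),
      2 * (√2 : ℝ) * Complex.I * (z ^ 2 + 1)] l / (z ^ 4 + 1) := by
  have hI := Complex.I_sq
  have h2 := sqrt_two_sq
  have hp2 : (((√2 : ℝ) : ℂ) / 2 * (1 + Complex.I)) ^ 2 = Complex.I := by
    linear_combination (1 + 2 * Complex.I + Complex.I ^ 2) / 4 * h2 + hI / 2
  have hq2 : (((√2 : ℝ) : ℂ) / 2 * (1 - Complex.I)) ^ 2 = -Complex.I := by
    linear_combination (1 - 2 * Complex.I + Complex.I ^ 2) / 4 * h2 + hI / 2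
  have hp4 : (((√2 : ℝ) : ℂ) / 2 * (1 + Complex.I)) ^ 4 = -1 := by
    rw [pow_mul _ 2 2, hp2, hI]
  have hq4 : (((√2 : ℝ) : ℂ) / 2 * (1 - Complex.I)) ^ 4 = -1 := by
    rw [pow_mul _ 2 2, hq2, neg_sq, hI]
  fin_cases l <;>
  simp only [omega, puncture, exp_I_mul_pi_div_four, exp_neg_I_mul_pi_div_four, Fin.zero_eta,
    Fin.mk_one, Fin.reduceFinMk, Matrix.cons_val] <;>
  rw [inv_sub_eq hz hp4, inv_sub_eq hz ((Even.neg_pow (by decide) _).trans hq4),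
    inv_sub_eq hz ((Even.neg_pow (by decide) _).trans hp4), inv_sub_eq hz hq4, neg_sq, neg_sq,
    hp2, hq2] <;>
  field_simp <;> ring_nf <;> simp only [Complex.I_sq] <;> ring

theorem ofReal_pow_four_add_one_ne_zero (s : ℝ) : (s : ℂ) ^ 4 + 1 ≠ 0 := by
  have : s ^ 4 + 1 ≠ 0 := by positivity
  exact_mod_cast this

/-- On the real axis a factor `i` in `ω` meets a factor `i` in `𝔪`, so the product is real. This is
why the monodromy has real Fourier coefficients and can live in `L1 ℤ`. -/
theorem omega_smul_frakM (l : Fin 3) (s : ℝ) (i j : Fin 2) :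
    omega (Real.pi / 4) l s * frakM l i j = (alpha l s : ℂ) * (mu l i j : ℂ) := by
  have h := ofReal_pow_four_add_one_ne_zero s
  rw [omega_eq h]
  rw [add_comm] at h
  fin_cases l <;> fin_cases i <;> fin_cases j <;>
    simp [alpha, mu, frakM, add_comm ((s : ℂ) ^ 4) 1] <;>
    field_simp <;> ring_nf <;> simp only [Complex.I_sq] <;> ring

variable {ρ : ℝ}

theorem potential_apply (φ t : ℝ) (x : Param ρ) (lam z : ℂ) (i j : Fin 2) :
    potential φ t x lam z i j = ∑ l, ((x.r * t : ℝ) : ℂ) * abc φ x lam l *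
      (omega φ l z * frakM l i j) := by
  simp only [potential, omega, Fin.sum_univ_four, Fin.sum_univ_three]
  generalize (z - puncture φ 0)⁻¹ = z0
  generalize (z - puncture φ 1)⁻¹ = z1
  generalize (z - puncture φ 2)⁻¹ = z2
  generalize (z - puncture φ 3)⁻¹ = z3
  fin_cases i <;> fin_cases j <;> simp [residue, frakM] <;> ring

theorem calP_eq {t : ℝ} {x : Param ρ} {lam : ℂ} {Ψ : ℝ → Matrix (Fin 2) (Fin 2) ℂ}
    (h : IsPrincipal
      (realPotential fun l => ((x.r * t : ℝ) : ℂ) * abc (Real.pi / 4) x lam l) Ψ) :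
    calP (Real.pi / 4) t x lam = Ψ 1 := by
  refine principalSolution_eq (continuous_realPotential _) (fun s => ?_) h
  ext i j
  simp only [mul_one, one_smul, potential_apply, omega_smul_frakM, realPotential, Matrix.of_apply,
    mul_assoc]

/-- Conjugation by `diag(e^{iπ/4}, e^{-iπ/4})`, and its effect on the second half of the
fundamental domain. -/
theorem calQ_eq {t : ℝ} {x : Param ρ} {lam : ℂ} {Ψ : ℝ → Matrix (Fin 2) (Fin 2) ℂ}
    (h : IsPrincipal (realPotential fun l => -(((x.r * t : ℝ) : ℂ) *
      ![abc (Real.pi / 4) x lam 0, abc (Real.pi / 4) x lam 2, abc (Real.pi / 4) x lam 1] l)) Ψ) :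
    calQ (Real.pi / 4) t x lam =
      !![Ψ 1 0 0, -(Complex.I * Ψ 1 0 1); Complex.I * Ψ 1 1 0, Ψ 1 1 1] := by
  -- Conjugation by a diagonal matrix with entries `d` multiplies the entry `(i, j)` by `c i j = d j
  -- / d i`; the cocycle relation `hc` makes this entrywise operation compatible with matrix
  -- products.
  let c : Fin 2 → Fin 2 → ℂ := ![![1, -Complex.I], ![Complex.I, 1]]
  have hc : ∀ i k j, c i k * c k j = c i j := by
    intro i k j
    fin_cases i <;> fin_cases k <;> fin_cases j <;> simp [c]
  set A := realPotential fun l => -(((x.r * t : ℝ) : ℂ) *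
      ![abc (Real.pi / 4) x lam 0, abc (Real.pi / 4) x lam 2, abc (Real.pi / 4) x lam 1] l) with hA
  have h' : IsPrincipal (fun s => Matrix.of fun i j => c i j * A s i j)
      (fun s => Matrix.of fun i j => c i j * Ψ s i j) := by
    refine ⟨?_, fun s hs i j => ?_⟩
    · ext i j
      fin_cases i <;> fin_cases j <;> simp [c, h.1]
    · have := (h.2 s hs i j).const_mul (c i j)
      refine HasDerivWithinAt.congr_deriv this ?_
      simp only [Matrix.mul_apply, Matrix.of_apply, Finset.mul_sum]
      refine Finset.sum_congr rfl fun k _ => ?_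
      rw [← hc i k j]
      ring
  have := principalSolution_eq (N := potential (Real.pi / 4) t x lam) (w := Complex.I)
    (fun i j => (continuous_realPotential _ i j).const_mul (c i j)) (fun s => ?_) h'
  · rw [calQ, this]
    ext i j
    fin_cases i <;> fin_cases j <;> simp [c]
  · ext i j
    have hs := ofReal_pow_four_add_one_ne_zero s
    have hs' : ((s : ℂ) * Complex.I) ^ 4 + 1 ≠ 0 := by
      rwa [mul_pow, Complex.I_pow_four, mul_one]
    have h4 : ((s : ℂ) * Complex.I) ^ 4 = s ^ 4 := by rw [mul_pow, Complex.I_pow_four, mul_one]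
    rw [Matrix.smul_apply, potential_apply]
    refine Eq.trans ?_ (congrArg (c i j * ·) (realPotential_apply _ s i j).symm)
    simp only [omega_eq hs', h4, Fin.sum_univ_three]
    rw [add_comm] at hs
    generalize ((x.r * t : ℝ) : ℂ) = y
    fin_cases i <;> fin_cases j <;>
    simp [alpha, mu, frakM, c, add_comm ((s : ℂ) ^ 4) 1, mul_pow] <;>
    field_simp <;> ring_nf <;> simp only [Complex.I_sq, Complex.I_pow_four] <;>
    ring

/-! ### The fundamental solution with values in the loop space -/

section Volterra

variable {Z : Type*} [NormedAddCommGroup Z]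

/-- The extension of a function on the unit interval to the real line, constant outside of it. -/
def extend (f : C(unitInterval, Z)) (u : ℝ) : Z := f (Set.projIcc 0 1 zero_le_one u)

theorem continuous_extend (f : C(unitInterval, Z)) : Continuous (extend f) :=
  f.continuous.comp continuous_projIcc

theorem extend_of_mem (f : C(unitInterval, Z)) {u : ℝ} (hu : u ∈ Set.Icc (0 : ℝ) 1) :
    extend f u = f ⟨u, hu⟩ := by rw [extend, Set.projIcc_of_mem]

theorem norm_extend_le (f : C(unitInterval, Z)) (u : ℝ) : ‖extend f u‖ ≤ ‖f‖ :=
  f.norm_coe_le_norm _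

variable [NormedSpace ℝ Z]

/-- The primitive which vanishes at `0`. -/
def primitive (Z : Type*) [NormedAddCommGroup Z] [NormedSpace ℝ Z] :
    C(unitInterval, Z) →L[ℝ] C(unitInterval, Z) :=
  LinearMap.mkContinuous
    { toFun := fun f => ⟨fun s => ∫ u in (0 : ℝ)..s, extend f u,
        (intervalIntegral.continuous_primitive
          (fun a b => (continuous_extend f).intervalIntegrable a b) 0).comp
          continuous_subtype_val⟩
      map_add' := fun f g => by
        ext s
        exact intervalIntegral.integral_add ((continuous_extend f).intervalIntegrable _ _)
          ((continuous_extend g).intervalIntegrable _ _)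
      map_smul' := fun c f => by
        ext s
        exact intervalIntegral.integral_smul c (extend f) } 1 fun f => by
    rw [one_mul, ContinuousMap.norm_le _ (norm_nonneg _)]
    intro s
    have := intervalIntegral.norm_integral_le_of_norm_le_const (a := 0) (b := (s : ℝ))
      (C := ‖f‖) (f := extend f) fun u _ => norm_extend_le f u
    refine this.trans (mul_le_of_le_one_right (norm_nonneg _) ?_)
    rw [sub_zero, abs_of_nonneg s.2.1]
    exact s.2.2

theorem primitive_apply (f : C(unitInterval, Z)) (s : unitInterval) :
    primitive Z f s = ∫ u in (0 : ℝ)..s, extend f u := rfl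

/-- The pointwise action of a bilinear map, with a scalar weight. -/
def pointwise {E : Type*} [NormedAddCommGroup E] [NormedSpace ℝ E] (a : C(unitInterval, ℝ))
    (B : E →L[ℝ] Z →L[ℝ] Z) : E →L[ℝ] C(unitInterval, Z) →L[ℝ] C(unitInterval, Z) :=
  LinearMap.mkContinuous₂
    (LinearMap.mk₂ ℝ (fun w f => (⟨fun s => a s • B w (f s), by fun_prop⟩ : C(unitInterval, Z)))
      (fun w w' f => by ext s; simp) (fun c w f => by ext s; simp [smul_comm c])
      (fun w f f' => by ext s; simp) (fun c w f => by ext s; simp [smul_comm c])) (‖a‖ * ‖B‖)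
    fun w f => by
      rw [ContinuousMap.norm_le _ (by positivity)]
      intro s
      change ‖a s • B w (f s)‖ ≤ _
      rw [norm_smul, mul_assoc, mul_assoc]
      refine mul_le_mul (a.norm_coe_le_norm s) ?_ (norm_nonneg _) (norm_nonneg _)
      rw [← mul_assoc]
      exact (B.le_opNorm₂ w (f s)).trans
        (mul_le_mul_of_nonneg_left (f.norm_coe_le_norm s) (by positivity))

end Volterra

section Fundamental

/-- Continuous functions on the unit interval with values in the loops. -/
def LoopPath : Type := C(unitInterval, L1 ℤ)

instance : NormedAddCommGroup LoopPath := inferInstanceAs (NormedAddCommGroup C(unitInterval, L1 ℤ))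
instance : NormedSpace ℝ LoopPath := inferInstanceAs (NormedSpace ℝ C(unitInterval, L1 ℤ))
instance : CompleteSpace LoopPath := inferInstanceAs (CompleteSpace C(unitInterval, L1 ℤ))

/-- `2 × 2` matrices of continuous functions on the unit interval, with values in the loops. -/
def Path : Type := Fin 2 → Fin 2 → LoopPath

instance : NormedAddCommGroup Path := inferInstanceAs (NormedAddCommGroup (Fin 2 → Fin 2 → LoopPath))
instance : NormedSpace ℝ Path := inferInstanceAs (NormedSpace ℝ (Fin 2 → Fin 2 → LoopPath))
instance : CompleteSpace Path := inferInstanceAs (CompleteSpace (Fin 2 → Fin 2 → LoopPath))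

/-- The value of a path of loops. -/
def LoopPath.at (s : unitInterval) : LoopPath →L[ℝ] L1 ℤ :=
  (ContinuousMap.evalCLM ℝ s : C(unitInterval, L1 ℤ) →L[ℝ] L1 ℤ)

/-- The extension of a path of loops to the real line, constant outside of the unit interval. -/
def LoopPath.ext (f : LoopPath) (u : ℝ) : L1 ℤ := f.at (Set.projIcc 0 1 zero_le_one u)

/-- The entries of a path. -/
def Path.entry (i j : Fin 2) : Path →L[ℝ] LoopPath :=
  (ContinuousLinearMap.proj (R := ℝ) (φ := fun _ : Fin 2 => LoopPath) j).comp
    (ContinuousLinearMap.proj (R := ℝ) (φ := fun _ : Fin 2 => Fin 2 → LoopPath) i)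

/-- The path with a single nonzero entry. -/
def Path.single (i j : Fin 2) : LoopPath →L[ℝ] Path :=
  (ContinuousLinearMap.single ℝ (fun _ : Fin 2 => Fin 2 → LoopPath) i).comp
    (ContinuousLinearMap.single ℝ (fun _ : Fin 2 => LoopPath) j)

theorem Path.entry_single (i j i' j' : Fin 2) (f : LoopPath) :
    entry i' j' (single i j f) = if i' = i ∧ j' = j then f else 0 := by
  change (Pi.single i (Pi.single j f) : Fin 2 → Fin 2 → LoopPath) i' j' = _
  by_cases h : i' = i
  · subst h
    by_cases h' : j' = j
    · subst h'
      simp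
    · simp [h']
  · simp [h]

variable (ρ : ℝ) [hρ : Fact (1 < ρ)]

/-- The integral operator `f ↦ ∫ α_l v f`. -/
def volterraScalar (l : Fin 3) : L1 ℤ →L[ℝ] LoopPath →L[ℝ] LoopPath :=
  (ContinuousLinearMap.compL ℝ C(unitInterval, L1 ℤ) _ _ (primitive (L1 ℤ))).comp
    (pointwise ⟨fun s => alpha l s, (continuous_alpha l).comp continuous_subtype_val⟩ (mulV ρ))

/-- The integral operator `Ψ ↦ ∫ Ψ ∑_l w_l α_l μ_l`. -/
def volterra : (Fin 3 → L1 ℤ) →L[ℝ] Path →L[ℝ] Path :=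
  ∑ i : Fin 2, ∑ j : Fin 2, ∑ k : Fin 2, ∑ l : Fin 3, mu l k j •
    ((ContinuousLinearMap.compL ℝ Path LoopPath Path (Path.single i j)).comp
    (((ContinuousLinearMap.compL ℝ Path LoopPath LoopPath).flip (Path.entry i k)).comp
    ((volterraScalar ρ l).comp
      (ContinuousLinearMap.proj (R := ℝ) (φ := fun _ : Fin 3 => L1 ℤ) l))))

variable {ρ}

theorem volterraScalar_apply (l : Fin 3) (v : L1 ℤ) (f : LoopPath) (s : unitInterval) :
    (volterraScalar ρ l v f).at s =
      ∫ u in (0 : ℝ)..s, alpha l u • mulV ρ v (f.ext u) := by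
  change primitive (L1 ℤ) (pointwise ⟨fun s => alpha l s,
    (continuous_alpha l).comp continuous_subtype_val⟩ (mulV ρ) v f) s = _
  rw [primitive_apply]
  refine intervalIntegral.integral_congr fun u hu => ?_
  rw [Set.uIcc_of_le s.2.1] at hu
  have hu' : u ∈ Set.Icc (0 : ℝ) 1 := ⟨hu.1, hu.2.trans s.2.2⟩
  rw [extend_of_mem _ hu', LoopPath.ext, Set.projIcc_of_mem _ hu']
  rfl

theorem LoopPath.continuous_ext (f : LoopPath) : Continuous f.ext :=
  continuous_extend (Z := L1 ℤ) f

theorem LoopPath.ext_of_mem (f : LoopPath) {u : ℝ} (hu : u ∈ Set.Icc (0 : ℝ) 1) :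
    f.ext u = f.at ⟨u, hu⟩ := extend_of_mem (Z := L1 ℤ) f hu

theorem entry_volterra (w : Fin 3 → L1 ℤ) (Ψ : Path) (i j : Fin 2) :
    Path.entry i j (volterra ρ w Ψ) =
      ∑ k, ∑ l, mu l k j • volterraScalar ρ l (w l) (Path.entry i k Ψ) := by
  simp only [volterra, sum_apply, smul_apply, map_sum, map_smul,
    ContinuousLinearMap.comp_apply, ContinuousLinearMap.compL_apply,
    ContinuousLinearMap.flip_apply, ContinuousLinearMap.proj_apply, Path.entry_single]
  rw [Finset.sum_eq_single i, Finset.sum_eq_single j]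
  · simp
  · intro b _ hb
    simp [hb.symm]
  · simp
  · intro b _ hb
    simp [hb.symm]
  · simp

/-- The constant path of loops. -/
def LoopPath.const (v : L1 ℤ) : LoopPath := ContinuousMap.const unitInterval v

theorem LoopPath.at_const (v : L1 ℤ) (s : unitInterval) : (const v).at s = v := rfl

/-- The constant path `1`. -/
def onePath : Path := fun i j => if i = j then LoopPath.const (L1.basis 0) else 0

theorem onePath_at (i j : Fin 2) (s : unitInterval) :
    (Path.entry i j onePath).at s = if i = j then L1.basis 0 else 0 := by
  change LoopPath.at s (if i = j then LoopPath.const (L1.basis 0) else 0) = _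
  split_ifs
  · exact LoopPath.at_const _ s
  · exact map_zero _

/-- The region in which the Neumann series converges. -/
def small (ρ : ℝ) [Fact (1 < ρ)] : Set (Fin 3 → L1 ℤ) := {w | ‖volterra ρ w‖ < 1}

theorem isOpen_small : IsOpen (small ρ) :=
  isOpen_lt (by fun_prop) continuous_const

theorem zero_mem_small : (0 : Fin 3 → L1 ℤ) ∈ small ρ := by simp [small]

/-- The fundamental solution. -/
def fundSol (ρ : ℝ) [Fact (1 < ρ)] (w : Fin 3 → L1 ℤ) : Path :=
  Ring.inverse (1 - volterra ρ w) onePath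

theorem isUnit_of_mem_small {w : Fin 3 → L1 ℤ} (hw : w ∈ small ρ) :
    IsUnit (1 - volterra ρ w) := isUnit_one_sub_of_norm_lt_one hw

theorem fundSol_eq {w : Fin 3 → L1 ℤ} (hw : w ∈ small ρ) :
    fundSol ρ w = onePath + volterra ρ w (fundSol ρ w) := by
  have := Ring.mul_inverse_cancel _ (isUnit_of_mem_small hw)
  have h2 := congrArg (fun T : Path →L[ℝ] Path => T onePath) this
  simp only [mul_apply_eq_comp, sub_apply,
    one_apply_eq_self] at h2
  exact sub_eq_iff_eq_add.1 h2

theorem fundSol_zero : fundSol ρ 0 = onePath := by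
  simp [fundSol]

/-- `volterra ρ w` is bounded and linear in `w`, and inversion is smooth at units of the Banach
algebra of operators, so smooth dependence needs no estimate on the differential equation. -/
theorem contDiffAt_fundSol {w : Fin 3 → L1 ℤ} (hw : w ∈ small ρ) :
    ContDiffAt ℝ ∞ (fundSol ρ) w := by
  have h1 : ContDiffAt ℝ ∞ (fun w => Ring.inverse (1 - volterra ρ w)) w := by
    have := contDiffAt_ringInverse ℝ (n := ∞) (isUnit_of_mem_small hw).unit
    exact ContDiffAt.comp w (g := Ring.inverse) this (by fun_prop)
  exact h1.clm_apply contDiffAt_const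

variable {lam : ℂ} (hl : lam ∈ annulus ρ)

include hl in
theorem evalV_volterraScalar (l : Fin 3) (v : L1 ℤ) (f : LoopPath)
    (s : unitInterval) : evalV hl ((volterraScalar ρ l v f).at s) =
      ∫ u in (0 : ℝ)..s, alpha l u * (evalV hl v * evalV hl (f.ext u)) := by
  have h1 := continuous_alpha l
  have h2 := f.continuous_ext
  rw [volterraScalar_apply, ← ContinuousLinearMap.intervalIntegral_comp_comm _
    (Continuous.intervalIntegrable (by fun_prop) _ _)]
  refine intervalIntegral.integral_congr fun u _ => ?_
  simp only [map_smul, evalV_mulV, Complex.real_smul]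

theorem evalV_basis_zero : evalV hl (L1.basis 0) = 1 := by
  simp [evalV_basis, wt]

theorem evalV_onePath (i j : Fin 2) (s : unitInterval) :
    evalV hl ((Path.entry i j onePath).at s) = (1 : Matrix (Fin 2) (Fin 2) ℂ) i j := by
  rw [onePath_at, Matrix.one_apply]
  split_ifs
  · exact evalV_basis_zero hl
  · simp

/-- Evaluation is continuous, linear and multiplicative, so it carries the integral equation
`fundSol_eq` for loops to a scalar one, which is then differentiated. -/
theorem isPrincipal_evalV_fundSol {w : Fin 3 → L1 ℤ} (hw : w ∈ small ρ) :
    IsPrincipal (realPotential fun l => evalV hl (w l))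
      (fun s => Matrix.of fun i j => evalV hl ((Path.entry i j (fundSol ρ w)).ext s)) := by
  set Φ := fundSol ρ w with hΦ
  have hΦ' : Φ = onePath + volterra ρ w Φ := fundSol_eq hw
  have hcont : ∀ i k l, Continuous fun u : ℝ =>
      (alpha l u : ℂ) * (evalV hl (w l) * evalV hl ((Path.entry i k Φ).ext u)) := fun i k l => by
    have h1 := continuous_alpha l
    have h2 := (Path.entry i k Φ).continuous_ext
    fun_prop
  have key : ∀ s ∈ Set.Icc (0 : ℝ) 1, ∀ i j, evalV hl ((Path.entry i j Φ).ext s) =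
      (1 : Matrix (Fin 2) (Fin 2) ℂ) i j + ∑ k, ∑ l, (mu l k j : ℂ) *
        ∫ u in (0 : ℝ)..s, alpha l u * (evalV hl (w l) * evalV hl ((Path.entry i k Φ).ext u)) := by
    intro s hs i j
    rw [LoopPath.ext_of_mem _ hs]
    conv_lhs => rw [hΦ']
    simp only [map_add, evalV_onePath, entry_volterra, map_sum, map_smul, evalV_volterraScalar,
      Complex.real_smul]
  refine ⟨?_, fun s hs i j => ?_⟩
  · ext i j
    refine (key 0 (by simp) i j).trans ?_
    simp
  · have hd : HasDerivWithinAt (fun s : ℝ => (1 : Matrix (Fin 2) (Fin 2) ℂ) i j +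
        ∑ k, ∑ l, (mu l k j : ℂ) *
        ∫ u in (0 : ℝ)..s, alpha l u * (evalV hl (w l) * evalV hl ((Path.entry i k Φ).ext u)))
        (∑ k, ∑ l, (mu l k j : ℂ) * (alpha l s * (evalV hl (w l) * evalV hl ((Path.entry i k Φ).ext s))))
        (Set.Icc 0 1) s := by
      refine HasDerivWithinAt.const_add _ (HasDerivWithinAt.fun_sum fun k _ =>
        HasDerivWithinAt.fun_sum fun l _ => HasDerivWithinAt.const_mul _
          (HasDerivAt.hasDerivWithinAt ?_))
      exact intervalIntegral.integral_hasDerivAt_right ((hcont i k l).intervalIntegrable _ _)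
        ((hcont i k l).stronglyMeasurableAtFilter _ _) (hcont i k l).continuousAt
    refine (hd.congr_of_mem (fun u hu => key u hu i j) hs).congr_deriv ?_
    rw [Matrix.mul_apply]
    refine Finset.sum_congr rfl fun k _ => ?_
    rw [realPotential_apply, Finset.mul_sum]
    refine Finset.sum_congr rfl fun l _ => ?_
    change _ = evalV hl ((Path.entry i k Φ).ext s) * _
    ring

/-! ### Divided differences of the monodromy -/

/-- `(𝒫 - 1) / t` for the potential with coefficients `t w`. -/
def remP (ρ : ℝ) [Fact (1 < ρ)] (t : ℝ) (w : Fin 3 → L1 ℤ) (i j : Fin 2) : L1 ℤ :=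
  (Path.entry i j (volterra ρ w (fundSol ρ (t • w)))).at 1

/-- `𝔭 / t` for the potential with coefficients `t w`. -/
def pHat (ρ : ℝ) [Fact (1 < ρ)] (t : ℝ) (w : Fin 3 → L1 ℤ) : L1 ℤ :=
  remP ρ t w 1 0 - remP ρ t w 0 1 + t • (mulV ρ (remP ρ t w 0 0) (remP ρ t w 1 0) -
    mulV ρ (remP ρ t w 0 1) (remP ρ t w 1 1))

/-- Linearity of `volterra` pulls out the factor `t`. The quotient by `t` is thus given by a formula
that is smooth across `t = 0`. -/
theorem fundSol_smul_apply_one {t : ℝ} {w : Fin 3 → L1 ℤ} (hw : t • w ∈ small ρ) (i j : Fin 2) :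
    (Path.entry i j (fundSol ρ (t • w))).at 1 =
      (Path.entry i j onePath).at 1 + t • remP ρ t w i j := by
  conv_lhs => rw [fundSol_eq hw]
  simp [remP]

theorem contDiffAt_remP {t : ℝ} {w : Fin 3 → L1 ℤ} (hw : t • w ∈ small ρ) (i j : Fin 2) :
    ContDiffAt ℝ ∞ (fun y : ℝ × (Fin 3 → L1 ℤ) => remP ρ y.1 y.2 i j) (t, w) := by
  have h1 : ContDiffAt ℝ ∞ (fun y : ℝ × (Fin 3 → L1 ℤ) => fundSol ρ (y.1 • y.2)) (t, w) :=
    ContDiffAt.comp (t, w) (g := fundSol ρ) (contDiffAt_fundSol hw) (by fun_prop)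
  have h2 : ContDiffAt ℝ ∞
      (fun y : ℝ × (Fin 3 → L1 ℤ) => volterra ρ y.2 (fundSol ρ (y.1 • y.2))) (t, w) := by
    refine ContDiffAt.clm_apply ?_ h1
    fun_prop
  exact ((LoopPath.at 1).comp (Path.entry i j)).contDiff.contDiffAt.comp (t, w) h2

theorem contDiffAt_pHat {t : ℝ} {w : Fin 3 → L1 ℤ} (hw : t • w ∈ small ρ) :
    ContDiffAt ℝ ∞ (fun y : ℝ × (Fin 3 → L1 ℤ) => pHat ρ y.1 y.2) (t, w) := by
  have h := fun i j => contDiffAt_remP (ρ := ρ) hw i j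
  have h00 := h 0 0
  have h01 := h 0 1
  have h10 := h 1 0
  have h11 := h 1 1
  unfold pHat
  have hm : ∀ {f g : ℝ × (Fin 3 → L1 ℤ) → L1 ℤ}, ContDiffAt ℝ ∞ f (t, w) →
      ContDiffAt ℝ ∞ g (t, w) → ContDiffAt ℝ ∞ (fun y => mulV ρ (f y) (g y)) (t, w) :=
    fun hf hg => ((mulV ρ).contDiff.contDiffAt.comp (t, w) hf).clm_apply hg
  exact (h10.sub h01).add (contDiffAt_fst.smul ((hm h00 h10).sub (hm h01 h11)))

theorem mulV_basis_zero (v : L1 ℤ) : mulV ρ v (L1.basis 0) = v := by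
  refine L1.clm_congr (f := (mulV ρ).flip (L1.basis 0)) (g := ContinuousLinearMap.id ℝ _)
    (fun k => ?_) v
  simp [mulV_basis, wt, rho_pos.ne']

/-- Up to the factor `4`, `1 + s⁴` is the product of `1 + (√2 s + 1)²` and `1 + (√2 s - 1)²`, whence
the two arctangents. At `s = 1` their arguments `√2 + 1` and `√2 - 1` are inverse to each other, so
the values add up to `π/2`. -/
theorem integral_alpha_two : ∫ s in (0 : ℝ)..1, alpha 2 s = Real.pi := by
  have h2 : √2 ^ 2 = 2 := Real.sq_sqrt zero_le_two
  have hd : ∀ s ∈ Set.uIcc (0 : ℝ) 1, HasDerivAt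
      (fun s : ℝ => 2 * (Real.arctan (√2 * s + 1) + Real.arctan (√2 * s - 1))) (alpha 2 s) s := by
    intro s _
    have h3 : HasDerivAt (fun s : ℝ => √2 * s + 1) √2 s := by
      simpa using ((hasDerivAt_id s).const_mul √2).add_const 1
    have h4 : HasDerivAt (fun s : ℝ => √2 * s - 1) √2 s := by
      simpa using ((hasDerivAt_id s).const_mul √2).sub_const 1
    refine ((h3.arctan.add h4.arctan).const_mul 2).congr_deriv ?_
    have h5 : 1 + s ^ 4 ≠ 0 := by positivity
    have h6 : 1 + (√2 * s + 1) ^ 2 ≠ 0 := by positivity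
    have h7 : 1 + (√2 * s - 1) ^ 2 ≠ 0 := by positivity
    have h8 : (1 + (√2 * s + 1) ^ 2) * (1 + (√2 * s - 1) ^ 2) = 4 * (1 + s ^ 4) := by
      linear_combination (s ^ 4 * (√2 ^ 2 + 2)) * h2
    simp only [alpha, Matrix.cons_val]
    rw [one_div_mul_eq_div, one_div_mul_eq_div, div_add_div _ _ h6 h7, h8]
    rw [← mul_div_assoc, div_eq_div_iff (by positivity) h5]
    linear_combination (4 * √2 * s ^ 2 * (1 + s ^ 4)) * h2
  rw [intervalIntegral.integral_eq_sub_of_hasDerivAt hd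
    ((continuous_alpha 2).intervalIntegrable _ _)]
  have h9 : √2 - 1 = (√2 + 1)⁻¹ := by
    refine eq_inv_of_mul_eq_one_left ?_
    linear_combination h2
  have h10 := Real.arctan_inv_of_pos (x := √2 + 1) (by positivity)
  simp only [mul_one, mul_zero, zero_add, zero_sub, Real.arctan_neg, Real.arctan_one]
  rw [h9, h10]
  ring

theorem remP_zero (w : Fin 3 → L1 ℤ) (i j : Fin 2) :
    remP ρ 0 w i j = ∑ l, (mu l i j * ∫ s in (0 : ℝ)..1, alpha l s) • w l := by
  have h1 : ∀ l k, (volterraScalar ρ l (w l) (Path.entry i k onePath)).at 1 =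
      if i = k then (∫ s in (0 : ℝ)..1, alpha l s) • w l else 0 := by
    intro l k
    rw [volterraScalar_apply]
    simp only [LoopPath.ext, onePath_at]
    split_ifs with hik
    · simp only [mulV_basis_zero]
      exact intervalIntegral.integral_smul_const _ _
    · simp
  rw [remP, zero_smul, fundSol_zero, entry_volterra]
  simp only [map_sum, map_smul, h1]
  rw [Finset.sum_eq_single i]
  · simp [mul_smul]
  · intro k _ hk
    simp [hk.symm]
  · simp

/-- The difference of the off-diagonal entries kills the diagonal `mu 0` and the symmetric `mu 1`;
the antisymmetric `mu 2` counts twice. To leading order `𝔭` sees `c` alone, which makes the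
linearisation triangular. -/
theorem pHat_zero (w : Fin 3 → L1 ℤ) : pHat ρ 0 w = (2 * Real.pi) • w 2 := by
  rw [pHat, remP_zero, remP_zero, zero_smul, add_zero]
  simp only [Fin.sum_univ_three, integral_alpha_two]
  simp only [mu, Matrix.cons_val, Matrix.cons_val', Matrix.cons_val_zero, Matrix.cons_val_one,
    Matrix.of_apply]
  module

end Fundamental

/-! ### Evaluation of Laurent polynomials -/

/-- Away from `0` evaluation is a ring homomorphism, from which the algebraic rules below follow. -/
theorem evalLaurent_eq_eval₂ {lam : ℂ} (h : lam ≠ 0) (f : ℂ[T;T⁻¹]) :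
    evalLaurent f lam = LaurentPolynomial.eval₂ (RingHom.id ℂ) (Units.mk0 lam h) f := by
  induction f using LaurentPolynomial.induction_on' with
  | add p q hp hq =>
    rw [map_add, ← hp, ← hq, evalLaurent, AddMonoidAlgebra.coeff_add, Finsupp.sum_add_index'] <;>
    simp [evalLaurent, add_mul]
  | C_mul_T n a =>
    rw [LaurentPolynomial.eval₂_C_mul_T, ← LaurentPolynomial.single_eq_C_mul_T, evalLaurent,
      AddMonoidAlgebra.coeff_single, Finsupp.sum_single_index] <;> simp

section EvalLaurent

variable {lam : ℂ} (h : lam ≠ 0) (f g : ℂ[T;T⁻¹])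

include h

theorem evalLaurent_add : evalLaurent (f + g) lam = evalLaurent f lam + evalLaurent g lam := by
  simp only [evalLaurent_eq_eval₂ h, map_add]

theorem evalLaurent_sub : evalLaurent (f - g) lam = evalLaurent f lam - evalLaurent g lam := by
  simp only [evalLaurent_eq_eval₂ h, map_sub]

theorem evalLaurent_mul : evalLaurent (f * g) lam = evalLaurent f lam * evalLaurent g lam := by
  simp only [evalLaurent_eq_eval₂ h, map_mul]

theorem evalLaurent_smul (c : ℂ) : evalLaurent (c • f) lam = c * evalLaurent f lam := by
  rw [LaurentPolynomial.smul_eq_C_mul, evalLaurent_mul h, evalLaurent_eq_eval₂ h,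
    LaurentPolynomial.eval₂_C]
  rfl

theorem evalLaurent_C (c : ℂ) : evalLaurent (LaurentPolynomial.C c) lam = c := by
  rw [evalLaurent_eq_eval₂ h, LaurentPolynomial.eval₂_C]
  rfl

theorem evalLaurent_T (n : ℤ) : evalLaurent (LaurentPolynomial.T n) lam = lam ^ n := by
  rw [evalLaurent_eq_eval₂ h, LaurentPolynomial.eval₂_T]
  simp

theorem evalLaurent_one : evalLaurent 1 lam = 1 := by
  simp only [evalLaurent_eq_eval₂ h, map_one]

theorem evalLaurent_zero : evalLaurent 0 lam = 0 := by
  simp only [evalLaurent_eq_eval₂ h, map_zero]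

theorem evalLaurent_sum {ι : Type*} (s : Finset ι) (f : ι → ℂ[T;T⁻¹]) :
    evalLaurent (∑ i ∈ s, f i) lam = ∑ i ∈ s, evalLaurent (f i) lam := by
  simp only [evalLaurent_eq_eval₂ h, map_sum]

end EvalLaurent

/-- The coefficients of the central values, for `φ = π / 4`. -/
theorem evalLaurent_central {lam : ℂ} (h : lam ≠ 0) (l : Fin 3) :
    evalLaurent (central (Real.pi / 4) l) lam = ![1 / 2 * (lam ^ (-1 : ℤ) - lam ^ (1 : ℤ)),
      -((√2 : ℝ) / 4) * (lam ^ (-1 : ℤ) + lam ^ (1 : ℤ)),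
      -((√2 : ℝ) / 4) * (lam ^ (-1 : ℤ) + lam ^ (1 : ℤ))] l := by
  fin_cases l <;> simp only [central, Fin.zero_eta, Fin.mk_one, Fin.reduceFinMk, Matrix.cons_val,
    evalLaurent_mul h, evalLaurent_C h, evalLaurent_sub h, evalLaurent_add h, evalLaurent_T h,
    Real.sin_pi_div_four, Real.cos_pi_div_four]
  all_goals push_cast; ring

/-! ### The monodromy data as values of loops. -/

section Identification

variable {ρ : ℝ} [hρ : Fact (1 < ρ)]

/-- The central values, as loops. -/
def centralV (ρ : ℝ) : Fin 3 → L1 ℤ :=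
  ![(1 / 2 : ℝ) • (monV ρ (-1) - monV ρ 1), (-(√2 / 4)) • (monV ρ (-1) + monV ρ 1),
    (-(√2 / 4)) • (monV ρ (-1) + monV ρ 1)]

theorem evalV_centralV {lam : ℂ} (hl : lam ∈ annulus ρ) (l : Fin 3) :
    evalV hl (centralV ρ l) = evalLaurent (central (Real.pi / 4) l) lam := by
  rw [evalLaurent_central (ne_zero_of_mem_annulus hl)]
  fin_cases l <;> simp [centralV, evalV_monV]
  all_goals ring

/-- The loops `𝐲 = r 𝐱`. -/
def loopY (x : Param ρ) (l : Fin 3) : L1 ℤ :=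
  x.r • (centralV ρ l + embV (PlusLoop.toL1 (x.tilde l)))

theorem evalV_loopY {lam : ℂ} (hl : lam ∈ annulus ρ) (x : Param ρ) (l : Fin 3) :
    evalV hl (loopY x l) = x.r * abc (Real.pi / 4) x lam l := by
  rw [loopY, map_smul, map_add, evalV_centralV, evalV_embV, ← PlusLoop.eval_eq, Complex.real_smul]
  rfl

/-- Exchange of `b` and `c`. -/
def swapBC (x : Param ρ) : Param ρ := (x.1, x.2.2.1, x.2.1, x.2.2.2)

variable {lam : ℂ} (hl : lam ∈ annulus ρ) {t : ℝ} {x : Param ρ}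

include hl

theorem calP_eq_evalV (h : t • loopY x ∈ small ρ) (i j : Fin 2) :
    calP (Real.pi / 4) t x lam i j =
      evalV hl ((Path.entry i j (fundSol ρ (t • loopY x))).at 1) := by
  have h1 := isPrincipal_evalV_fundSol hl h
  have h2 : (fun l => evalV hl ((t • loopY x) l)) =
      fun l => ((x.r * t : ℝ) : ℂ) * abc (Real.pi / 4) x lam l := by
    ext l
    rw [Pi.smul_apply, map_smul, evalV_loopY, Complex.real_smul]
    push_cast
    ring
  rw [h2] at h1
  rw [calP_eq h1, Matrix.of_apply, LoopPath.ext_of_mem _ (Set.right_mem_Icc.2 zero_le_one)]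
  rfl

theorem calQ_eq_evalV (h : (-t) • loopY (swapBC x) ∈ small ρ) :
    calQ (Real.pi / 4) t x lam =
      !![evalV hl ((Path.entry 0 0 (fundSol ρ ((-t) • loopY (swapBC x)))).at 1),
        -(Complex.I * evalV hl ((Path.entry 0 1 (fundSol ρ ((-t) • loopY (swapBC x)))).at 1));
        Complex.I * evalV hl ((Path.entry 1 0 (fundSol ρ ((-t) • loopY (swapBC x)))).at 1),
        evalV hl ((Path.entry 1 1 (fundSol ρ ((-t) • loopY (swapBC x)))).at 1)] := by
  have h1 := isPrincipal_evalV_fundSol hl h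
  have h2 : (fun l => evalV hl (((-t) • loopY (swapBC x)) l)) =
      fun l => -(((x.r * t : ℝ) : ℂ) * ![abc (Real.pi / 4) x lam 0, abc (Real.pi / 4) x lam 2,
        abc (Real.pi / 4) x lam 1] l) := by
    ext l
    rw [Pi.smul_apply, map_smul, evalV_loopY, Complex.real_smul]
    have h3 : abc (Real.pi / 4) (swapBC x) lam l = ![abc (Real.pi / 4) x lam 0,
        abc (Real.pi / 4) x lam 2, abc (Real.pi / 4) x lam 1] l := by
      fin_cases l <;> simp [abc, swapBC, Param.tilde, central]
    rw [h3]
    change _ * ((x.r : ℂ) * _) = _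
    push_cast
    ring
  rw [h2] at h1
  rw [calQ_eq h1]
  simp only [Matrix.of_apply, LoopPath.ext_of_mem _ (Set.right_mem_Icc.2 zero_le_one)]
  rfl

theorem evalV_fundSol {w : Fin 3 → L1 ℤ} (h : t • w ∈ small ρ) (i j : Fin 2) :
    evalV hl ((Path.entry i j (fundSol ρ (t • w))).at 1) =
      (1 : Matrix (Fin 2) (Fin 2) ℂ) i j + t * evalV hl (remP ρ t w i j) := by
  rw [fundSol_smul_apply_one h, map_add, map_smul, evalV_onePath, Complex.real_smul]

theorem evalV_pHat (w : Fin 3 → L1 ℤ) : evalV hl (pHat ρ t w) =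
    evalV hl (remP ρ t w 1 0) - evalV hl (remP ρ t w 0 1) +
      t * (evalV hl (remP ρ t w 0 0) * evalV hl (remP ρ t w 1 0) -
        evalV hl (remP ρ t w 0 1) * evalV hl (remP ρ t w 1 1)) := by
  simp only [pHat, map_add, map_sub, map_smul, evalV_mulV, Complex.real_smul]

theorem frakP_eq (h : t • loopY x ∈ small ρ) :
    frakP (Real.pi / 4) t x lam = t * evalV hl (pHat ρ t (loopY x)) := by
  simp only [frakP, calP_eq_evalV hl h, evalV_fundSol hl h, evalV_pHat]
  simp
  ring

/-- The factors `i` in `calQ_eq` change the plus sign in `𝔮` into the minus sign of `𝔭`: `𝔮` at `(t,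
x)` is `-𝔭` at `(-t, swapBC x)`, and the two minus signs cancel after division by `t`. -/
theorem frakQ_eq (h : (-t) • loopY (swapBC x) ∈ small ρ) :
    frakQ (Real.pi / 4) t x lam = t * evalV hl (pHat ρ (-t) (loopY (swapBC x))) := by
  simp only [frakQ, calQ_eq_evalV hl h, evalV_fundSol hl h, evalV_pHat]
  simp
  linear_combination (t * ((1 - t * evalV hl (remP ρ (-t) (loopY (swapBC x)) 0 0)) *
    -evalV hl (remP ρ (-t) (loopY (swapBC x)) 1 0) +
    evalV hl (remP ρ (-t) (loopY (swapBC x)) 0 1) *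
    (1 - t * evalV hl (remP ρ (-t) (loopY (swapBC x)) 1 1)))) * Complex.I_sq

-- At `t = 0` continuity of the quotient suffices: the derivative is the limit of the slopes, which
-- are the values of `g`.
omit hl in
theorem dslope_zero_eq {f g : ℝ → ℂ} (hf : ∀ᶠ s in 𝓝 (0 : ℝ), f s = s * g s)
    (hg : ContinuousAt g 0) (ht : f t = t * g t) : dslope f 0 t = g t := by
  have h0 : f 0 = 0 := by simpa using hf.self_of_nhds
  rcases eq_or_ne t 0 with rfl | h
  · rw [dslope_same]
    refine HasDerivAt.deriv ?_
    rw [hasDerivAt_iff_tendsto_slope]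
    refine Filter.Tendsto.congr' ?_ (hg.tendsto.mono_left nhdsWithin_le_nhds)
    filter_upwards [hf.filter_mono nhdsWithin_le_nhds, self_mem_nhdsWithin] with s hs hs'
    rw [slope_def_module, h0, sub_zero, sub_zero, hs, Complex.real_smul, Complex.ofReal_inv,
      inv_mul_cancel_left₀]
    exact_mod_cast hs'
  · rw [dslope_of_ne _ h, slope_def_module, h0, sub_zero, sub_zero, ht, Complex.real_smul,
      Complex.ofReal_inv, inv_mul_cancel_left₀]
    exact_mod_cast h

omit hl in
theorem eventually_smul_mem_small (w : Fin 3 → L1 ℤ) : ∀ᶠ s : ℝ in 𝓝 0, s • w ∈ small ρ := by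
  have : ContinuousAt (fun s : ℝ => s • w) 0 := by fun_prop
  exact this.eventually (isOpen_small.mem_nhds (by simpa using zero_mem_small))

omit hl in
theorem continuousAt_pHat (w : Fin 3 → L1 ℤ) : ContinuousAt (fun s => pHat ρ s w) 0 := by
  have h : ContinuousAt (fun y : ℝ × (Fin 3 → L1 ℤ) => pHat ρ y.1 y.2) (0, w) :=
    (contDiffAt_pHat (by rw [zero_smul]; exact zero_mem_small)).continuousAt
  exact h.comp (f := fun s : ℝ => (s, w)) (by fun_prop)

theorem hatP_eq (h : t • loopY x ∈ small ρ) :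
    hatP (Real.pi / 4) t x lam = evalV hl (pHat ρ t (loopY x)) := by
  refine dslope_zero_eq (g := fun s => evalV hl (pHat ρ s (loopY x))) ?_ ?_ (frakP_eq hl h)
  · filter_upwards [eventually_smul_mem_small (ρ := ρ) (loopY x)] with s hs using frakP_eq hl hs
  · exact (evalV hl).continuous.continuousAt.comp (continuousAt_pHat (loopY x))

theorem hatQ_eq (h : (-t) • loopY (swapBC x) ∈ small ρ) :
    hatQ (Real.pi / 4) t x lam = evalV hl (pHat ρ (-t) (loopY (swapBC x))) := by
  have hn : Filter.Tendsto (fun s : ℝ => -s) (𝓝 0) (𝓝 0) := by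
    simpa using (continuous_neg (G := ℝ)).tendsto 0
  refine dslope_zero_eq (g := fun s => evalV hl (pHat ρ (-s) (loopY (swapBC x)))) ?_ ?_
    (frakQ_eq hl h)
  · filter_upwards [hn.eventually (eventually_smul_mem_small (ρ := ρ) (loopY (swapBC x)))] with s hs
      using frakQ_eq hl hs
  · refine (evalV hl).continuous.continuousAt.comp ?_
    have := continuousAt_pHat (ρ := ρ) (loopY (swapBC x))
    rw [← neg_zero] at this
    exact ContinuousAt.comp (g := fun s => pHat ρ s (loopY (swapBC x))) this
      continuous_neg.continuousAt

end Identification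

/-! ### The functional equations in the loop space -/

/-- The reflection `λ ↦ λ⁻¹`. -/
def reflect : L1 ℤ →L[ℝ] L1 ℤ :=
  L1.lift (fun k => L1.basis (-k)) 1 fun _ => (L1.norm_basis _).le

theorem reflect_basis (k : ℤ) : reflect (L1.basis k) = L1.basis (-k) := L1.lift_basis _ _ _ _

theorem reflect_apply (u : L1 ℤ) (k : ℤ) : reflect u k = u (-k) := by
  rw [← L1.coord_apply, ← L1.coord_apply]
  refine L1.clm_congr (f := (L1.coord k).comp reflect) (g := L1.coord (-k)) (fun j => ?_) u
  simp only [ContinuousLinearMap.comp_apply, reflect_basis, L1.coord_apply, L1.basis_apply]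
  split_ifs <;> first | rfl | omega

/-- The antisymmetric part: the coefficients `h_k - h_{-k}` for `k ≥ 1`. -/
def antisym : L1 ℤ →L[ℝ] L1 ℕ :=
  L1.lift (fun k : ℤ => match k with
    | Int.ofNat 0 => 0
    | Int.ofNat (n + 1) => L1.basis n
    | Int.negSucc n => -L1.basis n) 1 fun k => by
      match k with
      | Int.ofNat 0 => simp
      | Int.ofNat (n + 1) => exact (L1.norm_basis n).le
      | Int.negSucc n => exact (norm_neg (L1.basis n)).le.trans (L1.norm_basis n).le

theorem antisym_apply (u : L1 ℤ) (k : ℕ) : antisym u k = u (k + 1 : ℤ) - u (-(k + 1) : ℤ) := by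
  rw [← L1.coord_apply, ← L1.coord_apply, ← L1.coord_apply, ← sub_apply]
  refine L1.clm_congr (f := (L1.coord k).comp antisym)
    (g := L1.coord (k + 1 : ℤ) - L1.coord (-(k + 1) : ℤ)) (fun j => ?_) u
  rw [ContinuousLinearMap.comp_apply, antisym, L1.lift_basis, sub_apply,
    L1.coord_apply, L1.coord_apply, L1.coord_apply, L1.basis_apply, L1.basis_apply]
  match j with
  | Int.ofNat 0 =>
    rw [if_neg (by simp; omega), if_neg (by simp; omega)]
    simp
  | Int.ofNat (n + 1) =>
    rw [L1.basis_apply, if_neg (c := -((k : ℤ) + 1) = _) (by simp; omega), sub_zero]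
    congr 1
    simp
  | Int.negSucc n =>
    rw [if_neg (c := (k : ℤ) + 1 = _) (by omega), zero_sub]
    change -(L1.basis n k) = _
    rw [L1.basis_apply]
    congr 2
    rw [Int.negSucc_eq, neg_inj]
    simp

theorem antisym_eq_zero_iff (u : L1 ℤ) : antisym u = 0 ↔ reflect u = u := by
  constructor
  · intro h
    have h' : ∀ k : ℕ, u (k + 1 : ℤ) = u (-(k + 1) : ℤ) := fun k => by
      have := congrArg (fun v : L1 ℕ => v k) h
      simpa [antisym_apply, sub_eq_zero] using this
    ext k
    rw [reflect_apply]
    obtain ⟨n, rfl | rfl⟩ := k.eq_nat_or_neg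
    · cases n with
      | zero => simp
      | succ n => simpa using (h' n).symm
    · cases n with
      | zero => simp
      | succ n => simpa using h' n
  · intro h
    ext k
    rw [antisym_apply]
    conv_lhs => rw [← h]
    rw [reflect_apply, reflect_apply, neg_neg]
    conv_lhs => rw [← h]
    rw [reflect_apply, reflect_apply, neg_neg]
    have := congrArg (fun v : L1 ℤ => v (k + 1 : ℤ)) h
    simp only [reflect_apply] at this
    simp [this]

theorem antisym_embV (u : L1 ℕ) (k : ℕ) : antisym (embV u) k = u (k + 1) := by
  rw [← L1.coord_apply, ← L1.coord_apply]
  refine L1.clm_congr (f := (L1.coord k).comp (antisym.comp embV)) (g := L1.coord (k + 1))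
    (fun j => ?_) u
  simp only [ContinuousLinearMap.comp_apply, embV_basis, L1.coord_apply, antisym_apply,
    L1.basis_apply]
  rw [if_neg (c := -((k : ℤ) + 1) = _) (by omega), sub_zero]
  norm_cast

section Loops

variable {ρ : ℝ} [hρ : Fact (1 < ρ)]

theorem star_eq_inv {lam : ℂ} (hl : ‖lam‖ = 1) : star lam = lam⁻¹ := by
  rw [Complex.star_def, Complex.inv_def, Complex.normSq_eq_norm_sq, hl]
  simp

theorem evalV_reflect {lam : ℂ} (hl : ‖lam‖ = 1) (u : L1 ℤ) :
    evalV (ρ := ρ) (mem_annulus_of_norm_eq_one hl) (reflect u) =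
      star (evalV (ρ := ρ) (mem_annulus_of_norm_eq_one hl) u) := by
  refine L1.clm_congr (f := (evalV (ρ := ρ) (mem_annulus_of_norm_eq_one hl)).comp reflect)
    (g := (Complex.conjCLE : ℂ →L[ℝ] ℂ).comp (evalV (ρ := ρ) (mem_annulus_of_norm_eq_one hl)))
    (fun k => ?_) u
  have h : (starRingEnd ℂ) lam = lam⁻¹ := star_eq_inv hl
  simp [reflect_basis, evalV_basis, wt, h]

/-- On the circle `star λ = λ⁻¹`, and the coefficients are real, so conjugating the values amounts
to reflecting the indices. Uniqueness of Fourier coefficients turns this family of conditions into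
one equation in a Banach space. -/
theorem antisym_eq_zero_iff_forall_evalV (u : L1 ℤ) : antisym u = 0 ↔
    ∀ lam : ℂ, ∀ hl : ‖lam‖ = 1, evalV (ρ := ρ) (mem_annulus_of_norm_eq_one hl) u -
      star (evalV (ρ := ρ) (mem_annulus_of_norm_eq_one hl) u) = 0 := by
  rw [antisym_eq_zero_iff]
  constructor
  · intro h lam hl
    rw [← evalV_reflect hl, h, sub_self]
  · intro h
    have : u - reflect u = 0 := eq_zero_of_evalV_eq_zero (ρ := ρ) fun lam hl => by
      rw [map_sub, evalV_reflect hl, h lam hl]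
    exact (sub_eq_zero.1 this).symm

/-! ### Evaluation on the unit circle -/

theorem norm_wt_mul_cos_le (θ : ℝ) (k : ℤ) : ‖wt ρ k * Real.cos (k * θ)‖ ≤ 1 := by
  rw [norm_mul, Real.norm_eq_abs, Real.norm_eq_abs, abs_of_pos (wt_pos k)]
  exact mul_le_one₀ (inv_le_one_of_one_le₀ (one_le_pow₀ hρ.out.le)) (abs_nonneg _)
    (Real.abs_cos_le_one _)

/-- The real part of the value at `e^{iθ}`. -/
def circEval (ρ : ℝ) [Fact (1 < ρ)] (θ : ℝ) : L1 ℤ →L[ℝ] ℝ :=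
  L1.lift (fun k => wt ρ k * Real.cos (k * θ)) 1 (norm_wt_mul_cos_le θ)

theorem circEval_basis (θ : ℝ) (k : ℤ) :
    circEval ρ θ (L1.basis k) = wt ρ k * Real.cos (k * θ) := L1.lift_basis _ _ _ _

theorem norm_exp_I_mul (θ : ℝ) : ‖Complex.exp (Complex.I * θ)‖ = 1 := by
  rw [mul_comm, Complex.norm_exp_ofReal_mul_I]

theorem circEval_eq_re (θ : ℝ) (u : L1 ℤ) : circEval ρ θ u =
    (evalV (ρ := ρ) (mem_annulus_of_norm_eq_one (norm_exp_I_mul θ)) u).re := by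
  refine L1.clm_congr (f := circEval ρ θ)
    (g := Complex.reCLM.comp (evalV (ρ := ρ) (mem_annulus_of_norm_eq_one (norm_exp_I_mul θ))))
    (fun k => ?_) u
  rw [circEval_basis, ContinuousLinearMap.comp_apply, evalV_basis, ← Complex.exp_int_mul,
    Complex.reCLM_apply, Complex.re_ofReal_mul]
  congr 1
  rw [show (k : ℂ) * (Complex.I * θ) = ((k * θ : ℝ) : ℂ) * Complex.I by push_cast; ring,
    Complex.exp_ofReal_mul_I_re]

theorem norm_coord_le {ι : Type} [DecidableEq ι] (i : ι) : ‖L1.coord i‖ ≤ 1 :=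
  L1.norm_lift_le _ zero_le_one _

theorem abs_iteratedDeriv_cos_le (n : ℕ) (x : ℝ) : |iteratedDeriv n Real.cos x| ≤ 1 := by
  obtain ⟨m, rfl | rfl⟩ := n.even_or_odd'
  · rw [Real.iteratedDeriv_even_cos]
    simpa [abs_mul] using Real.abs_cos_le_one x
  · rw [Real.iteratedDeriv_odd_cos]
    simpa [abs_mul] using Real.abs_sin_le_one x

theorem summable_abs_pow_mul_wt (n : ℕ) : Summable fun k : ℤ => |(k : ℝ)| ^ n * wt ρ k := by
  have h : Summable fun k : ℕ => (k : ℝ) ^ n * ρ⁻¹ ^ k :=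
    summable_pow_mul_geometric_of_norm_lt_one n (by
      rw [norm_inv, Real.norm_eq_abs, abs_of_pos rho_pos]
      exact inv_lt_one_of_one_lt₀ hρ.out)
  refine Summable.of_nat_of_neg ?_ ?_ <;> simpa [wt] using h

/-- The angle `θ` is an unknown, so evaluation at `e^{iθ}` must be smooth in `θ` as a map into the
dual space. Each derivative costs a factor `|k|`, which the geometric decay of `wt ρ k` absorbs. -/
theorem contDiff_circEval : ContDiff ℝ ∞ (circEval ρ) := by
  have h : circEval ρ = fun θ => ∑' k : ℤ, Real.cos (k * θ) • (wt ρ k • L1.coord k) := by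
    have hs : ∀ θ, Summable fun k : ℤ =>
        Real.cos (k * θ) • (wt ρ k • L1.coord k : L1 ℤ →L[ℝ] ℝ) := fun θ => by
      refine Summable.of_norm_bounded (summable_abs_pow_mul_wt (ρ := ρ) 0) fun k => ?_
      rw [norm_smul, norm_smul, Real.norm_eq_abs, Real.norm_eq_abs, abs_of_pos (wt_pos k),
        pow_zero]
      have h1 := Real.abs_cos_le_one (k * θ)
      have h2 := norm_coord_le k
      have h3 := (wt_pos (ρ := ρ) k).le
      calc |Real.cos (k * θ)| * (wt ρ k * ‖L1.coord k‖) ≤ 1 * (wt ρ k * 1) := by gcongr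
        _ = _ := by ring
    ext θ u
    have := (ContinuousLinearMap.apply ℝ ℝ u).map_tsum (hs θ)
    simp only [ContinuousLinearMap.apply_apply] at this
    rw [this, circEval, L1.lift_apply]
    refine tsum_congr fun k => ?_
    simp only [smul_apply, smul_eq_mul, L1.coord_apply]
    ring
  rw [h]
  refine contDiff_tsum (N := ⊤) (v := fun n (k : ℤ) => |(k : ℝ)| ^ n * wt ρ k)
    (fun k => by fun_prop) (fun n _ => summable_abs_pow_mul_wt n) fun n k θ _ => ?_
  rw [norm_iteratedFDeriv_eq_norm_iteratedDeriv, iteratedDeriv_smul_const (by fun_prop),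
    iteratedDeriv_comp_const_mul (Real.contDiff_cos), norm_smul, norm_smul, norm_mul, norm_pow,
    Real.norm_eq_abs, Real.norm_eq_abs, Real.norm_eq_abs, abs_of_pos (wt_pos k)]
  have h1 := abs_iteratedDeriv_cos_le n (k * θ)
  have h2 := norm_coord_le k
  have h3 := (wt_pos (ρ := ρ) k).le
  calc |(k : ℝ)| ^ n * |iteratedDeriv n Real.cos (k * θ)| * (wt ρ k * ‖L1.coord k‖)
      ≤ |(k : ℝ)| ^ n * 1 * (wt ρ k * 1) := by gcongr
    _ = _ := by ring

/-! ### The determinant -/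

/-- `λ (𝒦 + 1)`, for loops `ã`, `b̃`, `c̃`. -/
def kPlus (ρ r : ℝ) (a b c : L1 ℕ) : L1 ℕ :=
  (1 - r ^ 2) • monU ρ 1 + r ^ 2 • (a - mulU (monU ρ 2) a +
    (√2 / 2) • (b + c + mulU (monU ρ 2) (b + c)) +
    mulU (monU ρ 1) (mulU a a - mulU b b - mulU c c))

omit hρ in
theorem calK_eq (x : Param ρ) (lam : ℂ) : calK (Real.pi / 4) x lam =
    x.r ^ 2 * (abc (Real.pi / 4) x lam 0 ^ 2 - abc (Real.pi / 4) x lam 1 ^ 2 -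
      abc (Real.pi / 4) x lam 2 ^ 2) := by
  rw [calK, Matrix.det_smul, residue, Matrix.cons_val_zero, Matrix.det_fin_two_of]
  simp only [Fintype.card_fin]
  linear_combination (-(x.r : ℂ) ^ 2 * abc (Real.pi / 4) x lam 0 ^ 2 +
    (x.r : ℂ) ^ 2 * abc (Real.pi / 4) x lam 2 ^ 2) * Complex.I_sq

/-- The central values satisfy `a̲² - b̲² - c̲² = -1`, which removes the double pole of `𝒦 + 1` at
`0`. Only a simple pole remains, so the product with `λ` is a power series. -/
theorem evalU_kPlus {lam : ℂ} (hl : lam ∈ annulus ρ) (x : Param ρ) :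
    evalU hl.2 (kPlus ρ x.r (PlusLoop.toL1 (x.tilde 0)) (PlusLoop.toL1 (x.tilde 1))
      (PlusLoop.toL1 (x.tilde 2))) = lam * (calK (Real.pi / 4) x lam + 1) := by
  have h0 := ne_zero_of_mem_annulus hl
  have h2 := sqrt_two_sq
  rw [calK_eq]
  simp only [kPlus, map_add, map_sub, map_smul, evalU_mulU, evalU_monU, ← PlusLoop.eval_eq,
    Complex.real_smul, abc, evalLaurent_central h0]
  simp only [Matrix.cons_val, zpow_neg, zpow_one]
  push_cast
  generalize (x.tilde 0).eval lam = a
  generalize (x.tilde 1).eval lam = b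
  generalize (x.tilde 2).eval lam = c
  generalize ((√2 : ℝ) : ℂ) = s at *
  have hm : lam * lam⁻¹ = 1 := mul_inv_cancel₀ h0
  generalize lam⁻¹ = m at *
  linear_combination (-(x.r : ℂ) ^ 2 * a - (x.r : ℂ) ^ 2 * (s / 2) * (b + c) +
    (x.r : ℂ) ^ 2 * lam) * hm + (lam * (x.r : ℂ) ^ 2 * (m + lam) ^ 2 / 8) * h2

end Loops

section Division

variable {ρ : ℝ} [hρ : Fact (1 < ρ)]

/-! ### Division by `λ² - 1` -/

/-- The quotients of the normalised powers of `λ` by `λ² - 1`. -/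
def quotBasis (ρ : ℝ) : ℕ → L1 ℕ
  | 0 => 0
  | 1 => 0
  -- From `λ^(k+2) = (λ² - 1) λ^k + λ^k`; the factor comes from the normalisation of the powers.
  | k + 2 => (ρ ^ 2)⁻¹ • (L1.basis k + quotBasis ρ k)

/-- The remainders of the normalised powers of `λ` by `λ² - 1`. -/
def remBasis (ρ : ℝ) : ℕ → ℝ × ℝ
  | 0 => (1, 0)
  | 1 => (0, ρ⁻¹)
  | k + 2 => (ρ ^ 2)⁻¹ • remBasis ρ k

theorem one_lt_rho_sq : 1 < ρ ^ 2 := one_lt_pow₀ hρ.out two_ne_zero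

/-- The bound is the fixed point of `C ↦ (1 + C) / ρ²`, the estimate that the recursion produces. It
is finite because the zeros `±1` of `λ² - 1` lie strictly inside the disc of radius `ρ`. -/
theorem norm_quotBasis_le : ∀ k, ‖quotBasis ρ k‖ ≤ (ρ ^ 2 - 1)⁻¹
  | 0 | 1 => by
    have := one_lt_rho_sq (ρ := ρ)
    rw [quotBasis, norm_zero]
    exact inv_nonneg.2 (by linarith)
  | k + 2 => by
    have h := one_lt_rho_sq (ρ := ρ)
    have h1 := norm_quotBasis_le k
    have h2 : ‖L1.basis k + quotBasis ρ k‖ ≤ 1 + (ρ ^ 2 - 1)⁻¹ :=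
      (norm_add_le _ _).trans (add_le_add (L1.norm_basis k).le h1)
    have h3 : 0 < ρ ^ 2 - 1 := by linarith
    rw [quotBasis, norm_smul, norm_inv, Real.norm_eq_abs, abs_of_pos (by positivity)]
    calc (ρ ^ 2)⁻¹ * ‖L1.basis k + quotBasis ρ k‖ ≤ (ρ ^ 2)⁻¹ * (1 + (ρ ^ 2 - 1)⁻¹) := by gcongr
      _ = (ρ ^ 2 - 1)⁻¹ := by
        have : ρ ^ 2 ≠ 0 := by positivity
        have h4 := h3.ne'
        generalize ρ ^ 2 = y at *
        field_simp
        ring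

theorem norm_remBasis_le : ∀ k, ‖remBasis ρ k‖ ≤ 1
  | 0 => by simp [remBasis, Prod.norm_def]
  | 1 => by
    have := inv_le_one_of_one_le₀ hρ.out.le
    simpa [remBasis, Prod.norm_def, abs_of_pos rho_pos] using this
  | k + 2 => by
    have h := one_lt_rho_sq (ρ := ρ)
    rw [remBasis, norm_smul, norm_inv, Real.norm_eq_abs, abs_of_pos (by positivity)]
    exact mul_le_one₀ (inv_le_one_of_one_le₀ h.le) (norm_nonneg _) (norm_remBasis_le k)

/-- The quotient by `λ² - 1`. -/
def quotU (ρ : ℝ) [Fact (1 < ρ)] : L1 ℕ →L[ℝ] L1 ℕ :=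
  L1.lift (quotBasis ρ) _ norm_quotBasis_le

/-- The coefficients of the remainder by `λ² - 1`. -/
def remU (ρ : ℝ) [Fact (1 < ρ)] : L1 ℕ →L[ℝ] ℝ × ℝ :=
  L1.lift (remBasis ρ) _ norm_remBasis_le

theorem quotU_basis (k : ℕ) : quotU ρ (L1.basis k) = quotBasis ρ k := L1.lift_basis _ _ _ _

theorem remU_basis (k : ℕ) : remU ρ (L1.basis k) = remBasis ρ k := L1.lift_basis _ _ _ _

omit hρ in
theorem mulU_monU (j k : ℕ) : mulU (monU ρ j) (L1.basis k) = ρ ^ j • L1.basis (j + k) := by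
  rw [monU, map_smul, smul_apply, mulU_basis]

theorem division_basis : ∀ k, mulU (monU ρ 2) (quotBasis ρ k) - quotBasis ρ k +
    ((remBasis ρ k).1 • monU ρ 0 + (remBasis ρ k).2 • monU ρ 1) = L1.basis k
  | 0 => by simp [quotBasis, remBasis, monU]
  | 1 => by simp [quotBasis, remBasis, monU, smul_smul, rho_pos.ne']
  | k + 2 => by
    have h := division_basis k
    have h0 : ρ ^ 2 ≠ 0 := (pow_pos rho_pos 2).ne'
    rw [quotBasis, remBasis, map_smul, map_add, mulU_monU, Prod.smul_fst, Prod.smul_snd,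
      smul_assoc, smul_assoc, ← smul_sub, ← smul_add, ← smul_add, inv_smul_eq_iff₀ h0, add_comm k 2]
    rw [← h]
    abel

theorem division (u : L1 ℕ) : mulU (monU ρ 2) (quotU ρ u) - quotU ρ u +
    ((remU ρ u).1 • monU ρ 0 + (remU ρ u).2 • monU ρ 1) = u := by
  refine L1.clm_congr (f := (mulU (monU ρ 2)).comp (quotU ρ) - quotU ρ +
    (((ContinuousLinearMap.fst ℝ ℝ ℝ).comp (remU ρ)).smulRight (monU ρ 0) +
    ((ContinuousLinearMap.snd ℝ ℝ ℝ).comp (remU ρ)).smulRight (monU ρ 1)))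
    (g := ContinuousLinearMap.id ℝ _) (fun k => ?_) u
  have := division_basis (ρ := ρ) k
  simpa [quotU_basis, remU_basis] using this

theorem quotU_mul (u : L1 ℕ) : quotU ρ (mulU (monU ρ 2) u - u) = u := by
  refine L1.clm_congr (f := (quotU ρ).comp (mulU (monU ρ 2) - ContinuousLinearMap.id ℝ _))
    (g := ContinuousLinearMap.id ℝ _) (fun k => ?_) u
  have h0 : ρ ^ 2 ≠ 0 := (pow_pos rho_pos 2).ne'
  simp only [ContinuousLinearMap.comp_apply, sub_apply, ContinuousLinearMap.id_apply, map_sub,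
    mulU_monU, map_smul, quotU_basis, add_comm 2 k, quotBasis, smul_inv_smul₀ h0]
  abel

/-- Multiplication by `λ`, up to normalisation. -/
def shiftU : L1 ℕ →L[ℝ] L1 ℕ :=
  L1.lift (fun k => L1.basis (k + 1)) 1 fun _ => (L1.norm_basis _).le

theorem shiftU_basis (k : ℕ) : shiftU (L1.basis k) = L1.basis (k + 1) := L1.lift_basis _ _ _ _

/-- On power series `antisym` drops the constant term and shifts the rest; `shiftU` is a right
inverse and prescribes the nonconstant coefficients of `b` and `c`. -/
theorem antisym_embV_shiftU (u : L1 ℕ) : antisym (embV (shiftU u)) = u := by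
  refine L1.clm_congr (f := antisym.comp (embV.comp shiftU)) (g := ContinuousLinearMap.id ℝ _)
    (fun k => ?_) u
  ext j
  simp [shiftU_basis, antisym_embV, L1.basis_apply]

theorem antisym_embV_basis_zero : antisym (embV (L1.basis 0)) = 0 := by
  ext j
  simp [antisym_embV, L1.basis_apply]

theorem eq_smul_basis_zero {u : L1 ℕ} (h : antisym (embV u) = 0) : u = u 0 • L1.basis 0 := by
  ext k
  cases k with
  | zero => simp [L1.basis_apply]
  | succ k =>
    have := congrArg (fun v : L1 ℕ => v k) h
    simp only [antisym_embV] at this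
    simpa [L1.basis_apply] using this

theorem circEval_embV_basis_zero (θ : ℝ) : circEval ρ θ (embV (L1.basis 0)) = 1 := by
  simp [embV_basis, circEval_basis, wt]

/-! ### The linearisation -/

/-- The differential of `λ (𝒦 + 1)`. -/
def kLin (ρ r : ℝ) (a b c : L1 ℕ) : L1 ℕ :=
  a - mulU (monU ρ 2) a + (√2 / 2) • (b + c + mulU (monU ρ 2) (b + c)) - (2 * r) • monU ρ 1

theorem sqrt_two_mul_self : √2 * √2 = 2 := Real.mul_self_sqrt zero_le_two

/-- The antisymmetry equations leave only the constants `b 0` and `c 0`. At `λ = ±1` the factor `1 -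
λ²` of `a` vanishes, which gives `r = 0` and `b 0 + c 0 = 0`. Adding the two conditions at `i` then
gives `θ = 0`, so `b = c = 0`, and `(1 - λ²) a = 0` forces `a = 0`. -/
theorem lin_injective {a b c : L1 ℕ} {r θ : ℝ} (hc : antisym (embV c) = 0)
    (hb : antisym (embV b) = 0) (hk : kLin ρ r a b c = 0)
    (h1 : √2 / 2 * θ + circEval ρ (Real.pi / 2) (embV c) = 0)
    (h2 : √2 / 2 * θ + circEval ρ (Real.pi / 2) (embV b) = 0) :
    a = 0 ∧ b = 0 ∧ c = 0 ∧ r = 0 ∧ θ = 0 := by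
  have hs := sqrt_two_mul_self
  have hs0 : 0 < √2 := by positivity
  rw [eq_smul_basis_zero hc, map_smul, map_smul, circEval_embV_basis_zero, smul_eq_mul,
    mul_one] at h1
  rw [eq_smul_basis_zero hb, map_smul, map_smul, circEval_embV_basis_zero, smul_eq_mul,
    mul_one] at h2
  have he : ∀ lam : ℂ, ∀ hl : ‖lam‖ ≤ ρ, evalU hl a - lam ^ 2 * evalU hl a +
      ((√2 / 2 : ℝ) : ℂ) * ((b 0 + c 0 : ℝ) * (1 + lam ^ 2)) - (2 * r : ℝ) * lam = 0 := by
    intro lam hl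
    have := congrArg (evalU hl) hk
    rw [kLin, eq_smul_basis_zero hc, eq_smul_basis_zero hb] at this
    simp only [map_add, map_sub, map_smul, evalU_mulU, evalU_monU, Complex.real_smul, map_zero,
      evalU_basis, pow_zero, inv_one, mul_one, pow_one] at this
    rw [← this]
    push_cast
    ring
  have e1 := he 1 (by simpa using hρ.out.le)
  have e2 := he (-1) (by simpa using hρ.out.le)
  have e3 : √2 * (b 0 + c 0) - 2 * r = 0 := by
    have : ((√2 * (b 0 + c 0) - 2 * r : ℝ) : ℂ) = 0 := by
      rw [← e1]; push_cast; ring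
    exact_mod_cast this
  have e4 : √2 * (b 0 + c 0) + 2 * r = 0 := by
    have : ((√2 * (b 0 + c 0) + 2 * r : ℝ) : ℂ) = 0 := by
      rw [← e2]; push_cast; ring
    exact_mod_cast this
  have hr : r = 0 := by linarith
  have hbc : b 0 + c 0 = 0 := by
    have : √2 * (b 0 + c 0) = 0 := by linarith
    exact (mul_eq_zero.1 this).resolve_left hs0.ne'
  have hθ : θ = 0 := by
    have : √2 * θ = 0 := by linarith
    exact (mul_eq_zero.1 this).resolve_left hs0.ne'
  rw [hθ, mul_zero, zero_add] at h1 h2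
  have hb' : b = 0 := by rw [eq_smul_basis_zero hb, h2, zero_smul]
  have hc' : c = 0 := by rw [eq_smul_basis_zero hc, h1, zero_smul]
  refine ⟨?_, hb', hc', hr, hθ⟩
  rw [kLin, hb', hc', hr] at hk
  simp only [add_zero, map_zero, smul_zero, mul_zero, zero_smul, sub_zero] at hk
  have h3 : mulU (monU ρ 2) a - a = 0 := by rw [← neg_sub, hk, neg_zero]
  rw [← quotU_mul (ρ := ρ) a, h3, map_zero]

/-- `B` and `C` solve the antisymmetry equations up to constants `b₀`, `c₀`. In the division of what
remains of `k` by `λ² - 1`, the quotient yields `a`, the linear remainder `r`, and the constant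
remainder `b₀ + c₀`. -/
theorem lin_surjective (f g k : L1 ℕ) (h₁ h₂ : ℝ) : ∃ (a b c : L1 ℕ) (r θ : ℝ),
    antisym (embV c) = f ∧ antisym (embV b) = g ∧ kLin ρ r a b c = k ∧
    √2 / 2 * θ + circEval ρ (Real.pi / 2) (embV c) = h₁ ∧
    √2 / 2 * θ + circEval ρ (Real.pi / 2) (embV b) = h₂ := by
  have hs := sqrt_two_mul_self
  have hs0 : 0 < √2 := by positivity
  set B := shiftU g
  set C := shiftU f
  set m := k - (√2 / 2) • (B + C + mulU (monU ρ 2) (B + C)) with hm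
  set u := h₁ - circEval ρ (Real.pi / 2) (embV C) with hu
  set v := h₂ - circEval ρ (Real.pi / 2) (embV B) with hv
  -- Modulo `λ² - 1` the constants contribute `√2 (b₀ + c₀)`, so matching the constant remainder
  -- requires `b₀ + c₀ = s`. Inserted in the sum of the two conditions at `i`, this determines `θ`.
  set s := √2 / 2 * (remU ρ m).1 with hs'
  set θ := √2 / 2 * (u + v - s) with hθ
  set c₀ := u - √2 / 2 * θ with hc₀
  set b₀ := v - √2 / 2 * θ with hb₀
  have hbc : b₀ + c₀ = s := by
    rw [hb₀, hc₀, hθ]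
    linear_combination (-(u + v - s) / 2) * hs
  -- The constant added to `a` cancels the `λ²` term of `(√2 / 2)(b₀ + c₀)(1 + λ²)`.
  refine ⟨(√2 / 2 * (b₀ + c₀)) • monU ρ 0 - quotU ρ m, B + b₀ • L1.basis 0, C + c₀ • L1.basis 0,
    -(remU ρ m).2 / 2, θ, ?_, ?_, ?_, ?_, ?_⟩
  · simp [C, antisym_embV_shiftU, antisym_embV_basis_zero]
  · simp [B, antisym_embV_shiftU, antisym_embV_basis_zero]
  · have hd := division (ρ := ρ) m
    have hm' : k = m + (√2 / 2) • (B + C + mulU (monU ρ 2) (B + C)) := by rw [hm]; abel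
    have h0 : monU ρ 0 = L1.basis 0 := by simp [monU]
    have h1 : (remU ρ m).1 = √2 * (b₀ + c₀) := by
      rw [hbc, hs']
      linear_combination (-(remU ρ m).1 / 2) * hs
    rw [hm']
    conv_rhs => rw [← hd]
    rw [h1, kLin, h0]
    simp only [map_add, map_sub, map_smul]
    generalize mulU (monU ρ 2) (quotU ρ m) = x1
    generalize mulU (monU ρ 2) (L1.basis 0) = x2
    module
  · rw [map_add, map_add, map_smul, map_smul, circEval_embV_basis_zero, smul_eq_mul, mul_one,
      hc₀, hu]
    ring
  · rw [map_add, map_add, map_smul, map_smul, circEval_embV_basis_zero, smul_eq_mul, mul_one,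
      hb₀, hv]
    ring

end Division

section Functional

variable {ρ : ℝ} [hρ : Fact (1 < ρ)]

/-! ### The monodromy problem as an equation in a Banach space -/

/-- The functional whose zeros are the solutions of the monodromy problem. -/
def monF (y : ℝ × Param ρ) : L1 ℕ × L1 ℕ × L1 ℕ × ℝ × ℝ :=
  (antisym (pHat ρ y.1 (loopY y.2)), antisym (pHat ρ (-y.1) (loopY (swapBC y.2))),
    kPlus ρ y.2.r (PlusLoop.toL1 (y.2.tilde 0)) (PlusLoop.toL1 (y.2.tilde 1))
      (PlusLoop.toL1 (y.2.tilde 2)),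
    circEval ρ y.2.theta (pHat ρ y.1 (loopY y.2)),
    circEval ρ y.2.theta (pHat ρ (-y.1) (loopY (swapBC y.2))))

/-- The region in which both halves of the monodromy are given by convergent Neumann series. -/
structure Regular (y : ℝ × Param ρ) : Prop where
  left : y.1 • loopY y.2 ∈ small ρ
  right : (-y.1) • loopY (swapBC y.2) ∈ small ρ
  theta : y.2.theta ∈ Set.Ioo 0 Real.pi

theorem loopStar_apply (h : ℂ → ℂ) {lam : ℂ} (hl : ‖lam‖ = 1) : loopStar h lam = star (h lam) := by
  rw [loopStar, star_eq_inv hl, one_div, inv_inv]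

theorem monF_eq_zero_iff {y : ℝ × Param ρ} (hy : Regular y) :
    monF y = 0 ↔ MonodromyProblem (Real.pi / 4) y.1 y.2 := by
  obtain ⟨t, x⟩ := y
  have hP : ∀ {lam : ℂ} (hl : ‖lam‖ = 1), hatP (Real.pi / 4) t x lam =
      evalV (ρ := ρ) (mem_annulus_of_norm_eq_one hl) (pHat ρ t (loopY x)) :=
    fun hl => hatP_eq _ hy.left
  have hQ : ∀ {lam : ℂ} (hl : ‖lam‖ = 1), hatQ (Real.pi / 4) t x lam =
      evalV (ρ := ρ) (mem_annulus_of_norm_eq_one hl) (pHat ρ (-t) (loopY (swapBC x))) :=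
    fun hl => hatQ_eq _ hy.right
  have hre : ∀ {z : ℂ}, z - star z = 0 → (z = 0 ↔ z.re = 0) := by
    intro z hz
    have him : z.im = 0 := by
      have := congrArg Complex.im hz
      simp at this
      linarith
    rw [Complex.ext_iff]
    simp [him]
  have e1 : antisym (pHat ρ t (loopY x)) = 0 ↔ ∀ lam : ℂ, ‖lam‖ = 1 →
      hatP (Real.pi / 4) t x lam - loopStar (hatP (Real.pi / 4) t x) lam = 0 := by
    rw [antisym_eq_zero_iff_forall_evalV (ρ := ρ)]
    refine forall_congr' fun lam => forall_congr' fun hl => ?_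
    rw [loopStar_apply _ hl, hP hl]
  have e2 : antisym (pHat ρ (-t) (loopY (swapBC x))) = 0 ↔ ∀ lam : ℂ, ‖lam‖ = 1 →
      hatQ (Real.pi / 4) t x lam - loopStar (hatQ (Real.pi / 4) t x) lam = 0 := by
    rw [antisym_eq_zero_iff_forall_evalV (ρ := ρ)]
    refine forall_congr' fun lam => forall_congr' fun hl => ?_
    rw [loopStar_apply _ hl, hQ hl]
  have e3 : kPlus ρ x.r (PlusLoop.toL1 (x.tilde 0)) (PlusLoop.toL1 (x.tilde 1))
      (PlusLoop.toL1 (x.tilde 2)) = 0 ↔ ∀ lam : ℂ, ‖lam‖ = 1 → calK (Real.pi / 4) x lam = -1 := by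
    have he : ∀ lam : ℂ, ∀ hl : ‖lam‖ = 1, evalU (ρ := ρ) (hl.le.trans hρ.out.le)
        (kPlus ρ x.r (PlusLoop.toL1 (x.tilde 0)) (PlusLoop.toL1 (x.tilde 1))
          (PlusLoop.toL1 (x.tilde 2))) = lam * (calK (Real.pi / 4) x lam + 1) :=
      fun lam hl => evalU_kPlus (mem_annulus_of_norm_eq_one hl) x
    constructor
    · intro h lam hl
      have := he lam hl
      rw [h, map_zero, eq_comm, mul_eq_zero] at this
      exact eq_neg_of_add_eq_zero_left
        (this.resolve_left (ne_zero_of_mem_annulus (mem_annulus_of_norm_eq_one (ρ := ρ) hl)))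
    · intro h
      refine eq_zero_of_evalU_eq_zero (ρ := ρ) fun lam hl => ?_
      rw [he lam hl, h lam hl, neg_add_cancel, mul_zero]
  have hn := norm_exp_I_mul x.theta
  -- `circEval` sees only the real part of the value; once the antisymmetric part vanishes, the
  -- value on the circle is real and nothing is lost.
  have e4 : antisym (pHat ρ t (loopY x)) = 0 → (circEval ρ x.theta (pHat ρ t (loopY x)) = 0 ↔
      hatP (Real.pi / 4) t x (Complex.exp (Complex.I * x.theta)) = 0) := fun h => by
    rw [hP hn, circEval_eq_re]
    exact (hre ((antisym_eq_zero_iff_forall_evalV (ρ := ρ) _).1 h _ hn)).symm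
  have e5 : antisym (pHat ρ (-t) (loopY (swapBC x))) = 0 →
      (circEval ρ x.theta (pHat ρ (-t) (loopY (swapBC x))) = 0 ↔
      hatQ (Real.pi / 4) t x (Complex.exp (Complex.I * x.theta)) = 0) := fun h => by
    rw [hQ hn, circEval_eq_re]
    exact (hre ((antisym_eq_zero_iff_forall_evalV (ρ := ρ) _).1 h _ hn)).symm
  simp only [monF, Prod.mk_eq_zero]
  constructor
  · rintro ⟨h1, h2, h3, h4, h5⟩
    exact ⟨e1.1 h1, e2.1 h2, e3.1 h3, hy.theta, (e4 h1).1 h4, (e5 h2).1 h5⟩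
  · intro h
    have h1 := e1.2 h.calF_eq
    have h2 := e2.2 h.calG_eq
    exact ⟨h1, h2, e3.2 h.calK_eq, (e4 h1).2 h.calH₁_eq, (e5 h2).2 h.calH₂_eq⟩

/-! ### Smoothness -/

theorem contDiff_tilde (l : Fin 3) : ContDiff ℝ ∞ fun x : Param ρ => x.tilde l := by
  fin_cases l <;> simp only [Param.tilde, Fin.zero_eta, Fin.mk_one, Fin.reduceFinMk,
    Matrix.cons_val] <;> fun_prop

theorem contDiff_r : ContDiff ℝ ∞ fun x : Param ρ => x.r := by
  unfold Param.r; fun_prop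

theorem contDiff_theta : ContDiff ℝ ∞ fun x : Param ρ => x.theta := by
  unfold Param.theta; fun_prop

theorem contDiff_swapBC : ContDiff ℝ ∞ (swapBC (ρ := ρ)) := by
  unfold swapBC; fun_prop

theorem contDiff_toL1_tilde (l : Fin 3) :
    ContDiff ℝ ∞ fun x : Param ρ => PlusLoop.toL1 (x.tilde l) :=
  (PlusLoop.toL1 (ρ := ρ)).contDiff.comp (contDiff_tilde l)

theorem contDiff_loopY : ContDiff ℝ ∞ (loopY (ρ := ρ)) := by
  refine contDiff_pi.2 fun l => ContDiff.smul contDiff_r ?_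
  exact contDiff_const.add (embV.contDiff.comp (contDiff_toL1_tilde l))

theorem contDiffAt_pHat_comp {X : Type*} [NormedAddCommGroup X] [NormedSpace ℝ X] {f : X → ℝ}
    {g : X → Param ρ} {y : X} (hf : ContDiffAt ℝ ∞ f y) (hg : ContDiffAt ℝ ∞ g y)
    (h : f y • loopY (g y) ∈ small ρ) :
    ContDiffAt ℝ ∞ (fun y => pHat ρ (f y) (loopY (g y))) y :=
  ContDiffAt.comp y (g := fun y : ℝ × (Fin 3 → L1 ℤ) => pHat ρ y.1 y.2)
    (f := fun y => (f y, loopY (g y))) (contDiffAt_pHat h)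
    (hf.prodMk (contDiff_loopY.contDiffAt.comp y hg))

omit hρ in
theorem contDiff_kPlus {X : Type*} [NormedAddCommGroup X] [NormedSpace ℝ X] {r : X → ℝ}
    {a b c : X → L1 ℕ} (hr : ContDiff ℝ ∞ r) (ha : ContDiff ℝ ∞ a) (hb : ContDiff ℝ ∞ b)
    (hc : ContDiff ℝ ∞ c) : ContDiff ℝ ∞ fun y => kPlus ρ (r y) (a y) (b y) (c y) := by
  have hm : ∀ {f g : X → L1 ℕ}, ContDiff ℝ ∞ f → ContDiff ℝ ∞ g →
      ContDiff ℝ ∞ fun y => mulU (f y) (g y) :=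
    fun hf hg => (mulU.contDiff.comp hf).clm_apply hg
  unfold kPlus
  have h2 : ContDiff ℝ ∞ fun y => r y ^ 2 := hr.pow 2
  have h3 : ContDiff ℝ ∞ fun y => 1 - r y ^ 2 := contDiff_const.sub h2
  refine ContDiff.add (h3.smul contDiff_const)
    (h2.smul (ContDiff.add (ContDiff.add (ContDiff.sub ha (hm contDiff_const ha)) ?_) ?_))
  · exact ContDiff.const_smul _ ((hb.add hc).add (hm contDiff_const (hb.add hc)))
  · exact hm contDiff_const (((hm ha ha).sub (hm hb hb)).sub (hm hc hc))

theorem contDiffAt_monF {y : ℝ × Param ρ} (hy : Regular y) : ContDiffAt ℝ ∞ monF y := by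
  have h1 : ContDiffAt ℝ ∞ (fun y : ℝ × Param ρ => pHat ρ y.1 (loopY y.2)) y :=
    contDiffAt_pHat_comp contDiffAt_fst contDiffAt_snd hy.left
  have h2 : ContDiffAt ℝ ∞ (fun y : ℝ × Param ρ => pHat ρ (-y.1) (loopY (swapBC y.2))) y :=
    contDiffAt_pHat_comp (g := fun y : ℝ × Param ρ => swapBC y.2) contDiffAt_fst.neg
      (contDiff_swapBC.contDiffAt.comp y contDiffAt_snd) hy.right
  have h3 : ContDiffAt ℝ ∞ (fun y : ℝ × Param ρ => circEval ρ y.2.theta) y :=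
    (contDiff_circEval.comp (contDiff_theta.comp contDiff_snd)).contDiffAt
  have h4 : ContDiff ℝ ∞ fun x : Param ρ => kPlus ρ x.r (PlusLoop.toL1 (x.tilde 0))
      (PlusLoop.toL1 (x.tilde 1)) (PlusLoop.toL1 (x.tilde 2)) :=
    contDiff_kPlus contDiff_r (contDiff_toL1_tilde 0) (contDiff_toL1_tilde 1)
      (contDiff_toL1_tilde 2)
  exact (antisym.contDiff.contDiffAt.comp y h1).prodMk
    ((antisym.contDiff.contDiffAt.comp y h2).prodMk
    ((h4.comp contDiff_snd).contDiffAt.prodMk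
    ((h3.clm_apply h1).prodMk (h3.clm_apply h2))))

theorem eventually_regular {y : ℝ × Param ρ} (hy : Regular y) : ∀ᶠ y' in 𝓝 y, Regular y' := by
  have h1 : Continuous fun y : ℝ × Param ρ => y.1 • loopY y.2 :=
    continuous_fst.smul (contDiff_loopY.continuous.comp continuous_snd)
  have h2 : Continuous fun y : ℝ × Param ρ => (-y.1) • loopY (swapBC y.2) :=
    continuous_fst.neg.smul (contDiff_loopY.continuous.comp
      (contDiff_swapBC.continuous.comp continuous_snd))
  have h3 : Continuous fun y : ℝ × Param ρ => y.2.theta :=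
    contDiff_theta.continuous.comp continuous_snd
  filter_upwards [h1.continuousAt.eventually (isOpen_small.mem_nhds hy.left),
    h2.continuousAt.eventually (isOpen_small.mem_nhds hy.right),
    h3.continuousAt.eventually (isOpen_Ioo.mem_nhds hy.theta)] with y' a b c using ⟨a, b, c⟩

theorem regular_central : Regular ((0, centralParam ρ) : ℝ × Param ρ) := by
  refine ⟨?_, ?_, ?_⟩
  · rw [zero_smul]; exact zero_mem_small
  · rw [neg_zero, zero_smul]; exact zero_mem_small
  · have := Real.pi_pos
    exact ⟨by simp [centralParam, Param.theta]; positivity,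
      by simp [centralParam, Param.theta]; linarith⟩

/-! ### The partial differential at the central value -/

omit hρ in
theorem antisym_centralV_two : antisym (centralV ρ 2) = 0 := by
  rw [antisym_eq_zero_iff]
  simp only [centralV, Matrix.cons_val, map_smul, map_add, monV, reflect_basis]
  simp [wt, add_comm]

theorem circEval_centralV_two (θ : ℝ) :
    circEval ρ θ (centralV ρ 2) = -(√2 / 2) * Real.cos θ := by
  simp [centralV, monV, circEval_basis, wt, rho_pos.ne']
  ring

/-- At `t = 0` the formula `pHat_zero` makes the functional explicit, so its partial differential
can be read off along lines. The sine is the value of `c̲` near the angle `π/2`, where it vanishes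
to first order. -/
theorem monF_zero_central_add (v : Param ρ) (ε : ℝ) :
    monF ((0, centralParam ρ + ε • v) : ℝ × Param ρ) =
      ((2 * Real.pi * (1 + ε * v.r) * ε) • antisym (embV (PlusLoop.toL1 (v.tilde 2))),
       (2 * Real.pi * (1 + ε * v.r) * ε) • antisym (embV (PlusLoop.toL1 (v.tilde 1))),
       kPlus ρ (1 + ε * v.r) (ε • PlusLoop.toL1 (v.tilde 0)) (ε • PlusLoop.toL1 (v.tilde 1))
        (ε • PlusLoop.toL1 (v.tilde 2)),
       2 * Real.pi * (1 + ε * v.r) * (√2 / 2 * Real.sin (ε * v.theta) +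
        ε * circEval ρ (Real.pi / 2 + ε * v.theta) (embV (PlusLoop.toL1 (v.tilde 2)))),
       2 * Real.pi * (1 + ε * v.r) * (√2 / 2 * Real.sin (ε * v.theta) +
        ε * circEval ρ (Real.pi / 2 + ε * v.theta) (embV (PlusLoop.toL1 (v.tilde 1))))) := by
  obtain ⟨a, b, c, r, θ⟩ := v
  have hx : centralParam ρ + ε • ((a, b, c, r, θ) : Param ρ) =
      (ε • a, ε • b, ε • c, 1 + ε * r, Real.pi / 2 + ε * θ) := by
    simp [centralParam]
  have h21 : (centralV ρ 1) = centralV ρ 2 := rfl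
  rw [hx]
  simp only [monF, neg_zero, pHat_zero, loopY, swapBC, Param.tilde, Param.r, Param.theta,
    Matrix.cons_val, map_smul, map_add, antisym_centralV_two, circEval_centralV_two, zero_add,
    add_comm (Real.pi / 2), Real.cos_add_pi_div_two, smul_smul, smul_eq_mul, mul_assoc]
  congr 4
  all_goals ring

theorem hasDerivAt_monF_line (v : Param ρ) :
    HasDerivAt (fun ε : ℝ => monF ((0, centralParam ρ + ε • v) : ℝ × Param ρ))
      ((2 * Real.pi) • antisym (embV (PlusLoop.toL1 (v.tilde 2))),
       (2 * Real.pi) • antisym (embV (PlusLoop.toL1 (v.tilde 1))),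
       kLin ρ v.r (PlusLoop.toL1 (v.tilde 0)) (PlusLoop.toL1 (v.tilde 1))
        (PlusLoop.toL1 (v.tilde 2)),
       2 * Real.pi * (√2 / 2 * v.theta +
        circEval ρ (Real.pi / 2) (embV (PlusLoop.toL1 (v.tilde 2)))),
       2 * Real.pi * (√2 / 2 * v.theta +
        circEval ρ (Real.pi / 2) (embV (PlusLoop.toL1 (v.tilde 1))))) 0 := by
  simp only [monF_zero_central_add]
  have hid : ∀ s : ℝ, HasDerivAt (fun ε : ℝ => ε * s) s 0 := fun s => by
    simpa using (hasDerivAt_id (0 : ℝ)).mul_const s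
  have h1 : HasDerivAt (fun ε : ℝ => 2 * Real.pi * (1 + ε * v.r) * ε) (2 * Real.pi) 0 := by
    have := (((hid v.r).const_add 1).const_mul (2 * Real.pi)).mul (hasDerivAt_id (0 : ℝ))
    refine this.congr_deriv ?_
    simp
  have h3 : HasDerivAt (fun ε : ℝ => kPlus ρ (1 + ε * v.r) (ε • PlusLoop.toL1 (v.tilde 0))
      (ε • PlusLoop.toL1 (v.tilde 1)) (ε • PlusLoop.toL1 (v.tilde 2)))
      (kLin ρ v.r (PlusLoop.toL1 (v.tilde 0)) (PlusLoop.toL1 (v.tilde 1))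
        (PlusLoop.toL1 (v.tilde 2))) 0 := by
    set A := PlusLoop.toL1 (v.tilde 0)
    set B := PlusLoop.toL1 (v.tilde 1)
    set C := PlusLoop.toL1 (v.tilde 2)
    have e : (fun ε : ℝ => kPlus ρ (1 + ε * v.r) (ε • A) (ε • B) (ε • C)) = fun ε : ℝ =>
        (1 - (1 + ε * v.r) ^ 2) • monU ρ 1 + ((1 + ε * v.r) ^ 2 * ε) • (A - mulU (monU ρ 2) A +
          (√2 / 2) • (B + C + mulU (monU ρ 2) (B + C))) + ((1 + ε * v.r) ^ 2 * ε ^ 2) •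
          mulU (monU ρ 1) (mulU A A - mulU B B - mulU C C) := by
      ext1 ε
      simp only [kPlus, map_smul, smul_apply, map_add, map_sub]
      module
    rw [e]
    have hr := ((hid v.r).const_add 1).pow 2
    have d1 := (hr.const_sub 1).smul_const (monU ρ 1)
    have d2 := (hr.mul (hasDerivAt_id (0 : ℝ))).smul_const (A - mulU (monU ρ 2) A +
          (√2 / 2) • (B + C + mulU (monU ρ 2) (B + C)))
    have d3 := (hr.mul ((hasDerivAt_id (0 : ℝ)).pow 2)).smul_const
      (mulU (monU ρ 1) (mulU A A - mulU B B - mulU C C))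
    refine ((d1.add d2).add d3).congr_deriv ?_
    simp [kLin]
    abel
  have h4 : ∀ u : L1 ℤ, HasDerivAt (fun ε : ℝ => 2 * Real.pi * (1 + ε * v.r) *
      (√2 / 2 * Real.sin (ε * v.theta) + ε * circEval ρ (Real.pi / 2 + ε * v.theta) u))
      (2 * Real.pi * (√2 / 2 * v.theta + circEval ρ (Real.pi / 2) u)) 0 := by
    intro u
    have hd : DifferentiableAt ℝ (fun ε : ℝ => circEval ρ (Real.pi / 2 + ε * v.theta) u) 0 := by
      have := (contDiff_circEval (ρ := ρ)).differentiable (by simp)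
      fun_prop
    have d1 := ((hid v.r).const_add 1).const_mul (2 * Real.pi)
    have d2 := (hid v.theta).sin.const_mul (√2 / 2)
    have d3 := (hasDerivAt_id (0 : ℝ)).mul hd.hasDerivAt
    refine (d1.mul (d2.add d3)).congr_deriv ?_
    simp
  exact (h1.smul_const _).prodMk ((h1.smul_const _).prodMk (h3.prodMk ((h4 _).prodMk (h4 _))))

theorem fderiv_monF_inr (v : Param ρ) :
    (fderiv ℝ monF ((0, centralParam ρ) : ℝ × Param ρ) ∘L .inr ℝ ℝ (Param ρ)) v =
      ((2 * Real.pi) • antisym (embV (PlusLoop.toL1 (v.tilde 2))),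
       (2 * Real.pi) • antisym (embV (PlusLoop.toL1 (v.tilde 1))),
       kLin ρ v.r (PlusLoop.toL1 (v.tilde 0)) (PlusLoop.toL1 (v.tilde 1))
        (PlusLoop.toL1 (v.tilde 2)),
       2 * Real.pi * (√2 / 2 * v.theta +
        circEval ρ (Real.pi / 2) (embV (PlusLoop.toL1 (v.tilde 2)))),
       2 * Real.pi * (√2 / 2 * v.theta +
        circEval ρ (Real.pi / 2) (embV (PlusLoop.toL1 (v.tilde 1))))) := by
  have h1 : HasFDerivAt monF (fderiv ℝ monF ((0, centralParam ρ) : ℝ × Param ρ))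
      ((0, centralParam ρ + (0 : ℝ) • v) : ℝ × Param ρ) := by
    rw [zero_smul, add_zero]
    exact ((contDiffAt_monF regular_central).differentiableAt (by simp)).hasFDerivAt
  have h2 : HasDerivAt (fun ε : ℝ => ((0, centralParam ρ + ε • v) : ℝ × Param ρ)) (0, v) 0 := by
    refine (hasDerivAt_const _ _).prodMk ?_
    simpa using ((hasDerivAt_id (0 : ℝ)).smul_const v).const_add (centralParam ρ)
  have h3 : HasDerivAt (fun ε : ℝ => monF ((0, centralParam ρ + ε • v) : ℝ × Param ρ))
      (fderiv ℝ monF ((0, centralParam ρ) : ℝ × Param ρ) (0, v)) 0 :=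
    HasFDerivAt.comp_hasDerivAt (l := monF)
      (f := fun ε : ℝ => ((0, centralParam ρ + ε • v) : ℝ × Param ρ)) (0 : ℝ) h1 h2
  exact h3.unique (hasDerivAt_monF_line v)

theorem isInvertible_fderiv_monF :
    (fderiv ℝ monF ((0, centralParam ρ) : ℝ × Param ρ) ∘L .inr ℝ ℝ (Param ρ)).IsInvertible := by
  set T := fderiv ℝ monF ((0, centralParam ρ) : ℝ × Param ρ) ∘L .inr ℝ ℝ (Param ρ) with hT
  have h2π : 2 * Real.pi ≠ 0 := by positivity
  have hker : T.ker = ⊥ := by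
    rw [LinearMap.ker_eq_bot']
    intro v hv
    change T v = 0 at hv
    rw [hT, fderiv_monF_inr] at hv
    simp only [Prod.mk_eq_zero, smul_eq_zero, mul_eq_zero, h2π, false_or] at hv
    obtain ⟨h1, h2, h3, h4, h5⟩ := hv
    obtain ⟨ha, hb, hc, hr, hθ⟩ := lin_injective h1 h2 h3 h4 h5
    obtain ⟨a, b, c, r, θ⟩ := v
    simp only [Param.tilde, Matrix.cons_val, map_eq_zero_iff _ (PlusLoop.toL1 (ρ := ρ)).injective,
      Param.r, Param.theta] at ha hb hc hr hθ
    simp [ha, hb, hc, hr, hθ]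
  have hran : T.range = ⊤ := by
    rw [LinearMap.range_eq_top]
    rintro ⟨f, g, k, h₁, h₂⟩
    obtain ⟨a, b, c, r, θ, e1, e2, e3, e4, e5⟩ := lin_surjective (ρ := ρ)
      ((2 * Real.pi)⁻¹ • f) ((2 * Real.pi)⁻¹ • g) k ((2 * Real.pi)⁻¹ * h₁) ((2 * Real.pi)⁻¹ * h₂)
    refine ⟨(PlusLoop.toL1.symm a, PlusLoop.toL1.symm b, PlusLoop.toL1.symm c, r, θ), ?_⟩
    change T _ = _
    rw [hT, fderiv_monF_inr]
    simp only [Param.tilde, Param.r, Param.theta, Matrix.cons_val,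
      LinearIsometryEquiv.apply_symm_apply, e1, e2, e3, e4, e5, smul_inv_smul₀ h2π,
      mul_inv_cancel_left₀ h2π]
  -- Bijectivity suffices: by the open mapping theorem the inverse is bounded.
  exact ⟨ContinuousLinearEquiv.ofBijective T hker hran, 
    ContinuousLinearMap.ext fun _ => rfl⟩

/-! ### The implicit function theorem -/

theorem monF_central : monF ((0, centralParam ρ) : ℝ × Param ρ) = 0 := by
  have := monF_zero_central_add (0 : Param ρ) 0
  simp [kPlus, Param.r] at this
  exact this

/-- There is a smooth family of solutions, and every solution close to the central value belongs
to it. -/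
theorem exists_solution_family (ρ : ℝ) [Fact (1 < ρ)] : ∃ g : ℝ → Param ρ,
    IsSolutionFamily (Real.pi / 4) g ∧ ∀ᶠ y in 𝓝 ((0, centralParam ρ) : ℝ × Param ρ),
      MonodromyProblem (Real.pi / 4) y.1 y.2 → g y.1 = y.2 := by
  have hc : ContDiffAt ℝ ∞ monF ((0, centralParam ρ) : ℝ × Param ρ) :=
    contDiffAt_monF regular_central
  have hn : (∞ : WithTop ℕ∞) ≠ 0 := by simp
  have hi := isInvertible_fderiv_monF (ρ := ρ)
  have h0 : hc.implicitFunction hn hi 0 = centralParam ρ := hc.implicitFunction_apply_self hn hi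
  have hcd : ContDiffAt ℝ ∞ (hc.implicitFunction hn hi) 0 := hc.contDiffAt_implicitFunction hn hi
  refine ⟨hc.implicitFunction hn hi, ⟨h0, hcd, ?_⟩, ?_⟩
  · have hreg := eventually_regular (regular_central (ρ := ρ))
    have hcont : ContinuousAt (fun t => (t, hc.implicitFunction hn hi t)) 0 :=
      continuousAt_id.prodMk hcd.continuousAt
    have hreg' : ∀ᶠ t in 𝓝 (0 : ℝ), Regular (t, hc.implicitFunction hn hi t) := by
      refine hcont.eventually (p := Regular) ?_
      simpa only [h0] using hreg
    filter_upwards [hreg', hc.eventually_apply_implicitFunction hn hi] with t ht ht'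
    rw [monF_central] at ht'
    exact (monF_eq_zero_iff ht).1 ht'
  · filter_upwards [eventually_regular (regular_central (ρ := ρ)),
      hc.eventually_apply_eq_iff_implicitFunction hn hi] with y hy hy' hm
    refine hy'.1 ?_
    rw [monF_central]
    exact (monF_eq_zero_iff hy).2 hm

/-- Local uniqueness in the implicit function theorem determines the germ of a family, so symmetries
of the problem are inherited by its solutions. -/
theorem IsSolutionFamily.eventuallyEq {x x' : ℝ → Param ρ}
    (h : IsSolutionFamily (Real.pi / 4) x) (h' : IsSolutionFamily (Real.pi / 4) x') :
    x =ᶠ[𝓝 0] x' := by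
  obtain ⟨g, -, hg⟩ := exists_solution_family ρ
  have aux : ∀ {z : ℝ → Param ρ}, IsSolutionFamily (Real.pi / 4) z → g =ᶠ[𝓝 0] z := by
    intro z hz
    have hcont : ContinuousAt (fun t => (t, z t)) 0 := continuousAt_id.prodMk hz.smooth.continuousAt
    have := hcont.eventually (p := fun y => MonodromyProblem (Real.pi / 4) y.1 y.2 → g y.1 = y.2)
      (by simpa only [hz.initial] using hg)
    filter_upwards [this, hz.solves] with t ht ht' using ht ht'
  exact (aux h).symm.trans (aux h')

end Functional

section Symmetry

variable {ρ : ℝ} [hρ : Fact (1 < ρ)]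

/-! ### The symmetries of the solutions -/

/-- The exchange of `b` and `c` together with `t ↦ -t` interchanges `𝔭̂` and `𝔮̂`. The determinant
is unchanged because `b̲ = c̲` for `φ = π/4`. -/
theorem monodromyProblem_swapBC {t : ℝ} {x : Param ρ} (hr : Regular (t, x))
    (h : MonodromyProblem (Real.pi / 4) t x) :
    MonodromyProblem (Real.pi / 4) (-t) (swapBC x) := by
  have hP : ∀ {lam : ℂ}, ‖lam‖ = 1 →
      hatP (Real.pi / 4) (-t) (swapBC x) lam = hatQ (Real.pi / 4) t x lam := fun hl => by
    rw [hatQ_eq (mem_annulus_of_norm_eq_one hl) hr.right,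
      hatP_eq (mem_annulus_of_norm_eq_one hl) hr.right]
  have hleft : (-(-t)) • loopY (swapBC (swapBC x)) ∈ small ρ := by
    rw [neg_neg]; exact hr.left
  have hQ : ∀ {lam : ℂ}, ‖lam‖ = 1 →
      hatQ (Real.pi / 4) (-t) (swapBC x) lam = hatP (Real.pi / 4) t x lam := fun hl => by
    rw [hatQ_eq (mem_annulus_of_norm_eq_one hl) hleft,
      hatP_eq (mem_annulus_of_norm_eq_one hl) hr.left, neg_neg]
    rfl
  have hn := norm_exp_I_mul x.theta
  refine ⟨fun lam hl => ?_, fun lam hl => ?_, fun lam hl => ?_, h.theta_mem, ?_, ?_⟩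
  · rw [loopStar_apply _ hl, hP hl, ← loopStar_apply _ hl]
    exact h.calG_eq lam hl
  · rw [loopStar_apply _ hl, hQ hl, ← loopStar_apply _ hl]
    exact h.calF_eq lam hl
  · rw [← h.calK_eq lam hl, calK_eq, calK_eq]
    simp only [abc, swapBC, Param.tilde, Param.r, Matrix.cons_val,
      evalLaurent_central (ne_zero_of_mem_annulus (mem_annulus_of_norm_eq_one (ρ := ρ) hl))]
    ring
  · exact (hP hn).trans h.calH₂_eq
  · exact (hQ hn).trans h.calH₁_eq

/-- The substitution `h(λ) ↦ -h(-λ)`. -/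
def oddSub : L1 ℕ →L[ℝ] L1 ℕ :=
  L1.lift (fun k => (-1 : ℝ) ^ (k + 1) • L1.basis k) 1 fun k => by
    rw [norm_smul, L1.norm_basis, norm_pow, norm_neg, norm_one, one_pow, one_mul]

theorem evalU_oddSub {lam : ℂ} (hl : ‖lam‖ ≤ ρ) (hl' : ‖-lam‖ ≤ ρ) (u : L1 ℕ) :
    evalU hl (oddSub u) = -evalU hl' u := by
  refine L1.clm_congr (f := (evalU hl).comp oddSub) (g := -evalU hl') (fun k => ?_) u
  rw [ContinuousLinearMap.comp_apply, oddSub, L1.lift_basis, map_smul, neg_apply,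
    evalU_basis, evalU_basis, Complex.real_smul, neg_pow lam]
  push_cast
  ring

/-- The substitution `h(λ) ↦ -h(-λ)` on the loop space. -/
def oddLoop : PlusLoop ρ →L[ℝ] PlusLoop ρ :=
  (PlusLoop.toL1 (ρ := ρ)).symm.toContinuousLinearEquiv.toContinuousLinearMap.comp
    (oddSub.comp (PlusLoop.toL1 (ρ := ρ)).toContinuousLinearEquiv.toContinuousLinearMap)

theorem eval_oddLoop (h : PlusLoop ρ) {lam : ℂ} (hl : ‖lam‖ ≤ ρ) :
    (oddLoop h).eval lam = -h.eval (-lam) := by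
  have hl' : ‖-lam‖ ≤ ρ := by rwa [norm_neg]
  rw [PlusLoop.eval_eq _ hl, PlusLoop.eval_eq _ hl', ← evalU_oddSub hl hl']
  congr 1
  exact PlusLoop.toL1.apply_symm_apply _

/-- The substitution `λ ↦ -λ` on the parameters. -/
def negLoop (x : Param ρ) : Param ρ :=
  (oddLoop x.1, oddLoop x.2.1, oddLoop x.2.2.1, x.r, Real.pi - x.theta)

theorem contDiff_negLoop : ContDiff ℝ ∞ (negLoop (ρ := ρ)) := by
  have h := contDiff_theta (ρ := ρ)
  have h' := contDiff_r (ρ := ρ)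
  unfold negLoop
  fun_prop

theorem abc_negLoop (x : Param ρ) {lam : ℂ} (hl : lam ∈ annulus ρ) (i : Fin 3) :
    abc (Real.pi / 4) (negLoop x) lam i = -abc (Real.pi / 4) x (-lam) i := by
  have h0 := ne_zero_of_mem_annulus hl
  rw [abc, abc, evalLaurent_central h0, evalLaurent_central (neg_ne_zero.2 h0)]
  fin_cases i <;>
    simp only [negLoop, Param.tilde, Fin.zero_eta, Fin.mk_one, Fin.reduceFinMk, Matrix.cons_val,
      eval_oddLoop _ hl.2, zpow_neg, zpow_one, inv_neg] <;> ring

theorem potential_negLoop (t : ℝ) (x : Param ρ) {lam : ℂ} (hl : lam ∈ annulus ρ) :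
    potential (Real.pi / 4) (-t) (negLoop x) lam = potential (Real.pi / 4) t x (-lam) := by
  funext z
  ext i j
  rw [potential_apply, potential_apply]
  refine Finset.sum_congr rfl fun l _ => ?_
  rw [abc_negLoop x hl]
  change ((x.r * -t : ℝ) : ℂ) * _ * _ = _
  push_cast
  ring

theorem dslope_comp_neg (f : ℝ → ℂ) (t : ℝ) :
    dslope (fun s => f (-s)) 0 (-t) = -dslope f 0 t := by
  rcases eq_or_ne t 0 with rfl | h
  · rw [neg_zero, dslope_same, dslope_same, deriv_comp_neg, neg_zero]
  · rw [dslope_of_ne _ (neg_ne_zero.2 h), dslope_of_ne _ h, slope_def_module, slope_def_module,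
      neg_neg, neg_zero, sub_zero, sub_zero, inv_neg, neg_smul]

theorem hatP_negLoop (t : ℝ) (x : Param ρ) {lam : ℂ} (hl : lam ∈ annulus ρ) :
    hatP (Real.pi / 4) (-t) (negLoop x) lam = -hatP (Real.pi / 4) t x (-lam) := by
  rw [hatP, hatP, ← dslope_comp_neg]
  congr 1
  funext s
  have h := potential_negLoop (-s) x hl
  rw [neg_neg] at h
  simp only [frakP, calP, h]

theorem hatQ_negLoop (t : ℝ) (x : Param ρ) {lam : ℂ} (hl : lam ∈ annulus ρ) :
    hatQ (Real.pi / 4) (-t) (negLoop x) lam = -hatQ (Real.pi / 4) t x (-lam) := by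
  rw [hatQ, hatQ, ← dslope_comp_neg]
  congr 1
  funext s
  have h := potential_negLoop (-s) x hl
  rw [neg_neg] at h
  simp only [frakQ, calQ, h]

/-- The central values are odd in `λ`, so replacing `h(λ)` by `-h(-λ)` and `t` by `-t` amounts to `λ
↦ -λ`. A zero at `e^{iθ}` yields one at `-e^{iθ}`; since coefficients are real its conjugate `e^{i(π
- θ)}` is also a zero, and this angle stays in `(0, π)`. -/
theorem monodromyProblem_negLoop {t : ℝ} {x : Param ρ} (hr : Regular (t, x))
    (h : MonodromyProblem (Real.pi / 4) t x) :
    MonodromyProblem (Real.pi / 4) (-t) (negLoop x) := by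
  have hm : ∀ {lam : ℂ}, ‖lam‖ = 1 → lam ∈ annulus ρ := mem_annulus_of_norm_eq_one
  have hneg : ∀ {lam : ℂ}, ‖lam‖ = 1 → ‖-lam‖ = 1 := fun h => by rwa [norm_neg]
  have hn := norm_exp_I_mul x.theta
  have hn' := norm_exp_I_mul (negLoop x).theta
  have he : -Complex.exp (Complex.I * (negLoop x).theta) =
      star (Complex.exp (Complex.I * x.theta)) := by
    have h1 : Complex.I * ((negLoop x).theta : ℂ) = Real.pi * Complex.I + -(Complex.I * x.theta) := by
      change Complex.I * ((Real.pi - x.theta : ℝ) : ℂ) = _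
      push_cast
      ring
    rw [h1, Complex.exp_add, Complex.exp_pi_mul_I, neg_one_mul, neg_neg, Complex.star_def,
      ← Complex.exp_conj]
    simp
  have hs : ‖star (Complex.exp (Complex.I * x.theta))‖ = 1 := by rw [norm_star, hn]
  refine ⟨fun lam hl => ?_, fun lam hl => ?_, fun lam hl => ?_, ?_, ?_, ?_⟩
  · have := h.calF_eq (-lam) (hneg hl)
    rw [loopStar_apply _ (hneg hl)] at this
    rw [loopStar_apply _ hl, hatP_negLoop t x (hm hl), star_neg]
    linear_combination -this
  · have := h.calG_eq (-lam) (hneg hl)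
    rw [loopStar_apply _ (hneg hl)] at this
    rw [loopStar_apply _ hl, hatQ_negLoop t x (hm hl), star_neg]
    linear_combination -this
  · rw [← h.calK_eq (-lam) (hneg hl), calK_eq, calK_eq]
    simp only [abc_negLoop x (hm hl), neg_sq]
    rfl
  · have := h.theta_mem
    exact ⟨sub_pos.2 this.2, sub_lt_self _ this.1⟩
  · rw [hatP_negLoop t x (hm hn'), he, hatP_eq (hm hs) hr.left, conj_evalV (hm hn),
      ← hatP_eq (hm hn) hr.left, h.calH₁_eq]
    simp
  · rw [hatQ_negLoop t x (hm hn'), he, hatQ_eq (hm hs) hr.right, conj_evalV (hm hn),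
      ← hatQ_eq (hm hn) hr.right, h.calH₂_eq]
    simp

/-! ### Symmetries inherited by a solution family. -/

section Family

variable {x : ℝ → Param ρ} (hx : IsSolutionFamily (Real.pi / 4) x)

include hx

theorem IsSolutionFamily.eventually_regular : ∀ᶠ t in 𝓝 (0 : ℝ), Regular (t, x t) := by
  have hcont : ContinuousAt (fun t => (t, x t)) 0 := continuousAt_id.prodMk hx.smooth.continuousAt
  refine hcont.eventually (p := Regular) ?_
  simpa only [hx.initial] using DPW.eventually_regular (regular_central (ρ := ρ))

theorem IsSolutionFamily.reverse {σ : Param ρ → Param ρ} (hσ : ContDiff ℝ ∞ σ)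
    (h0 : σ (centralParam ρ) = centralParam ρ)
    (h : ∀ {t : ℝ} {x : Param ρ}, Regular (t, x) → MonodromyProblem (Real.pi / 4) t x →
      MonodromyProblem (Real.pi / 4) (-t) (σ x)) :
    IsSolutionFamily (Real.pi / 4) fun t => σ (x (-t)) := by
  have hn : Filter.Tendsto (fun s : ℝ => -s) (𝓝 0) (𝓝 0) := by
    simpa using (continuous_neg (G := ℝ)).tendsto 0
  refine ⟨by rw [neg_zero, hx.initial, h0], ?_, ?_⟩
  · refine hσ.contDiffAt.comp 0 (ContDiffAt.comp (g := x) 0 ?_ contDiffAt_id.neg)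
    simpa using hx.smooth
  · filter_upwards [hn.eventually hx.eventually_regular, hn.eventually hx.solves] with t h1 h2
    simpa using h h1 h2

theorem IsSolutionFamily.eventually_swapBC : ∀ᶠ t in 𝓝 (0 : ℝ), x t = swapBC (x (-t)) :=
  hx.eventuallyEq (hx.reverse contDiff_swapBC rfl monodromyProblem_swapBC)

/-- The two symmetries give `θ(t) = θ(-t)` and `θ(t) = π - θ(-t)`; add them. -/
theorem IsSolutionFamily.eventually_theta : ∀ᶠ t in 𝓝 (0 : ℝ), (x t).theta = Real.pi / 2 := by
  have h0 : negLoop (centralParam ρ) = centralParam ρ := by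
    simp [negLoop, centralParam, Param.r, Param.theta]
    ring
  filter_upwards [hx.eventually_swapBC,
    hx.eventuallyEq (hx.reverse contDiff_negLoop h0 monodromyProblem_negLoop)] with t h1 h2
  have e1 : (x t).theta = (swapBC (x (-t))).theta := congrArg Param.theta h1
  have e2 : (x t).theta = (negLoop (x (-t))).theta := congrArg Param.theta h2
  change _ = (x (-t)).theta at e1
  change _ = Real.pi - (x (-t)).theta at e2
  linarith

theorem IsSolutionFamily.iteratedDeriv_theta {n : ℕ} (hn : 1 ≤ n) :
    iteratedDeriv n (fun t => (x t).theta) 0 = 0 := by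
  rw [Filter.EventuallyEq.iteratedDeriv_eq (g := fun _ => Real.pi / 2) n hx.eventually_theta,
    iteratedDeriv_const, if_neg (by omega)]

theorem IsSolutionFamily.iteratedDeriv_tilde_one (n : ℕ) :
    iteratedDeriv n (fun t => (x t).tilde 1) 0 =
      (-1 : ℝ) ^ n • iteratedDeriv n (fun t => (x t).tilde 2) 0 := by
  have h : (fun t => (x t).tilde 1) =ᶠ[𝓝 0] fun t => (x (-t)).tilde 2 := by
    filter_upwards [hx.eventually_swapBC] with t ht
    exact congrArg (fun y : Param ρ => y.tilde 1) ht
  rw [h.iteratedDeriv_eq]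
  have := iteratedDeriv_comp_neg n (fun t => (x t).tilde 2) 0
  simpa using this

end Family

end Symmetry

/-! ### Iterated derivatives -/

theorem iteratedDeriv_clm_comp {E F : Type*} [NormedAddCommGroup E] [NormedSpace ℝ E]
    [NormedAddCommGroup F] [NormedSpace ℝ F] (T : E →L[ℝ] F) {f : ℝ → E} {t : ℝ}
    (hf : ContDiffAt ℝ ∞ f t) (n : ℕ) :
    iteratedDeriv n (fun t => T (f t)) t = T (iteratedDeriv n f t) := by
  have := T.iteratedFDeriv_comp_left hf (i := n) (by exact_mod_cast le_top)
  rw [iteratedDeriv_eq_iteratedFDeriv, iteratedDeriv_eq_iteratedFDeriv]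
  exact congrArg (fun m => m fun _ => (1 : ℝ)) this

/-- In Leibniz' rule at `0` only the `l`-th derivative of `t ^ l` survives. For `m < l` the
subtraction `m - l` is truncated, but `descFactorial` vanishes there. -/
theorem iteratedDeriv_pow_mul {f : ℝ → ℂ} (hf : ContDiffAt ℝ ∞ f 0) (l m : ℕ) :
    iteratedDeriv m (fun t : ℝ => (t : ℂ) ^ l * f t) 0 =
      m.descFactorial l * iteratedDeriv (m - l) f 0 := by
  have hn : (m : WithTop ℕ∞) ≤ ∞ := by exact_mod_cast le_top
  have hpow : ContDiff ℝ ∞ fun t : ℝ => (t : ℂ) ^ l := by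
    have := Complex.ofRealCLM.contDiff (n := ∞)
    exact this.pow l
  have h1 : ∀ k, iteratedDeriv k (fun t : ℝ => (t : ℂ) ^ l) 0 =
      if k = l then (l.factorial : ℂ) else 0 := by
    intro k
    have := iteratedDeriv_clm_comp Complex.ofRealCLM (f := fun t : ℝ => t ^ l) (t := 0)
      (contDiff_id.pow l).contDiffAt k
    rw [iteratedDeriv_fun_pow_zero] at this
    simp only [Complex.ofRealCLM_apply, Complex.ofReal_pow] at this
    rw [this]
    split_ifs <;> simp
  rw [iteratedDeriv_fun_mul (hpow.contDiffAt.of_le hn) (hf.of_le hn)]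
  simp only [h1]
  rcases lt_or_ge m l with h | h
  · rw [Nat.descFactorial_eq_zero_iff_lt.2 h, Nat.cast_zero, zero_mul]
    refine Finset.sum_eq_zero fun k hk => ?_
    rw [if_neg (by have := Finset.mem_range.1 hk; omega)]
    simp
  · rw [Finset.sum_eq_single l]
    · rw [if_pos rfl, Nat.descFactorial_eq_factorial_mul_choose]
      push_cast
      ring
    · intro k _ hk
      simp [hk]
    · intro hk
      exact absurd (Finset.mem_range.2 (by omega)) hk

/-! ### Iterated integrals -/

theorem continuous_omega (i : Fin 3) : Continuous fun u : ℝ => omega (Real.pi / 4) i u := by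
  have h : (fun u : ℝ => omega (Real.pi / 4) i u) = fun u : ℝ => ![4 * Complex.I * (u : ℂ),
      2 * (√2 : ℝ) * ((u : ℂ) ^ 2 - 1), 2 * (√2 : ℝ) * Complex.I * ((u : ℂ) ^ 2 + 1)] i /
      ((u : ℂ) ^ 4 + 1) :=
    funext fun u => omega_eq (ofReal_pow_four_add_one_ne_zero u) i
  rw [h]
  refine Continuous.div ?_ (by fun_prop) ofReal_pow_four_add_one_ne_zero
  fin_cases i <;> simp <;> fun_prop

theorem continuous_iteratedIntegral :
    ∀ w : List (Fin 3), Continuous (iteratedIntegral (Real.pi / 4) w)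
  | [] => continuous_const
  | i :: w => intervalIntegral.continuous_primitive (fun a b =>
      ((continuous_iteratedIntegral w).mul (continuous_omega i)).intervalIntegrable a b) 0

theorem frakMWord_snoc {l : ℕ} (I : Fin l → Fin 3) (m : Fin 3) :
    frakMWord (Fin.snoc I m : Fin (l + 1) → Fin 3) = frakMWord I * frakM m := by
  rw [frakMWord, List.ofFn_succ', List.concat_eq_append, List.prod_append]
  simp [frakMWord]

theorem ofFn_snoc {l : ℕ} (I : Fin l → Fin 3) (m : Fin 3) :
    List.ofFn (Fin.snoc I m : Fin (l + 1) → Fin 3) = List.ofFn I ++ [m] := by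
  rw [List.ofFn_succ', List.concat_eq_append]
  simp

theorem sum_snoc {M : Type*} [AddCommMonoid M] {l : ℕ} (f : (Fin (l + 1) → Fin 3) → M) :
    ∑ I, f I = ∑ m : Fin 3, ∑ I : Fin l → Fin 3, f (Fin.snoc I m) := by
  rw [← (Fin.snocEquiv fun _ : Fin (l + 1) => Fin 3).sum_comp, Fintype.sum_prod_type]
  rfl

/-- The product of the values of `y` along a word. -/
def wordProd (y : Fin 3 → ℂ) (w : List (Fin 3)) : ℂ := (w.map y).prod

section Expansion

variable {ρ : ℝ} [hρ : Fact (1 < ρ)] {lam : ℂ} (hl : lam ∈ annulus ρ)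

/-- In `Ψ' = Ψ A` the potential acts from the right, so each application of `volterra` appends a
last letter to the word: one more integration against `ω` and one more right factor `𝔪`. Hence the
induction by `Fin.snoc` and the reversed lists. -/
theorem evalV_volterra_pow (w : Fin 3 → L1 ℤ) : ∀ (l : ℕ) (s : unitInterval) (i j : Fin 2),
    evalV hl ((Path.entry i j ((volterra ρ w ^ l) onePath)).at s) = ∑ I : Fin l → Fin 3,
      wordProd (fun m => evalV hl (w m)) (List.ofFn I) *
        (iteratedIntegral (Real.pi / 4) (List.ofFn I).reverse s * frakMWord I i j)
  | 0, s, i, j => by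
    simp [evalV_onePath, wordProd, iteratedIntegral, frakMWord]
  | l + 1, s, i, j => by
    rw [pow_succ', mul_apply_eq_comp, entry_volterra]
    simp only [map_sum, map_smul, evalV_volterraScalar, Complex.real_smul]
    have hint : ∀ (k : Fin 2) (m : Fin 3), (mu m k j : ℂ) * ∫ u in (0 : ℝ)..s, alpha m u *
        (evalV hl (w m) * evalV hl ((Path.entry i k ((volterra ρ w ^ l) onePath)).ext u)) =
        ∑ I : Fin l → Fin 3, wordProd (fun m => evalV hl (w m)) (List.ofFn I) * evalV hl (w m) *
          (frakMWord I i k * frakM m k j) *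
          iteratedIntegral (Real.pi / 4) (m :: (List.ofFn I).reverse) s := by
      intro k m
      have e : ∀ u ∈ Set.uIcc (0 : ℝ) s, (mu m k j : ℂ) * (alpha m u * (evalV hl (w m) *
          evalV hl ((Path.entry i k ((volterra ρ w ^ l) onePath)).ext u))) =
          ∑ I : Fin l → Fin 3, wordProd (fun m => evalV hl (w m)) (List.ofFn I) *
            evalV hl (w m) * (frakMWord I i k * frakM m k j) *
            (iteratedIntegral (Real.pi / 4) (List.ofFn I).reverse u *
              omega (Real.pi / 4) m u) := by
        intro u hu
        rw [Set.uIcc_of_le s.2.1] at hu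
        rw [LoopPath.ext_of_mem _ ⟨hu.1, hu.2.trans s.2.2⟩, evalV_volterra_pow w l,
          Finset.mul_sum, Finset.mul_sum, Finset.mul_sum]
        refine Finset.sum_congr rfl fun I _ => ?_
        linear_combination (-(wordProd (fun m => evalV hl (w m)) (List.ofFn I) *
            evalV hl (w m) * frakMWord I i k *
            iteratedIntegral (Real.pi / 4) (List.ofFn I).reverse u)) * omega_smul_frakM m u k j
      rw [← intervalIntegral.integral_const_mul, intervalIntegral.integral_congr e,
        intervalIntegral.integral_finsetSum]
      · refine Finset.sum_congr rfl fun I _ => ?_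
        rw [intervalIntegral.integral_const_mul]
        rfl
      · intro I _
        exact (((continuous_iteratedIntegral _).mul (continuous_omega m)).const_mul
          _).intervalIntegrable _ _
    simp only [hint]
    rw [Finset.sum_comm, sum_snoc]
    refine Finset.sum_congr rfl fun m _ => ?_
    rw [Finset.sum_comm]
    refine Finset.sum_congr rfl fun I _ => ?_
    rw [frakMWord_snoc, ofFn_snoc, Matrix.mul_apply, List.reverse_append, wordProd, wordProd,
      List.map_append, List.prod_append]
    simp only [List.map_cons, List.map_nil, List.prod_cons, List.prod_nil, mul_one,
      List.reverse_cons, List.reverse_nil, List.nil_append, List.singleton_append]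
    rw [Finset.mul_sum, Finset.mul_sum]
    refine Finset.sum_congr rfl fun k _ => ?_
    ring

/-- A finite Neumann sum with exact remainder, so derivatives can be taken without differentiating
an infinite series. -/
theorem fundSol_expansion {w : Fin 3 → L1 ℤ} (hw : w ∈ small ρ) (N : ℕ) :
    fundSol ρ w = ∑ l ∈ Finset.range N, (volterra ρ w ^ l) onePath +
      (volterra ρ w ^ N) (fundSol ρ w) := by
  induction N with
  | zero => simp
  | succ N ih =>
    conv_lhs => rw [ih, fundSol_eq hw]
    rw [map_add, Finset.sum_range_succ, pow_succ, mul_apply_eq_comp, add_assoc]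

theorem wordProd_smul (y : Fin 3 → ℂ) (t : ℂ) (w : List (Fin 3)) :
    wordProd (fun m => t * y m) w = t ^ w.length * wordProd y w := by
  induction w with
  | nil => simp [wordProd]
  | cons i w ih =>
    have h : ∀ z : Fin 3 → ℂ, wordProd z (i :: w) = z i * wordProd z w := fun z => rfl
    rw [h, h, ih, List.length_cons, pow_succ]
    ring

/-- The expansion of the monodromy along a smooth family of potentials. -/
theorem iteratedDeriv_evalV_fundSol {w : ℝ → Fin 3 → L1 ℤ} (hw : ContDiffAt ℝ ∞ w 0)
    (i j : Fin 2) (m : ℕ) :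
    iteratedDeriv m (fun t => evalV hl ((Path.entry i j (fundSol ρ (t • w t))).at 1)) 0 =
      ∑ l ∈ Finset.range (m + 1), ∑ I : Fin l → Fin 3, (m.descFactorial l *
        iteratedDeriv (m - l) (fun t => wordProd (fun k => evalV hl (w t k)) (List.ofFn I)) 0) *
        (omegaValue (Real.pi / 4) I * frakMWord I i j) := by
  have hn : (m : WithTop ℕ∞) ≤ ∞ := by exact_mod_cast le_top
  have htw : ContDiffAt ℝ ∞ (fun t : ℝ => t • w t) 0 := contDiffAt_id.smul hw
  have hsmall : ∀ᶠ t : ℝ in 𝓝 0, t • w t ∈ small ρ :=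
    htw.continuousAt.eventually (isOpen_small.mem_nhds (by simpa using zero_mem_small))
  have hfund : ContDiffAt ℝ ∞ (fun t : ℝ => fundSol ρ (t • w t)) 0 :=
    ContDiffAt.comp (g := fundSol ρ) 0 (contDiffAt_fundSol (by simpa using zero_mem_small)) htw
  -- The remainder after the words of length at most `m` is `t ^ (m + 1)` times the smooth `R`, and
  -- contributes nothing to the derivative of order `m` at `0`.
  set R : ℝ → ℂ := fun t => evalV hl ((Path.entry i j
    ((volterra ρ (w t) ^ (m + 1)) (fundSol ρ (t • w t)))).at 1) with hR
  have hRs : ContDiffAt ℝ ∞ R 0 := by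
    have h1 : ContDiffAt ℝ ∞ (fun t => volterra ρ (w t) ^ (m + 1)) 0 :=
      ((volterra ρ).contDiff.contDiffAt.comp 0 hw).pow (m + 1)
    exact ((evalV hl).comp ((LoopPath.at 1).comp (Path.entry i j))).contDiff.contDiffAt.comp 0
      (h1.clm_apply hfund)
  have hword : ∀ v : List (Fin 3), ContDiffAt ℝ ∞
      (fun t => wordProd (fun k => evalV hl (w t k)) v) 0 := by
    intro v
    induction v with
    | nil => exact contDiffAt_const
    | cons k v ih =>
      have h1 : ContDiffAt ℝ ∞ (fun t => evalV hl (w t k)) 0 :=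
        (evalV hl).contDiff.contDiffAt.comp 0 (contDiffAt_pi.1 hw k)
      exact h1.mul ih
  have hexp : (fun t => evalV hl ((Path.entry i j (fundSol ρ (t • w t))).at 1)) =ᶠ[𝓝 0]
      fun t : ℝ => (∑ l ∈ Finset.range (m + 1), ∑ I : Fin l → Fin 3, (t : ℂ) ^ l *
        wordProd (fun k => evalV hl (w t k)) (List.ofFn I) *
        (omegaValue (Real.pi / 4) I * frakMWord I i j)) + (t : ℂ) ^ (m + 1) * R t := by
    filter_upwards [hsmall] with t ht
    have h1 : evalV hl ((Path.entry i j
        ((volterra ρ (t • w t) ^ (m + 1)) (fundSol ρ (t • w t)))).at 1) =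
        (t : ℂ) ^ (m + 1) * R t := by
      rw [hR, map_smul, smul_pow, smul_apply, map_smul, map_smul, map_smul, Complex.real_smul,
        Complex.ofReal_pow]
    have h2 := fundSol_expansion ht (m + 1)
    conv_lhs => rw [h2]
    rw [map_add, map_add, map_add, h1, map_sum, map_sum, map_sum]
    congr 1
    refine Finset.sum_congr rfl fun l _ => ?_
    rw [evalV_volterra_pow]
    refine Finset.sum_congr rfl fun I _ => ?_
    have h3 : (fun k => evalV hl ((t • w t) k)) = fun k => (t : ℂ) * evalV hl (w t k) :=
      funext fun k => by rw [Pi.smul_apply, map_smul, Complex.real_smul]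
    rw [h3, wordProd_smul, List.length_ofFn]
    rfl
  have hpow : ∀ l : ℕ, ContDiffAt ℝ ∞ (fun t : ℝ => (t : ℂ) ^ l) 0 := fun l =>
    (Complex.ofRealCLM.contDiff.pow l).contDiffAt
  have hterm : ∀ (l : ℕ) (I : Fin l → Fin 3), ContDiffAt ℝ ∞ (fun t : ℝ => (t : ℂ) ^ l *
        wordProd (fun k => evalV hl (w t k)) (List.ofFn I) *
        (omegaValue (Real.pi / 4) I * frakMWord I i j)) 0 := fun l I =>
    ((hpow l).mul (hword _)).mul contDiffAt_const
  rw [hexp.iteratedDeriv_eq, iteratedDeriv_fun_add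
    (ContDiffAt.of_le (ContDiffAt.sum fun l _ => ContDiffAt.sum fun I _ => hterm l I) hn)
    (((hpow _).mul hRs).of_le hn), iteratedDeriv_pow_mul hRs,
    Nat.descFactorial_eq_zero_iff_lt.2 (Nat.lt_succ_self m), Nat.cast_zero, zero_mul, add_zero,
    iteratedDeriv_fun_sum fun l _ =>
      ContDiffAt.of_le (ContDiffAt.sum fun I _ => hterm l I) hn]
  refine Finset.sum_congr rfl fun l _ => ?_
  rw [iteratedDeriv_fun_sum fun I _ => (hterm l I).of_le hn]
  refine Finset.sum_congr rfl fun I _ => ?_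
  rw [iteratedDeriv_mul_const_field, iteratedDeriv_pow_mul (hword _)]

end Expansion

/-! ### Degrees of Laurent polynomials -/

namespace LaurentDegreeLE

variable {d e : ℕ} {f g : ℂ[T;T⁻¹]}

theorem mono (hf : LaurentDegreeLE d f) (h : d ≤ e) : LaurentDegreeLE e f :=
  fun k hk => hf k (lt_of_le_of_lt (by exact_mod_cast h) hk)

theorem zero : LaurentDegreeLE d 0 := fun k _ => by simp

theorem add (hf : LaurentDegreeLE d f) (hg : LaurentDegreeLE d g) : LaurentDegreeLE d (f + g) :=
  fun k hk => by simp [hf k hk, hg k hk]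

theorem smul (c : ℂ) (hf : LaurentDegreeLE d f) : LaurentDegreeLE d (c • f) :=
  fun k hk => by simp [hf k hk]

theorem sub (hf : LaurentDegreeLE d f) (hg : LaurentDegreeLE d g) : LaurentDegreeLE d (f - g) :=
  fun k hk => by simp [hf k hk, hg k hk]

theorem sum {ι : Type*} {s : Finset ι} {f : ι → ℂ[T;T⁻¹]}
    (h : ∀ i ∈ s, LaurentDegreeLE d (f i)) : LaurentDegreeLE d (∑ i ∈ s, f i) :=
  Finset.sum_induction _ _ (fun _ _ => add) zero h

theorem of_support (h : ∀ k ∈ f.coeff.support, |k| ≤ d) : LaurentDegreeLE d f := fun k hk => by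
  by_contra hne
  exact absurd (h k (Finsupp.mem_support_iff.2 hne)) (not_le.2 hk)

theorem le_of_mem_support (hf : LaurentDegreeLE d f) {k : ℤ} (hk : k ∈ f.coeff.support) :
    |k| ≤ d := by
  by_contra hlt
  exact Finsupp.mem_support_iff.1 hk (hf k (not_le.1 hlt))

theorem mul (hf : LaurentDegreeLE d f) (hg : LaurentDegreeLE e g) :
    LaurentDegreeLE (d + e) (f * g) := by
  classical
  refine of_support fun k hk => ?_
  obtain ⟨a, ha, b, hb, rfl⟩ := Finset.mem_add.1 (AddMonoidAlgebra.support_coeff_mul_subset f g hk)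
  push_cast
  exact (abs_add_le a b).trans (add_le_add (hf.le_of_mem_support ha) (hg.le_of_mem_support hb))

theorem C_mul_T (c : ℂ) {n : ℤ} (h : |n| ≤ d) :
    LaurentDegreeLE d (LaurentPolynomial.C c * LaurentPolynomial.T n) := fun k hk => by
  rw [← LaurentPolynomial.single_eq_C_mul_T, AddMonoidAlgebra.coeff_single,
    Finsupp.single_eq_of_ne]
  rintro rfl
  exact absurd h (not_le.2 hk)

theorem one : LaurentDegreeLE d 1 := by
  have := C_mul_T (d := d) 1 (n := 0) (by simp)
  simpa using this

theorem central (φ : ℝ) (i : Fin 3) : LaurentDegreeLE 1 (central φ i) := by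
  fin_cases i <;> simp only [DPW.central, Fin.zero_eta, Fin.mk_one, Fin.reduceFinMk,
    Matrix.cons_val, mul_sub, mul_add]
  · exact (C_mul_T _ (by simp)).sub (C_mul_T _ (by simp))
  · exact (C_mul_T _ (by simp)).add (C_mul_T _ (by simp))
  · exact (C_mul_T _ (by simp)).add (C_mul_T _ (by simp))

end LaurentDegreeLE

theorem coeff_toLaurent_natCast (p : ℂ[X]) (k : ℕ) :
    (Polynomial.toLaurent p).coeff (k : ℤ) = p.coeff k := by
  induction p using Polynomial.induction_on' with
  | add p q hp hq =>
    rw [map_add, AddMonoidAlgebra.coeff_add, Finsupp.add_apply, hp, hq]; simp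
  | monomial n a =>
    rw [Polynomial.toLaurent_C_mul_T, ← LaurentPolynomial.single_eq_C_mul_T,
      AddMonoidAlgebra.coeff_single, Polynomial.coeff_monomial, Finsupp.single_apply]
    norm_cast

theorem coeff_toLaurent_of_neg (p : ℂ[X]) {k : ℤ} (hk : k < 0) :
    (Polynomial.toLaurent p).coeff k = 0 := by
  induction p using Polynomial.induction_on' with
  | add p q hp hq =>
    rw [map_add, AddMonoidAlgebra.coeff_add, Finsupp.add_apply, hp, hq]; simp
  | monomial n a =>
    rw [Polynomial.toLaurent_C_mul_T, ← LaurentPolynomial.single_eq_C_mul_T,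
      AddMonoidAlgebra.coeff_single, Finsupp.single_apply, if_neg (by omega)]

theorem LaurentDegreeLE.toLaurent {p : ℂ[X]} {d : ℕ} (h : p.natDegree ≤ d) :
    LaurentDegreeLE d (Polynomial.toLaurent p) := fun k hk => by
  rcases lt_or_ge k 0 with h0 | h0
  · exact coeff_toLaurent_of_neg p h0
  · lift k to ℕ using h0
    rw [coeff_toLaurent_natCast]
    refine Polynomial.coeff_eq_zero_of_natDegree_lt ?_
    rw [Nat.abs_cast] at hk
    exact lt_of_le_of_lt h (by exact_mod_cast hk)

theorem evalLaurent_toLaurent {lam : ℂ} (h : lam ≠ 0) (p : ℂ[X]) :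
    evalLaurent (Polynomial.toLaurent p) lam = p.eval lam := by
  induction p using Polynomial.induction_on' with
  | add p q hp hq => rw [map_add, evalLaurent_add h, hp, hq, Polynomial.eval_add]
  | monomial n a =>
    rw [Polynomial.toLaurent_C_mul_T, evalLaurent_mul h, evalLaurent_C h, evalLaurent_T h,
      Polynomial.eval_monomial, zpow_natCast]

/-! ### Degrees in the recursion -/

section Degree

variable {X : ℕ → Fin 3 → ℂ[T;T⁻¹]} {R : ℕ → ℝ} (hX : ∀ n i, LaurentDegreeLE (n + 1) (X n i))

include hX

theorem degree_yDeriv (k : ℕ) (i : Fin 3) : LaurentDegreeLE (k + 1) (yDeriv X R k i) :=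
  .sum fun l hl => ((hX l i).mono (by have := Finset.mem_range.1 hl; omega)).smul _

theorem degree_yWordDeriv : ∀ (w : List (Fin 3)) (k : ℕ),
    LaurentDegreeLE (k + w.length) (yWordDeriv X R w k)
  | [], k => by
    rw [yWordDeriv]
    split_ifs
    · exact .one
    · exact .zero
  | i :: w, k => by
    rw [yWordDeriv, List.length_cons]
    refine .sum fun j hj => (((degree_yDeriv hX j i).mul (degree_yWordDeriv w (k - j))).mono ?_).smul _
    have := Finset.mem_range.1 hj
    omega

/-- Each letter and each derivative raise the degree by at most one. A word of length `l` is
differentiated `n + 1 - l` times, so the bound is the same for all lengths. -/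
theorem degree_calPLower (φ : ℝ) (n : ℕ) (i j : Fin 2) :
    LaurentDegreeLE (n + 1) (calPLower φ X R n i j) := by
  rw [calPLower, Matrix.add_apply]
  simp only [Matrix.sum_apply, scaledMatrix, Matrix.of_apply]
  refine .add (.sum fun m _ => .sum fun l hl => .smul _ (.smul _ ((hX l m).mono ?_)))
    (.sum fun l hl => .sum fun I _ => .smul _ (.smul _ ((degree_yWordDeriv hX _ _).mono ?_)))
  · have := Finset.mem_Icc.1 hl
    omega
  · have := Finset.mem_Icc.1 hl
    rw [List.length_ofFn]
    omega

theorem degree_frakPLower (φ : ℝ) {P : ℕ → Matrix (Fin 2) (Fin 2) ℂ[T;T⁻¹]}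
    (hP : ∀ n i j, LaurentDegreeLE n (P n i j)) (n : ℕ) :
    LaurentDegreeLE (n + 1) (frakPLower φ X R P n) := by
  refine .add (.sub (degree_calPLower hX φ n 1 0) (degree_calPLower hX φ n 0 1))
    (.sum fun k hk => .smul _ ?_)
  have hk' := Finset.mem_Icc.1 hk
  exact .sub (((hP k 0 0).mul (hP (n + 1 - k) 1 0)).mono (by omega))
    (((hP k 0 1).mul (hP (n + 1 - k) 1 1)).mono (by omega))

theorem degree_calKLower {n : ℕ} : LaurentDegreeLE (n + 2) (calKLower X R n) := by
  have hlor : ∀ {u v : Fin 3 → ℂ[T;T⁻¹]} {d e : ℕ}, (∀ i, LaurentDegreeLE d (u i)) →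
      (∀ i, LaurentDegreeLE e (v i)) → LaurentDegreeLE (d + e) (lorentz u v) := fun hu hv =>
    .sub (.sub ((hu 0).mul (hv 0)) ((hu 1).mul (hv 1))) ((hu 2).mul (hv 2))
  have h0 : ∀ i, LaurentDegreeLE (0 + 1 + (n + 1)) (X 0 i * X n i) := fun i =>
    (hX 0 i).mul (hX n i)
  refine .add (.add (.add (.smul _ ((h0 1).mono (by omega))) (.smul _ ((h0 2).mono (by omega))))
    (.smul _ (.sum fun k hk => .smul _ ?_))) (.sum fun k hk => .smul _ ?_)
  · have := Finset.mem_Icc.1 hk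
    exact (hlor (hX 0) (hX (n - k))).mono (by omega)
  · have := Finset.mem_Icc.1 hk
    exact (hlor (degree_yDeriv hX k) (degree_yDeriv hX (n - k))).mono (by omega)

end Degree

/-- The Taylor coefficients of the monodromy, as determined by those of the parameters. -/
def monodromyJet (φ : ℝ) (p : Fin 3 → ℕ → ℝ[X]) (R : ℕ → ℝ) :
    ℕ → Matrix (Fin 2) (Fin 2) ℂ[T;T⁻¹]
  | 0 => 1
  | 1 => ∑ i : Fin 3, scaledMatrix (central φ i) (omegaValue φ ![i] • frakM i)
  | n + 2 => (∑ i : Fin 3, scaledMatrix (((n + 1 + 1 : ℕ) : ℂ) • (coeffJet φ p (n + 1) i +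
      (R (n + 1) : ℂ) • central φ i)) (omegaValue φ ![i] • frakM i)) +
      calPLower φ (coeffJet φ p) R (n + 1)

section JetDegree

variable {p : Fin 3 → ℕ → ℝ[X]} (hp : ∀ i n, (p i n).natDegree ≤ n + 1)

include hp

theorem degree_coeffJet (φ : ℝ) :
    ∀ (n : ℕ) (i : Fin 3), LaurentDegreeLE (n + 1) (coeffJet φ p n i)
  | 0, i => .central φ i
  | n + 1, i => .toLaurent (Polynomial.natDegree_map_le.trans (hp i (n + 1)))

theorem degree_monodromyJet (φ : ℝ) (R : ℕ → ℝ) :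
    ∀ (n : ℕ) (i j : Fin 2), LaurentDegreeLE n (monodromyJet φ p R n i j)
  | 0, i, j => by
    rw [monodromyJet, Matrix.one_apply]
    split_ifs
    · exact .one
    · exact .zero
  | 1, i, j => by
    rw [monodromyJet]
    simp only [Matrix.sum_apply, scaledMatrix, Matrix.of_apply]
    exact .sum fun m _ => .smul _ (.central φ m)
  | n + 2, i, j => by
    rw [monodromyJet, Matrix.add_apply]
    refine .add ?_ (degree_calPLower (degree_coeffJet hp φ) φ (n + 1) i j)
    simp only [Matrix.sum_apply, scaledMatrix, Matrix.of_apply]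
    exact .sum fun m _ => .smul _ (.smul _ (.add (degree_coeffJet hp φ (n + 1) m)
      (.smul _ ((LaurentDegreeLE.central φ m).mono (by omega)))))

end JetDegree

/-- In a Leibniz sum the two ends carry the terms of top order; `1 ≤ n` makes them distinct. -/
theorem sum_range_succ_eq_ends {M : Type*} [AddCommMonoid M] {n : ℕ} (hn : 1 ≤ n) (f : ℕ → M) :
    ∑ k ∈ Finset.range (n + 1), f k = f 0 + f n + ∑ k ∈ Finset.Icc 1 (n - 1), f k := by
  obtain ⟨m, rfl⟩ := Nat.exists_eq_add_of_le' hn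
  have h : Finset.Icc 1 (m + 1 - 1) = Finset.Ico 1 (m + 1) := by
    ext k; simp only [Finset.mem_Icc, Finset.mem_Ico]; omega
  rw [h, Finset.sum_range_succ, Finset.range_eq_Ico,
    ← Finset.sum_Ico_consecutive f (Nat.zero_le 1) (by omega : 1 ≤ m + 1)]
  simp
  abel

theorem omegaValue_single_mul_frakM (m : Fin 3) (i j : Fin 2) :
    omegaValue (Real.pi / 4) ![m] * frakM m i j =
      ((∫ s in (0 : ℝ)..1, alpha m s : ℝ) : ℂ) * (mu m i j : ℂ) := by
  have h : omegaValue (Real.pi / 4) ![m] = ∫ u in (0 : ℝ)..1, omega (Real.pi / 4) m u := by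
    simp [omegaValue, iteratedIntegral]
  rw [h, ← intervalIntegral.integral_mul_const, ← intervalIntegral.integral_ofReal,
    ← intervalIntegral.integral_mul_const]
  exact intervalIntegral.integral_congr fun u _ => omega_smul_frakM m u i j

/-! ### The recursion formulas at a fixed value of `λ`. -/

section Pointwise

variable {r : ℝ → ℝ} {z : Fin 3 → ℝ → ℂ} {X : ℕ → Fin 3 → ℂ[T;T⁻¹]} {lam : ℂ} {N : ℕ}

theorem natCast_le_infty (m : ℕ) : (m : WithTop ℕ∞) ≤ ∞ := by exact_mod_cast le_top

theorem contDiffAt_ofReal_comp {r : ℝ → ℝ} (hr : ContDiffAt ℝ ∞ r 0) :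
    ContDiffAt ℝ ∞ (fun t => (r t : ℂ)) 0 :=
  Complex.ofRealCLM.contDiff.contDiffAt.comp 0 hr

theorem iteratedDeriv_ofReal_mul (hr : ContDiffAt ℝ ∞ r 0) {f : ℝ → ℂ}
    (hf : ContDiffAt ℝ ∞ f 0) (k : ℕ) :
    iteratedDeriv k (fun t => (r t : ℂ) * f t) 0 = ∑ l ∈ Finset.range (k + 1),
      ((k.choose l * iteratedDeriv (k - l) r 0 : ℝ) : ℂ) * iteratedDeriv l f 0 := by
  have h : (fun t => (r t : ℂ) * f t) = fun t => f t * (r t : ℂ) := funext fun t => mul_comm _ _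
  rw [h, iteratedDeriv_fun_mul (hf.of_le (natCast_le_infty k))
    ((contDiffAt_ofReal_comp hr).of_le (natCast_le_infty k))]
  refine Finset.sum_congr rfl fun l _ => ?_
  have := iteratedDeriv_clm_comp Complex.ofRealCLM hr (k - l)
  simp only [Complex.ofRealCLM_apply] at this
  rw [this]
  push_cast
  ring

variable (hr : ContDiffAt ℝ ∞ r 0) (hz : ∀ i, ContDiffAt ℝ ∞ (z i) 0) (h0 : lam ≠ 0)
  (hX : ∀ m < N, ∀ i, evalLaurent (X m i) lam = iteratedDeriv m (z i) 0)

include hr hz h0 hX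

theorem evalLaurent_yDeriv {k : ℕ} (hk : k < N) (i : Fin 3) :
    evalLaurent (yDeriv X (fun k => iteratedDeriv k r 0) k i) lam =
      iteratedDeriv k (fun t => (r t : ℂ) * z i t) 0 := by
  rw [iteratedDeriv_ofReal_mul hr (hz i), yDeriv, evalLaurent_sum h0]
  refine Finset.sum_congr rfl fun l hl => ?_
  rw [evalLaurent_smul h0, hX l (by have := Finset.mem_range.1 hl; omega)]

theorem evalLaurent_yWordDeriv : ∀ (w : List (Fin 3)) {k : ℕ}, k < N →
    evalLaurent (yWordDeriv X (fun k => iteratedDeriv k r 0) w k) lam =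
      iteratedDeriv k (fun t => wordProd (fun m => (r t : ℂ) * z m t) w) 0
  | [], k, _ => by
    have : (fun t => wordProd (fun m => (r t : ℂ) * z m t) []) = fun _ => 1 := rfl
    rw [this, yWordDeriv, iteratedDeriv_const]
    split_ifs
    · exact evalLaurent_one h0
    · exact evalLaurent_zero h0
  | i :: w, k, hk => by
    have hw : ∀ v : List (Fin 3), ContDiffAt ℝ ∞
        (fun t => wordProd (fun m => (r t : ℂ) * z m t) v) 0 := by
      intro v
      induction v with
      | nil => exact contDiffAt_const
      | cons m v ih => exact ((contDiffAt_ofReal_comp hr).mul (hz m)).mul ih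
    have h1 : (fun t => wordProd (fun m => (r t : ℂ) * z m t) (i :: w)) =
        fun t => ((r t : ℂ) * z i t) * wordProd (fun m => (r t : ℂ) * z m t) w := rfl
    rw [h1, iteratedDeriv_fun_mul
      (((contDiffAt_ofReal_comp hr).mul (hz i)).of_le (natCast_le_infty k))
      ((hw w).of_le (natCast_le_infty k)), yWordDeriv, evalLaurent_sum h0]
    refine Finset.sum_congr rfl fun j hj => ?_
    have hj' := Finset.mem_range.1 hj
    rw [evalLaurent_smul h0, evalLaurent_mul h0,
      evalLaurent_yDeriv hr hz h0 hX (by omega) i, evalLaurent_yWordDeriv w (by omega), mul_assoc]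

omit h0 hX in
theorem iteratedDeriv_ofReal_mul_eq_ends (hr1 : r 0 = 1) {n : ℕ} (hn : 1 ≤ n) (i : Fin 3) :
    iteratedDeriv n (fun t => (r t : ℂ) * z i t) 0 =
      iteratedDeriv n (z i) 0 + (iteratedDeriv n r 0 : ℝ) * z i 0 +
      ∑ l ∈ Finset.Icc 1 (n - 1), ((n.choose l * iteratedDeriv (n - l) r 0 : ℝ) : ℂ) *
        iteratedDeriv l (z i) 0 := by
  rw [iteratedDeriv_ofReal_mul hr (hz i), sum_range_succ_eq_ends hn]
  simp [iteratedDeriv_zero, hr1, add_comm]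

/-- The derivatives of one entry of the monodromy. -/
theorem iteratedDeriv_entry_eq (hr1 : r 0 = 1) (hN : 1 ≤ N) {i j : Fin 2} {f : ℝ → ℂ}
    (hf : iteratedDeriv (N + 1) f 0 =
      ∑ l ∈ Finset.range (N + 1 + 1), ∑ I : Fin l → Fin 3, ((N + 1).descFactorial l *
        iteratedDeriv (N + 1 - l)
          (fun t => wordProd (fun k => (r t : ℂ) * z k t) (List.ofFn I)) 0) *
        (omegaValue (Real.pi / 4) I * frakMWord I i j)) :
    iteratedDeriv (N + 1) f 0 = (∑ m : Fin 3, ((N + 1 : ℕ) : ℂ) *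
      (iteratedDeriv N (z m) 0 + (iteratedDeriv N r 0 : ℝ) * z m 0) *
        (omegaValue (Real.pi / 4) ![m] * frakM m i j)) +
      evalLaurent (calPLower (Real.pi / 4) X (fun k => iteratedDeriv k r 0) N i j) lam := by
  have hIcc : Finset.Icc 2 (N + 1) = Finset.Ico 2 (N + 1 + 1) := by
    ext k; simp only [Finset.mem_Icc, Finset.mem_Ico]; omega
  -- The sum is split by word length: the empty word is constant and drops out, single letters
  -- contain the unknowns of order `N`, and longer words involve only orders below `N`.
  have hzero : ∑ I : Fin 0 → Fin 3, (((N + 1).descFactorial 0 : ℂ) *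
        iteratedDeriv (N + 1 - 0)
          (fun t => wordProd (fun k => (r t : ℂ) * z k t) (List.ofFn I)) 0) *
        (omegaValue (Real.pi / 4) I * frakMWord I i j) = 0 := by
    refine Finset.sum_eq_zero fun I _ => ?_
    have h : (fun t => wordProd (fun k => (r t : ℂ) * z k t) (List.ofFn I)) = fun _ => 1 := by
      funext t; simp [wordProd]
    rw [h, iteratedDeriv_const, if_neg (by omega), mul_zero, zero_mul]
  have hone : ∑ I : Fin 1 → Fin 3, (((N + 1).descFactorial 1 : ℂ) *
        iteratedDeriv (N + 1 - 1)
          (fun t => wordProd (fun k => (r t : ℂ) * z k t) (List.ofFn I)) 0) *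
        (omegaValue (Real.pi / 4) I * frakMWord I i j) = ∑ m : Fin 3, ((N + 1 : ℕ) : ℂ) *
      iteratedDeriv N (fun t => (r t : ℂ) * z m t) 0 *
        (omegaValue (Real.pi / 4) ![m] * frakM m i j) := by
    rw [← (Equiv.funUnique (Fin 1) (Fin 3)).symm.sum_comp]
    refine Finset.sum_congr rfl fun m _ => ?_
    have hm : (Equiv.funUnique (Fin 1) (Fin 3)).symm m = ![m] := by
      funext a; simp
    rw [hm, Nat.descFactorial_one, Nat.add_sub_cancel]
    simp [wordProd, frakMWord]
  rw [hf, Finset.range_eq_Ico, ← Finset.sum_Ico_consecutive _ (Nat.zero_le 2) (by omega),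
    ← Finset.range_eq_Ico, Finset.sum_range_succ, Finset.sum_range_one, hone, ← hIcc,
    hzero, zero_add,
    calPLower, Matrix.add_apply, evalLaurent_add h0, ← add_assoc]
  congr 1
  · simp only [Matrix.sum_apply, scaledMatrix, Matrix.of_apply, evalLaurent_sum h0,
      evalLaurent_smul h0, ← Finset.sum_add_distrib]
    refine Finset.sum_congr rfl fun m _ => ?_
    rw [iteratedDeriv_ofReal_mul_eq_ends hr hz hr1 hN, mul_add, add_mul, Finset.mul_sum,
      Finset.sum_mul]
    congr 1
    refine Finset.sum_congr rfl fun l hl => ?_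
    have hl' := Finset.mem_Icc.1 hl
    rw [hX l (by omega), Matrix.smul_apply]
    push_cast
    simp only [smul_eq_mul]
    ring
  · simp only [Matrix.sum_apply, scaledMatrix, Matrix.of_apply, evalLaurent_sum h0,
      evalLaurent_smul h0]
    refine Finset.sum_congr rfl fun l hl => Finset.sum_congr rfl fun I _ => ?_
    have hl' := Finset.mem_Icc.1 hl
    rw [evalLaurent_yWordDeriv hr hz h0 hX _ (by omega), Matrix.smul_apply, smul_eq_mul]
    ring

omit hr hz hX in
/-- The derivatives of the function `𝔭`. -/
theorem iteratedDeriv_frakP_eq {P : ℕ → Matrix (Fin 2) (Fin 2) ℂ[T;T⁻¹]}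
    {f : Fin 2 → Fin 2 → ℝ → ℂ} (hfs : ∀ i j, ContDiffAt ℝ ∞ (f i j) 0)
    (hf0 : ∀ i j, f i j 0 = (1 : Matrix (Fin 2) (Fin 2) ℂ) i j)
    (hfN : ∀ i j, iteratedDeriv (N + 1) (f i j) 0 = (∑ m : Fin 3, ((N + 1 : ℕ) : ℂ) *
      (iteratedDeriv N (z m) 0 + (iteratedDeriv N r 0 : ℝ) * z m 0) *
        (omegaValue (Real.pi / 4) ![m] * frakM m i j)) +
      evalLaurent (calPLower (Real.pi / 4) X (fun k => iteratedDeriv k r 0) N i j) lam)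
    (hP : ∀ k ≤ N, ∀ i j, evalLaurent (P k i j) lam = iteratedDeriv k (f i j) 0) :
    iteratedDeriv (N + 1) (fun t => f 0 0 t * f 1 0 t - f 0 1 t * f 1 1 t) 0 =
      2 * Real.pi * (N + 1) * (iteratedDeriv N (z 2) 0 + (iteratedDeriv N r 0 : ℝ) * z 2 0) +
      evalLaurent (frakPLower (Real.pi / 4) X (fun k => iteratedDeriv k r 0) P N) lam := by
  have hle := natCast_le_infty (N + 1)
  have hc : ∀ i j, ContDiffAt ℝ ((N + 1 : ℕ) : WithTop ℕ∞) (f i j) 0 := fun i j =>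
    (hfs i j).of_le hle
  rw [iteratedDeriv_fun_sub ((hc 0 0).mul (hc 1 0)) ((hc 0 1).mul (hc 1 1)),
    iteratedDeriv_fun_mul (hc 0 0) (hc 1 0), iteratedDeriv_fun_mul (hc 0 1) (hc 1 1),
    ← Finset.sum_sub_distrib, sum_range_succ_eq_ends (by omega)]
  -- The matrix is the identity at `t = 0`, so the two ends of the sum reduce to the difference of
  -- the off-diagonal entries of order `N + 1`.
  simp only [Nat.choose_zero_right, Nat.choose_self, Nat.sub_zero, Nat.sub_self, Nat.cast_one,
    one_mul, iteratedDeriv_zero, hf0, Nat.add_sub_cancel]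
  rw [frakPLower, evalLaurent_add h0, evalLaurent_sub h0, evalLaurent_sum h0, hfN 1 0, hfN 0 1]
  have hsum : ∑ k ∈ Finset.Icc 1 N, (((N + 1).choose k : ℂ) * iteratedDeriv k (f 0 0) 0 *
        iteratedDeriv (N + 1 - k) (f 1 0) 0 - ((N + 1).choose k : ℂ) *
        iteratedDeriv k (f 0 1) 0 * iteratedDeriv (N + 1 - k) (f 1 1) 0) =
      ∑ k ∈ Finset.Icc 1 N, evalLaurent (((N + 1).choose k : ℂ) •
        (P k 0 0 * P (N + 1 - k) 1 0 - P k 0 1 * P (N + 1 - k) 1 1)) lam := by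
    refine Finset.sum_congr rfl fun k hk => ?_
    have hk' := Finset.mem_Icc.1 hk
    rw [evalLaurent_smul h0, evalLaurent_sub h0, evalLaurent_mul h0, evalLaurent_mul h0,
      hP k hk'.2, hP k hk'.2, hP (N + 1 - k) (by omega), hP (N + 1 - k) (by omega)]
    ring
  rw [hsum]
  simp only [omegaValue_single_mul_frakM, Fin.sum_univ_three, integral_alpha_two]
  simp [mu]
  ring

/-- The derivatives of the quadratic constraint. -/
theorem calKLower_eq (hr1 : r 0 = 1) (hN : 1 ≤ N)
    (hz0 : ∀ i, z i 0 = evalLaurent (central (Real.pi / 4) i) lam)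
    (hX1 : evalLaurent (X N 1) lam = iteratedDeriv N (z 1) 0)
    (hX2 : evalLaurent (X N 2) lam = iteratedDeriv N (z 2) 0)
    (hK : ∀ᶠ t in 𝓝 (0 : ℝ), ((r t : ℂ) * z 0 t) * ((r t : ℂ) * z 0 t) -
      ((r t : ℂ) * z 1 t) * ((r t : ℂ) * z 1 t) -
      ((r t : ℂ) * z 2 t) * ((r t : ℂ) * z 2 t) = -1) :
    lam * evalLaurent (calKLower X (fun k => iteratedDeriv k r 0) N) lam =
      (lam ^ 2 - 1) * iteratedDeriv N (z 0) 0 + 2 * (iteratedDeriv N r 0 : ℝ) * lam := by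
  have hy : ∀ i, ContDiffAt ℝ N (fun t => (r t : ℂ) * z i t) 0 := fun i =>
    ((contDiffAt_ofReal_comp hr).mul (hz i)).of_le (natCast_le_infty N)
  have hyy : ∀ i, iteratedDeriv N (fun t => ((r t : ℂ) * z i t) * ((r t : ℂ) * z i t)) 0 =
      2 * z i 0 * (iteratedDeriv N (z i) 0 + (iteratedDeriv N r 0 : ℝ) * z i 0 +
        ∑ k ∈ Finset.Icc 1 (N - 1), ((N.choose k * iteratedDeriv k r 0 : ℝ) : ℂ) *
          evalLaurent (X (N - k) i) lam) +
      ∑ k ∈ Finset.Icc 1 (N - 1), (N.choose k : ℂ) *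
        (evalLaurent (yDeriv X (fun k => iteratedDeriv k r 0) k i) lam *
          evalLaurent (yDeriv X (fun k => iteratedDeriv k r 0) (N - k) i) lam) := by
    intro i
    rw [iteratedDeriv_fun_mul (hy i) (hy i), sum_range_succ_eq_ends hN]
    simp only [Nat.choose_zero_right, Nat.choose_self, Nat.sub_zero, Nat.sub_self, Nat.cast_one,
      one_mul, iteratedDeriv_zero, hr1, Complex.ofReal_one]
    rw [iteratedDeriv_ofReal_mul_eq_ends hr hz hr1 hN]
    have e1 : ∑ l ∈ Finset.Icc 1 (N - 1), ((N.choose l * iteratedDeriv (N - l) r 0 : ℝ) : ℂ) *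
        iteratedDeriv l (z i) 0 = ∑ k ∈ Finset.Icc 1 (N - 1),
          ((N.choose k * iteratedDeriv k r 0 : ℝ) : ℂ) * evalLaurent (X (N - k) i) lam := by
      refine Finset.sum_nbij' (fun k => N - k) (fun k => N - k) ?_ ?_ ?_ ?_ ?_ <;> intro k hk <;>
        have hk' := Finset.mem_Icc.1 hk
      · exact Finset.mem_Icc.2 ⟨by omega, by omega⟩
      · exact Finset.mem_Icc.2 ⟨by omega, by omega⟩
      · omega
      · omega
      · rw [Nat.choose_symm (by omega), Nat.sub_sub_self (by omega), hX k (by omega)]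
    have e2 : ∑ k ∈ Finset.Icc 1 (N - 1), (N.choose k : ℂ) *
        iteratedDeriv k (fun t => (r t : ℂ) * z i t) 0 *
        iteratedDeriv (N - k) (fun t => (r t : ℂ) * z i t) 0 =
        ∑ k ∈ Finset.Icc 1 (N - 1), (N.choose k : ℂ) *
        (evalLaurent (yDeriv X (fun k => iteratedDeriv k r 0) k i) lam *
          evalLaurent (yDeriv X (fun k => iteratedDeriv k r 0) (N - k) i) lam) := by
      refine Finset.sum_congr rfl fun k hk => ?_
      have hk' := Finset.mem_Icc.1 hk
      rw [evalLaurent_yDeriv hr hz h0 hX (by omega), evalLaurent_yDeriv hr hz h0 hX (by omega),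
        mul_assoc]
    rw [e1, e2]
    ring
  have hd := Filter.EventuallyEq.iteratedDeriv_eq N hK
  rw [iteratedDeriv_const, if_neg (by omega),
    iteratedDeriv_fun_sub (((hy 0).mul (hy 0)).sub ((hy 1).mul (hy 1))) ((hy 2).mul (hy 2)),
    iteratedDeriv_fun_sub ((hy 0).mul (hy 0)) ((hy 1).mul (hy 1)), hyy, hyy, hyy] at hd
  have hX0 : ∀ i, evalLaurent (X 0 i) lam = z i 0 := fun i => by
    rw [hX 0 (by omega), iteratedDeriv_zero]
  have hlow : evalLaurent (calKLower X (fun k => iteratedDeriv k r 0) N) lam =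
      -2 * (z 1 0 * iteratedDeriv N (z 1) 0) + -2 * (z 2 0 * iteratedDeriv N (z 2) 0) +
      2 * (z 0 0 * (∑ k ∈ Finset.Icc 1 (N - 1), ((N.choose k * iteratedDeriv k r 0 : ℝ) : ℂ) *
          evalLaurent (X (N - k) 0) lam) - z 1 0 * (∑ k ∈ Finset.Icc 1 (N - 1),
          ((N.choose k * iteratedDeriv k r 0 : ℝ) : ℂ) * evalLaurent (X (N - k) 1) lam) -
          z 2 0 * (∑ k ∈ Finset.Icc 1 (N - 1),
          ((N.choose k * iteratedDeriv k r 0 : ℝ) : ℂ) * evalLaurent (X (N - k) 2) lam)) +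
      (∑ k ∈ Finset.Icc 1 (N - 1), (N.choose k : ℂ) *
        (evalLaurent (yDeriv X (fun k => iteratedDeriv k r 0) k 0) lam *
          evalLaurent (yDeriv X (fun k => iteratedDeriv k r 0) (N - k) 0) lam) -
       ∑ k ∈ Finset.Icc 1 (N - 1), (N.choose k : ℂ) *
        (evalLaurent (yDeriv X (fun k => iteratedDeriv k r 0) k 1) lam *
          evalLaurent (yDeriv X (fun k => iteratedDeriv k r 0) (N - k) 1) lam) -
       ∑ k ∈ Finset.Icc 1 (N - 1), (N.choose k : ℂ) *
        (evalLaurent (yDeriv X (fun k => iteratedDeriv k r 0) k 2) lam *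
          evalLaurent (yDeriv X (fun k => iteratedDeriv k r 0) (N - k) 2) lam)) := by
    simp only [calKLower, lorentz, evalLaurent_add h0, evalLaurent_smul h0, evalLaurent_mul h0,
      evalLaurent_sum h0, evalLaurent_sub h0, hX0, hX1, hX2, Finset.mul_sum, mul_sub,
      Finset.sum_sub_distrib]
    congr 2
    simp only [mul_left_comm]
  -- The identity `2 λ a̲ = 1 - λ²` produces the divisor multiplying the derivative of `a`; the
  -- constraint on the central values, `hc12`, produces the coefficient `2 λ` of the derivative of
  -- `r`.
  have hc0 : z 0 0 = (1 - lam ^ 2) / (2 * lam) := by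
    rw [hz0, evalLaurent_central h0]
    simp
    field_simp
  have hc12 : z 0 0 ^ 2 - z 1 0 ^ 2 - z 2 0 ^ 2 = -1 := by
    rw [hz0, hz0, hz0]
    simp only [evalLaurent_central h0]
    simp
    field_simp
    linear_combination (-8 * (1 + lam ^ 2) ^ 2) * sqrt_two_sq
  have hc0' : 2 * lam * z 0 0 = 1 - lam ^ 2 := by rw [hc0]; field_simp
  rw [hlow]
  linear_combination lam * hd - (iteratedDeriv N (z 0) 0) * hc0' -
    2 * lam * (iteratedDeriv N r 0 : ℝ) * hc12
end Pointwise

/-! ### Fourier coefficients on the unit circle -/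

theorem hasSum_evalLaurent (f : ℂ[T;T⁻¹]) (lam : ℂ) :
    HasSum (fun k : ℤ => f.coeff k * lam ^ k) (evalLaurent f lam) :=
  hasSum_sum_of_ne_finset_zero fun k hk => by rw [Finsupp.notMem_support_iff.1 hk, zero_mul]

theorem summable_norm_coeff (f : ℂ[T;T⁻¹]) : Summable fun k : ℤ => ‖f.coeff k‖ :=
  summable_of_ne_finset_zero (s := f.coeff.support) fun k hk => by
    rw [Finsupp.notMem_support_iff.1 hk, norm_zero]

theorem laurent_eq_of_evalLaurent_eq {f g : ℂ[T;T⁻¹]}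
    (h : ∀ lam : ℂ, ‖lam‖ = 1 → evalLaurent f lam = evalLaurent g lam) : f = g := by
  refine AddMonoidAlgebra.ext (Finsupp.ext fun k => sub_eq_zero.1 ?_)
  refine fourier_coeff_eq_zero (d := fun k => f.coeff k - g.coeff k) ?_ (fun lam hl => ?_) k
  · exact .of_nonneg_of_le (fun _ => norm_nonneg _) (fun k => norm_sub_le _ _)
      ((summable_norm_coeff f).add (summable_norm_coeff g))
  · have := (hasSum_evalLaurent f lam).sub (hasSum_evalLaurent g lam)
    rw [h lam hl, sub_self] at this
    simp only [sub_mul, this.tsum_eq]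

theorem hasSum_star_neg {c : ℤ → ℂ} {lam s : ℂ} (hl : ‖lam‖ = 1)
    (h : HasSum (fun k => c k * lam ^ k) s) :
    HasSum (fun k => star (c (-k)) * lam ^ k) (star s) := by
  have h1 := h.star
  rw [← (Equiv.neg ℤ).hasSum_iff] at h1
  refine h1.congr_fun fun k => ?_
  simp only [Function.comp_apply, Equiv.neg_apply]
  rw [star_mul', star_zpow₀, star_eq_inv hl, zpow_neg, inv_zpow, inv_inv]

section Loops

variable {ρ : ℝ} [hρ : Fact (1 < ρ)]

theorem PlusLoop.summable_abs_coeff (h : PlusLoop ρ) : Summable fun k => |h.coeff k| := by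
  refine .of_nonneg_of_le (fun _ => abs_nonneg _) (fun k => ?_) h.summable_coeff
  exact le_mul_of_one_le_right (abs_nonneg _) (one_le_pow₀ (hρ.out.le.trans (le_abs_self ρ)))

/-- The coefficients of a power series, as a doubly infinite sequence. -/
def PlusLoop.intCoeff (h : PlusLoop ρ) (k : ℤ) : ℂ := if 0 ≤ k then h.coeff k.toNat else 0

omit hρ in
theorem PlusLoop.intCoeff_natCast (h : PlusLoop ρ) (k : ℕ) : h.intCoeff k = h.coeff k := by
  rw [intCoeff, if_pos (Int.natCast_nonneg k), Int.toNat_natCast]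

omit hρ in
theorem PlusLoop.intCoeff_of_neg (h : PlusLoop ρ) {k : ℤ} (hk : k < 0) : h.intCoeff k = 0 :=
  if_neg (not_le.2 hk)

theorem PlusLoop.summable_norm_intCoeff (h : PlusLoop ρ) :
    Summable fun k => ‖h.intCoeff k‖ := by
  refine ((Nat.cast_injective (R := ℤ)).summable_iff fun k hk => ?_).1 ?_
  · rw [h.intCoeff_of_neg, norm_zero]
    by_contra hk'
    exact hk ⟨k.toNat, Int.toNat_of_nonneg (not_lt.1 hk')⟩
  · refine h.summable_abs_coeff.congr fun k => ?_
    rw [Function.comp_apply, intCoeff_natCast, Complex.norm_real, Real.norm_eq_abs]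

theorem PlusLoop.hasSum_intCoeff (h : PlusLoop ρ) {lam : ℂ} (hl : ‖lam‖ = 1) :
    HasSum (fun k => h.intCoeff k * lam ^ k) (h.eval lam) := by
  refine (Nat.cast_injective.hasSum_iff (β := ℤ) fun k hk => ?_).1 ?_
  · rw [h.intCoeff_of_neg, zero_mul]
    by_contra hk'
    exact hk ⟨k.toNat, Int.toNat_of_nonneg (not_lt.1 hk')⟩
  · have hs : Summable fun k => (h.coeff k : ℂ) * lam ^ k := by
      refine .of_norm (h.summable_abs_coeff.congr fun k => ?_)
      rw [norm_mul, norm_pow, hl, one_pow, mul_one, Complex.norm_real, Real.norm_eq_abs]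
    refine hs.hasSum.congr_fun fun k => ?_
    rw [Function.comp_apply, intCoeff_natCast, zpow_natCast]

/-- Reality on the circle says that the coefficients of index `k` and `-k` are conjugate. Since `h`
has no negative coefficients, this can be solved for `h.coeff k` when `1 ≤ k`. -/
theorem coeff_of_real_on_circle (h : PlusLoop ρ) (f : ℂ[T;T⁻¹]) (c : ℝ)
    (hf : ∀ lam : ℂ, ‖lam‖ = 1 →
      star (c * h.eval lam + evalLaurent f lam) = c * h.eval lam + evalLaurent f lam)
    {k : ℕ} (hk : 1 ≤ k) : (c : ℂ) * h.coeff k = star (f.coeff (-(k : ℤ))) - f.coeff k := by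
  set e : ℤ → ℂ := fun k => c * h.intCoeff k + f.coeff k with he
  have hsum : Summable fun k => ‖e k‖ :=
    .of_nonneg_of_le (fun _ => norm_nonneg _) (fun k => norm_add_le _ _)
      ((by simpa only [norm_mul] using h.summable_norm_intCoeff.mul_left ‖(c : ℂ)‖ :
        Summable fun k => ‖(c : ℂ) * h.intCoeff k‖).add (summable_norm_coeff f))
  have key := fourier_coeff_eq_zero (d := fun k => e k - star (e (-k))) ?_ (fun lam hl => ?_) k
  · simp only [he, h.intCoeff_natCast, h.intCoeff_of_neg (k := -(k : ℤ)) (by omega), mul_zero,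
      zero_add] at key
    linear_combination key
  · refine .of_nonneg_of_le (fun _ => norm_nonneg _) (fun k => norm_sub_le _ _)
      (hsum.add ?_)
    simp only [norm_star]
    exact (Equiv.neg ℤ).summable_iff.2 hsum
  · have h1 : HasSum (fun k => e k * lam ^ k) (c * h.eval lam + evalLaurent f lam) := by
      refine (((h.hasSum_intCoeff hl).mul_left (c : ℂ)).add
        (hasSum_evalLaurent f lam)).congr_fun fun k => ?_
      simp only [he]
      ring
    have h2 := h1.sub (hasSum_star_neg hl h1)
    rw [hf lam hl, sub_self] at h2
    simp only [sub_mul, h2.tsum_eq]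

/-- Beyond the degree of `f`, comparison of coefficients gives `h_{j+2} = h_j`, and a summable
sequence with this property is zero. Since `λ² - 1` vanishes at `±1`, summability has to play the
role of a pointwise division. -/
theorem coeff_eq_zero_of_mul_on_circle (h : PlusLoop ρ) (f : ℂ[T;T⁻¹]) {d : ℕ}
    (hd : LaurentDegreeLE (d + 2) f)
    (hf : ∀ lam : ℂ, ‖lam‖ = 1 → (lam ^ 2 - 1) * h.eval lam = evalLaurent f lam)
    {k : ℕ} (hk : d < k) : h.coeff k = 0 := by
  have hrec : ∀ j : ℕ, d < j → h.coeff (j + 2) = h.coeff j := by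
    intro j hj
    have key := fourier_coeff_eq_zero
      (d := fun k => h.intCoeff (k - 2) - h.intCoeff k - f.coeff k) ?_ (fun lam hl => ?_)
      ((j + 2 : ℕ) : ℤ)
    · have e1 : ((j + 2 : ℕ) : ℤ) - 2 = (j : ℤ) := by push_cast; ring
      have e2 : f.coeff ((j + 2 : ℕ) : ℤ) = 0 := hd _ (by rw [Nat.abs_cast]; exact_mod_cast (by omega))
      rw [e1, e2, h.intCoeff_natCast, h.intCoeff_natCast, sub_zero, sub_eq_zero] at key
      exact_mod_cast key.symm
    · have hs := h.summable_norm_intCoeff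
      refine .of_nonneg_of_le (fun _ => norm_nonneg _)
        (fun k => (norm_sub_le _ _).trans (add_le_add_left (norm_sub_le _ _) _))
        (((((Equiv.subRight (2 : ℤ)).summable_iff (f := fun k => ‖h.intCoeff k‖)).2 hs).add
          hs).add (summable_norm_coeff f))
    · have h0 : lam ≠ 0 := ne_zero_of_mem_annulus (mem_annulus_of_norm_eq_one (ρ := ρ) hl)
      have h1 := h.hasSum_intCoeff hl
      have h2 : HasSum (fun k => h.intCoeff (k - 2) * lam ^ k) (lam ^ 2 * h.eval lam) := by
        have := ((Equiv.subRight (2 : ℤ)).hasSum_iff.2 h1).mul_left (lam ^ 2)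
        refine this.congr_fun fun k => ?_
        simp only [Function.comp_apply, Equiv.subRight_apply]
        rw [zpow_sub₀ h0]
        norm_cast
        field_simp
      have h3 := (h2.sub h1).sub (hasSum_evalLaurent f lam)
      rw [← hf lam hl, sub_mul, one_mul, sub_self] at h3
      simp only [sub_mul, h3.tsum_eq]
  have hconst : ∀ j : ℕ, h.coeff (k + 2 * j) = h.coeff k := by
    intro j
    induction j with
    | zero => rfl
    | succ j ih =>
      rw [← ih, ← hrec (k + 2 * j) (by omega)]
      congr 1
  have ht := h.summable_abs_coeff.tendsto_atTop_zero.comp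
    (Filter.tendsto_atTop_mono (fun j : ℕ => (show j ≤ k + 2 * j by omega)) Filter.tendsto_id)
  have ht' : Filter.Tendsto (fun _ : ℕ => |h.coeff k|) Filter.atTop (𝓝 0) :=
    ht.congr fun j => by rw [Function.comp_apply, hconst]
  exact abs_eq_zero.1 (tendsto_nhds_unique tendsto_const_nhds ht')

omit hρ in
theorem PlusLoop.eval_eq_sum (h : PlusLoop ρ) {d : ℕ} (hd : ∀ k, d < k → h.coeff k = 0)
    (lam : ℂ) : h.eval lam = ∑ k ∈ Finset.range (d + 1), (h.coeff k : ℂ) * lam ^ k :=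
  tsum_eq_sum fun k hk => by
    rw [hd k (by by_contra hlt; exact hk (Finset.mem_range.2 (by omega))), Complex.ofReal_zero,
      zero_mul]

end Loops

/-! ### The derivatives of a solution family and the induction on their order. -/

section Family

variable {ρ : ℝ} [hρ : Fact (1 < ρ)]

/-- The Taylor polynomial in `λ` of degree `n + 1` of the `n`-th derivative of the `i`-th
parameter. -/
def jetPoly (x : ℝ → Param ρ) (i : Fin 3) (n : ℕ) : ℝ[X] :=
  ∑ k ∈ Finset.range (n + 2),
    Polynomial.monomial k ((iteratedDeriv n (fun t => (x t).tilde i) 0).coeff k)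

theorem coeff_jetPoly (x : ℝ → Param ρ) (i : Fin 3) (n k : ℕ) : (jetPoly x i n).coeff k =
    if k < n + 2 then (iteratedDeriv n (fun t => (x t).tilde i) 0).coeff k else 0 := by
  simp [jetPoly, Polynomial.coeff_monomial]

theorem natDegree_jetPoly (x : ℝ → Param ρ) (i : Fin 3) (n : ℕ) :
    (jetPoly x i n).natDegree ≤ n + 1 :=
  Polynomial.natDegree_le_iff_coeff_eq_zero.2 fun k hk => by
    rw [coeff_jetPoly, if_neg (by omega)]

theorem eval_map_jetPoly (x : ℝ → Param ρ) (i : Fin 3) (n : ℕ) (lam : ℂ) :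
    ((jetPoly x i n).map (algebraMap ℝ ℂ)).eval lam = ∑ k ∈ Finset.range (n + 1 + 1),
      ((iteratedDeriv n (fun t => (x t).tilde i) 0).coeff k : ℂ) * lam ^ k := by
  simp [jetPoly, Polynomial.map_sum, Polynomial.eval_finsetSum]

omit hρ in
theorem tilde_centralParam (i : Fin 3) : (centralParam ρ).tilde i = 0 := by
  fin_cases i <;> rfl

variable {x : ℝ → Param ρ} (hx : IsSolutionFamily (Real.pi / 4) x)

include hx

theorem IsSolutionFamily.contDiffAt_tilde (i : Fin 3) :
    ContDiffAt ℝ ∞ (fun t => (x t).tilde i) 0 :=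
  (contDiff_tilde i).contDiffAt.comp 0 hx.smooth

theorem IsSolutionFamily.contDiffAt_r : ContDiffAt ℝ ∞ (fun t => (x t).r) 0 :=
  contDiff_r.contDiffAt.comp 0 hx.smooth

theorem IsSolutionFamily.contDiffAt_loopY : ContDiffAt ℝ ∞ (fun t => loopY (x t)) 0 :=
  contDiff_loopY.contDiffAt.comp 0 hx.smooth

theorem IsSolutionFamily.r_zero : (x 0).r = 1 := by rw [hx.initial]; rfl

section Point

variable {lam : ℂ} (hl : lam ∈ annulus ρ)

include hl

omit hx in
theorem abc_eq_add (i : Fin 3) : (fun t => abc (Real.pi / 4) (x t) lam i) =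
    fun t => evalLaurent (central (Real.pi / 4) i) lam +
      ((evalU hl.2).comp (PlusLoop.toL1 (ρ := ρ)).toContinuousLinearEquiv.toContinuousLinearMap)
        ((x t).tilde i) := by
  funext t
  rw [abc, PlusLoop.eval_eq _ hl.2]
  rfl

theorem IsSolutionFamily.contDiffAt_abc (i : Fin 3) :
    ContDiffAt ℝ ∞ (fun t => abc (Real.pi / 4) (x t) lam i) 0 := by
  rw [abc_eq_add hl]
  exact contDiffAt_const.add (ContinuousLinearMap.contDiff _ |>.contDiffAt.comp 0
    (hx.contDiffAt_tilde i))

omit hl in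
theorem IsSolutionFamily.abc_zero (i : Fin 3) : abc (Real.pi / 4) (x 0) lam i =
    evalLaurent (central (Real.pi / 4) i) lam := by
  rw [abc, hx.initial, tilde_centralParam]
  simp [PlusLoop.eval, PlusLoop.coeff_zero]

theorem IsSolutionFamily.iteratedDeriv_abc {n : ℕ} (hn : 1 ≤ n) (i : Fin 3) :
    iteratedDeriv n (fun t => abc (Real.pi / 4) (x t) lam i) 0 =
      (iteratedDeriv n (fun t => (x t).tilde i) 0).eval lam := by
  rw [abc_eq_add hl, iteratedDeriv_const_add (by omega),
    iteratedDeriv_clm_comp _ (hx.contDiffAt_tilde i), PlusLoop.eval_eq _ hl.2]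
  rfl

theorem IsSolutionFamily.evalLaurent_coeffJet {n : ℕ} (i : Fin 3)
    (h : ∀ k, n + 1 < k → (iteratedDeriv n (fun t => (x t).tilde i) 0).coeff k = 0) :
    evalLaurent (coeffJet (Real.pi / 4) (jetPoly x) n i) lam =
      iteratedDeriv n (fun t => abc (Real.pi / 4) (x t) lam i) 0 := by
  cases n with
  | zero => rw [iteratedDeriv_zero, hx.abc_zero]; rfl
  | succ n =>
    rw [coeffJet, evalLaurent_toLaurent (ne_zero_of_mem_annulus hl), eval_map_jetPoly,
      hx.iteratedDeriv_abc hl (by omega), PlusLoop.eval_eq_sum _ h]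

theorem IsSolutionFamily.eventually_calP (i j : Fin 2) :
    (fun t => calP (Real.pi / 4) t (x t) lam i j) =ᶠ[𝓝 0]
      fun t => evalV hl ((Path.entry i j (fundSol ρ (t • loopY (x t)))).at 1) := by
  filter_upwards [hx.eventually_regular] with t ht using calP_eq_evalV hl ht.left i j

theorem IsSolutionFamily.contDiffAt_calP (i j : Fin 2) :
    ContDiffAt ℝ ∞ (fun t => calP (Real.pi / 4) t (x t) lam i j) 0 := by
  refine ContDiffAt.congr_of_eventuallyEq ?_ (hx.eventually_calP hl i j)
  have h1 : ContDiffAt ℝ ∞ (fun t : ℝ => t • loopY (x t)) 0 :=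
    contDiffAt_id.smul hx.contDiffAt_loopY
  have h2 : ContDiffAt ℝ ∞ (fun t : ℝ => fundSol ρ (t • loopY (x t))) 0 :=
    ContDiffAt.comp (g := fundSol ρ) 0 (contDiffAt_fundSol (by simpa using zero_mem_small)) h1
  exact ((evalV hl).comp ((LoopPath.at 1).comp (Path.entry i j))).contDiff.contDiffAt.comp 0 h2

omit hx in
theorem calP_zero (x : ℝ → Param ρ) (i j : Fin 2) :
    calP (Real.pi / 4) 0 (x 0) lam i j = (1 : Matrix (Fin 2) (Fin 2) ℂ) i j := by
  rw [calP_eq_evalV hl (by rw [zero_smul]; exact zero_mem_small), zero_smul, fundSol_zero,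
    evalV_onePath]

theorem IsSolutionFamily.iteratedDeriv_calP (i j : Fin 2) (m : ℕ) :
    iteratedDeriv m (fun t => calP (Real.pi / 4) t (x t) lam i j) 0 =
      ∑ l ∈ Finset.range (m + 1), ∑ I : Fin l → Fin 3, (m.descFactorial l *
        iteratedDeriv (m - l) (fun t => wordProd
          (fun k => ((x t).r : ℂ) * abc (Real.pi / 4) (x t) lam k) (List.ofFn I)) 0) *
        (omegaValue (Real.pi / 4) I * frakMWord I i j) := by
  rw [(hx.eventually_calP hl i j).iteratedDeriv_eq,
    iteratedDeriv_evalV_fundSol hl hx.contDiffAt_loopY]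
  simp only [evalV_loopY]

/-- If the derivatives of the parameters of order less than `n` are polynomials of the expected
degree, then the derivatives of the monodromy of order at most `n` are as expected. -/
theorem IsSolutionFamily.evalLaurent_monodromyJet : ∀ (n : ℕ)
    (_ : ∀ m < n, ∀ i k, m + 1 < k →
      (iteratedDeriv m (fun t => (x t).tilde i) 0).coeff k = 0) (i j : Fin 2),
    evalLaurent (monodromyJet (Real.pi / 4) (jetPoly x)
      (fun k => iteratedDeriv k (fun t => (x t).r) 0) n i j) lam =
      iteratedDeriv n (fun t => calP (Real.pi / 4) t (x t) lam i j) 0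
  | 0, _, i, j => by
    rw [iteratedDeriv_zero, calP_zero hl x, monodromyJet, Matrix.one_apply, Matrix.one_apply]
    split_ifs
    · exact evalLaurent_one (ne_zero_of_mem_annulus hl)
    · exact evalLaurent_zero (ne_zero_of_mem_annulus hl)
  | 1, _, i, j => by
    have h0 := ne_zero_of_mem_annulus hl
    have hzero : ∑ I : Fin 0 → Fin 3, ((Nat.descFactorial 1 0 : ℂ) *
        iteratedDeriv (1 - 0) (fun t => wordProd
          (fun k => ((x t).r : ℂ) * abc (Real.pi / 4) (x t) lam k) (List.ofFn I)) 0) *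
        (omegaValue (Real.pi / 4) I * frakMWord I i j) = 0 := by
      refine Finset.sum_eq_zero fun I _ => ?_
      have h : (fun t => wordProd (fun k => ((x t).r : ℂ) * abc (Real.pi / 4) (x t) lam k)
          (List.ofFn I)) = fun _ => 1 := by
        funext t; simp [wordProd]
      rw [h, iteratedDeriv_const, if_neg (by omega), mul_zero, zero_mul]
    rw [hx.iteratedDeriv_calP hl, Finset.sum_range_succ, Finset.sum_range_one, hzero, zero_add,
      ← (Equiv.funUnique (Fin 1) (Fin 3)).symm.sum_comp, monodromyJet]
    simp only [Matrix.sum_apply, scaledMatrix, Matrix.of_apply, evalLaurent_sum h0,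
      evalLaurent_smul h0]
    refine Finset.sum_congr rfl fun m _ => ?_
    have hm : (Equiv.funUnique (Fin 1) (Fin 3)).symm m = ![m] := by
      funext a; simp
    rw [hm, Nat.descFactorial_one, Nat.sub_self, iteratedDeriv_zero, ← hx.abc_zero m]
    simp [wordProd, frakMWord, hx.r_zero]
    ring
  | n + 2, hV, i, j => by
    have h0 := ne_zero_of_mem_annulus hl
    have hX : ∀ m < n + 1 + 1, ∀ i, evalLaurent (coeffJet (Real.pi / 4) (jetPoly x) m i) lam =
        iteratedDeriv m (fun t => abc (Real.pi / 4) (x t) lam i) 0 := fun m hm i =>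
      hx.evalLaurent_coeffJet hl i (hV m hm i)
    rw [iteratedDeriv_entry_eq hx.contDiffAt_r (fun i => hx.contDiffAt_abc hl i) h0
      (N := n + 1) (fun m hm => hX m (by omega)) hx.r_zero (by omega)
      (hx.iteratedDeriv_calP hl i j (n + 1 + 1)), monodromyJet, Matrix.add_apply,
      evalLaurent_add h0]
    congr 1
    simp only [Matrix.sum_apply, scaledMatrix, Matrix.of_apply, evalLaurent_sum h0,
      evalLaurent_smul h0, evalLaurent_add h0, hX (n + 1) (by omega)]
    refine Finset.sum_congr rfl fun m _ => ?_
    rw [Matrix.smul_apply, smul_eq_mul, hx.abc_zero]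
    ring

/-- The formula from which the `n`-th derivative of `c` is read off. The only other unknown of order
`n` is that of `r`, multiplied by `c̲`, which is real on the circle and vanishes at `i`. -/
theorem IsSolutionFamily.iteratedDeriv_frakP {n : ℕ} (hn : 1 ≤ n)
    (hV : ∀ m < n, ∀ i k, m + 1 < k →
      (iteratedDeriv m (fun t => (x t).tilde i) 0).coeff k = 0) :
    iteratedDeriv (n + 1) (fun t => frakP (Real.pi / 4) t (x t) lam) 0 =
      2 * Real.pi * (n + 1) * ((iteratedDeriv n (fun t => (x t).tilde 2) 0).eval lam +
        (iteratedDeriv n (fun t => (x t).r) 0 : ℝ) *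
          evalLaurent (central (Real.pi / 4) 2) lam) +
      evalLaurent (frakPLower (Real.pi / 4) (coeffJet (Real.pi / 4) (jetPoly x))
        (fun k => iteratedDeriv k (fun t => (x t).r) 0)
        (monodromyJet (Real.pi / 4) (jetPoly x)
          (fun k => iteratedDeriv k (fun t => (x t).r) 0)) n) lam := by
  have h0 := ne_zero_of_mem_annulus hl
  have hX : ∀ m < n, ∀ i, evalLaurent (coeffJet (Real.pi / 4) (jetPoly x) m i) lam =
      iteratedDeriv m (fun t => abc (Real.pi / 4) (x t) lam i) 0 := fun m hm i =>
    hx.evalLaurent_coeffJet hl i (hV m hm i)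
  have := iteratedDeriv_frakP_eq (r := fun t => (x t).r)
    (z := fun i t => abc (Real.pi / 4) (x t) lam i) h0 (N := n)
    (f := fun i j t => calP (Real.pi / 4) t (x t) lam i j)
    (fun i j => hx.contDiffAt_calP hl i j) (fun i j => calP_zero hl x i j)
    (fun i j => iteratedDeriv_entry_eq hx.contDiffAt_r (fun i => hx.contDiffAt_abc hl i) h0 hX
      hx.r_zero hn (hx.iteratedDeriv_calP hl i j (n + 1)))
    (fun k hk i j => hx.evalLaurent_monodromyJet hl k
      (fun m hm => hV m (by omega)) i j)
  rw [hx.iteratedDeriv_abc hl hn, hx.abc_zero] at this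
  exact this

end Point

theorem IsSolutionFamily.eventually_frakP {lam : ℂ} (hl : ‖lam‖ = 1) :
    ∀ᶠ t in 𝓝 (0 : ℝ), frakP (Real.pi / 4) t (x t) lam = t * hatP (Real.pi / 4) t (x t) lam := by
  filter_upwards [hx.eventually_regular] with t ht
  rw [frakP_eq (mem_annulus_of_norm_eq_one hl) ht.left,
    hatP_eq (mem_annulus_of_norm_eq_one hl) ht.left]

theorem IsSolutionFamily.contDiffAt_frakP {lam : ℂ} (hl : lam ∈ annulus ρ) :
    ContDiffAt ℝ ∞ (fun t => frakP (Real.pi / 4) t (x t) lam) 0 :=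
  ((hx.contDiffAt_calP hl 0 0).mul (hx.contDiffAt_calP hl 1 0)).sub
    ((hx.contDiffAt_calP hl 0 1).mul (hx.contDiffAt_calP hl 1 1))

theorem IsSolutionFamily.star_iteratedDeriv_frakP {lam : ℂ} (hl : ‖lam‖ = 1) (n : ℕ) :
    star (iteratedDeriv n (fun t => frakP (Real.pi / 4) t (x t) lam) 0) =
      iteratedDeriv n (fun t => frakP (Real.pi / 4) t (x t) lam) 0 := by
  have h1 := iteratedDeriv_clm_comp (Complex.conjCLE : ℂ →L[ℝ] ℂ)
    (hx.contDiffAt_frakP (mem_annulus_of_norm_eq_one hl)) n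
  refine h1.symm.trans (Filter.EventuallyEq.iteratedDeriv_eq n ?_)
  filter_upwards [hx.eventually_frakP hl, hx.solves] with t ht ht'
  have h2 := ht'.calF_eq lam hl
  rw [loopStar_apply _ hl, sub_eq_zero] at h2
  change star (frakP (Real.pi / 4) t (x t) lam) = _
  rw [ht, star_mul', ← h2]
  simp

/-- As `θ = π/2` along the family, `𝔭` vanishes at the fixed point `i` for all small `t`, so the
condition can be differentiated at fixed `λ`. -/
theorem IsSolutionFamily.iteratedDeriv_frakP_I (n : ℕ) :
    iteratedDeriv n (fun t => frakP (Real.pi / 4) t (x t) Complex.I) 0 = 0 := by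
  have h : (fun t => frakP (Real.pi / 4) t (x t) Complex.I) =ᶠ[𝓝 0] fun _ => 0 := by
    filter_upwards [hx.eventually_frakP Complex.norm_I, hx.solves, hx.eventually_theta]
      with t h1 h2 h3
    have h4 := h2.calH₁_eq
    have h5 : Complex.exp (Complex.I * ((Real.pi / 2 : ℝ) : ℂ)) = Complex.I := by
      rw [mul_comm]
      push_cast
      exact Complex.exp_pi_div_two_mul_I
    rw [h3, h5] at h4
    rw [h1, h4, mul_zero]
  rw [h.iteratedDeriv_eq, iteratedDeriv_const]
  simp

theorem IsSolutionFamily.coeff_c {n : ℕ} (hn : 1 ≤ n)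
    (hV : ∀ m < n, ∀ i k, m + 1 < k →
      (iteratedDeriv m (fun t => (x t).tilde i) 0).coeff k = 0) {k : ℕ} (hk : 1 ≤ k) :
    ((2 * Real.pi * (n + 1) : ℝ) : ℂ) * (iteratedDeriv n (fun t => (x t).tilde 2) 0).coeff k =
      star ((frakPLower (Real.pi / 4) (coeffJet (Real.pi / 4) (jetPoly x))
        (fun k => iteratedDeriv k (fun t => (x t).r) 0)
        (monodromyJet (Real.pi / 4) (jetPoly x)
          (fun k => iteratedDeriv k (fun t => (x t).r) 0)) n).coeff (-(k : ℤ))) -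
      (frakPLower (Real.pi / 4) (coeffJet (Real.pi / 4) (jetPoly x))
        (fun k => iteratedDeriv k (fun t => (x t).r) 0)
        (monodromyJet (Real.pi / 4) (jetPoly x)
          (fun k => iteratedDeriv k (fun t => (x t).r) 0)) n).coeff (k : ℤ) := by
  refine coeff_of_real_on_circle _ _ _ (fun lam hl => ?_) hk
  have hm := mem_annulus_of_norm_eq_one (ρ := ρ) hl
  have h1 := hx.iteratedDeriv_frakP hm hn hV
  have h2 := hx.star_iteratedDeriv_frakP hl (n + 1)
  have h3 : star (evalLaurent (central (Real.pi / 4) 2) lam) =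
      evalLaurent (central (Real.pi / 4) 2) lam := by
    have h4 : (starRingEnd ℂ) lam = lam⁻¹ := star_eq_inv hl
    rw [evalLaurent_central (ne_zero_of_mem_annulus hm)]
    simp [h4]
    ring
  set g := iteratedDeriv (n + 1) (fun t => frakP (Real.pi / 4) t (x t) lam) 0
  set c0 := evalLaurent (central (Real.pi / 4) 2) lam
  have h5 : ((2 * Real.pi * (n + 1) : ℝ) : ℂ) *
      (iteratedDeriv n (fun t => (x t).tilde 2) 0).eval lam +
      evalLaurent (frakPLower (Real.pi / 4) (coeffJet (Real.pi / 4) (jetPoly x))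
        (fun k => iteratedDeriv k (fun t => (x t).r) 0)
        (monodromyJet (Real.pi / 4) (jetPoly x)
          (fun k => iteratedDeriv k (fun t => (x t).r) 0)) n) lam =
      g - ((2 * Real.pi * (n + 1) * iteratedDeriv n (fun t => (x t).r) 0 : ℝ) : ℂ) * c0 := by
    rw [h1]
    push_cast
    ring
  rw [h5, star_sub, h2, star_mul', h3, Complex.star_def, Complex.conj_ofReal]

theorem IsSolutionFamily.coeff_c_eq_zero {n : ℕ} (hn : 1 ≤ n)
    (hV : ∀ m < n, ∀ i k, m + 1 < k →
      (iteratedDeriv m (fun t => (x t).tilde i) 0).coeff k = 0) {k : ℕ} (hk : n + 1 < k) :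
    (iteratedDeriv n (fun t => (x t).tilde 2) 0).coeff k = 0 := by
  have hdeg := degree_frakPLower (degree_coeffJet (fun i n => natDegree_jetPoly x i n)
    (Real.pi / 4)) (R := fun k => iteratedDeriv k (fun t => (x t).r) 0) (Real.pi / 4)
    (degree_monodromyJet (fun i n => natDegree_jetPoly x i n) (Real.pi / 4)
      (fun k => iteratedDeriv k (fun t => (x t).r) 0)) n
  have h := hx.coeff_c hn hV (k := k) (by omega)
  rw [hdeg _ (by rw [abs_neg, Nat.abs_cast]; exact_mod_cast hk),
    hdeg _ (by rw [Nat.abs_cast]; exact_mod_cast hk), star_zero, sub_zero, mul_eq_zero] at h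
  have hne : ((2 * Real.pi * (n + 1) : ℝ) : ℂ) ≠ 0 := by
    rw [Complex.ofReal_ne_zero]
    positivity
  exact_mod_cast h.resolve_left hne

theorem IsSolutionFamily.calKLower_eq {n : ℕ} (hn : 1 ≤ n)
    (hV : ∀ m < n, ∀ i k, m + 1 < k →
      (iteratedDeriv m (fun t => (x t).tilde i) 0).coeff k = 0) {lam : ℂ} (hl : ‖lam‖ = 1) :
    lam * evalLaurent (calKLower (coeffJet (Real.pi / 4) (jetPoly x))
      (fun k => iteratedDeriv k (fun t => (x t).r) 0) n) lam =
      (lam ^ 2 - 1) * (iteratedDeriv n (fun t => (x t).tilde 0) 0).eval lam +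
        2 * (iteratedDeriv n (fun t => (x t).r) 0 : ℝ) * lam := by
  have hm := mem_annulus_of_norm_eq_one (ρ := ρ) hl
  rw [← hx.iteratedDeriv_abc hm hn]
  refine DPW.calKLower_eq (z := fun i t => abc (Real.pi / 4) (x t) lam i) hx.contDiffAt_r
    (fun i => hx.contDiffAt_abc hm i) (ne_zero_of_mem_annulus hm)
    (fun m hmn i => hx.evalLaurent_coeffJet hm i (hV m hmn i)) hx.r_zero hn
    (fun i => hx.abc_zero i) (hx.evalLaurent_coeffJet hm 1 fun k hk => ?_)
    (hx.evalLaurent_coeffJet hm 2 fun k hk => hx.coeff_c_eq_zero hn hV hk) ?_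
  · rw [hx.iteratedDeriv_tilde_one, PlusLoop.coeff_smul, hx.coeff_c_eq_zero hn hV hk, mul_zero]
  · filter_upwards [hx.solves] with t ht
    rw [← ht.calK_eq lam hl, calK_eq]
    ring

/-- Strong induction: the lower orders bound the degree of `frakPLower`, hence that of `c`; symmetry
transfers the bound to `b`; together they bound `calKLower`, hence `a`. -/
theorem IsSolutionFamily.coeff_eq_zero (n : ℕ) : ∀ i k, n + 1 < k →
    (iteratedDeriv n (fun t => (x t).tilde i) 0).coeff k = 0 := by
  induction n using Nat.strong_induction_on with
  | _ n hV =>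
    rcases Nat.eq_zero_or_pos n with rfl | hn
    · intro i k _
      rw [iteratedDeriv_zero, hx.initial, tilde_centralParam, PlusLoop.coeff_zero]
    have h2 : ∀ k, n + 1 < k → (iteratedDeriv n (fun t => (x t).tilde 2) 0).coeff k = 0 :=
      fun k hk => hx.coeff_c_eq_zero hn hV hk
    have h1 : ∀ k, n + 1 < k → (iteratedDeriv n (fun t => (x t).tilde 1) 0).coeff k = 0 :=
      fun k hk => by rw [hx.iteratedDeriv_tilde_one, PlusLoop.coeff_smul, h2 k hk, mul_zero]
    have h0 : ∀ k, n + 1 < k → (iteratedDeriv n (fun t => (x t).tilde 0) 0).coeff k = 0 := by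
      intro k hk
      set R : ℕ → ℝ := fun k => iteratedDeriv k (fun t => (x t).r) 0 with hR
      have hdeg := degree_calKLower (degree_coeffJet (fun i n => natDegree_jetPoly x i n)
        (Real.pi / 4)) (R := R) (n := n)
      have hT : LaurentDegreeLE 1 (LaurentPolynomial.T 1 : ℂ[T;T⁻¹]) := by
        simpa using LaurentDegreeLE.C_mul_T (d := 1) 1 (n := 1) (by simp)
      -- `calKLower` has degree at most `n + 2`, so its product with `λ` has degree at most `(n + 1)
      -- + 2`, as required for a factor `λ² - 1`.
      refine coeff_eq_zero_of_mul_on_circle _ (LaurentPolynomial.T 1 *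
        calKLower (coeffJet (Real.pi / 4) (jetPoly x)) R n -
        LaurentPolynomial.C ((2 * R n : ℝ) : ℂ) * LaurentPolynomial.T 1) (d := n + 1)
        (((hT.mul hdeg).mono (by omega)).sub (.C_mul_T _ (by simp; omega))) (fun lam hl => ?_) hk
      have hne : lam ≠ 0 :=
        ne_zero_of_mem_annulus (mem_annulus_of_norm_eq_one (ρ := ρ) hl)
      rw [evalLaurent_sub hne, evalLaurent_mul hne, evalLaurent_mul hne, evalLaurent_T hne,
        evalLaurent_C hne, zpow_one, hx.calKLower_eq hn hV hl]
      push_cast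
      ring
    intro i
    fin_cases i
    · exact h0
    · exact h1
    · exact h2

/-- `jetPoly` is defined by truncation, before any degree bound is known; by the bound nothing was
cut off. -/
theorem IsSolutionFamily.coeff_jetPoly (i : Fin 3) (n k : ℕ) :
    (jetPoly x i n).coeff k = (iteratedDeriv n (fun t => (x t).tilde i) 0).coeff k := by
  rw [DPW.coeff_jetPoly]
  split_ifs with h
  · rfl
  · rw [hx.coeff_eq_zero n i k (by omega)]

theorem IsSolutionFamily.recursionStep {n : ℕ} (hn : 1 ≤ n) :
    RecursionStep (Real.pi / 4) (jetPoly x) (fun k => iteratedDeriv k (fun t => (x t).r) 0)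
      (monodromyJet (Real.pi / 4) (jetPoly x)
        (fun k => iteratedDeriv k (fun t => (x t).r) 0)) n := by
  have hV : ∀ m < n, ∀ i k, m + 1 < k →
      (iteratedDeriv m (fun t => (x t).tilde i) 0).coeff k = 0 :=
    fun m _ => hx.coeff_eq_zero m
  have hπ : (Real.pi : ℂ) ≠ 0 := by exact_mod_cast Real.pi_ne_zero
  have hn' : (n : ℂ) + 1 ≠ 0 := by exact_mod_cast Nat.succ_ne_zero n
  refine ⟨fun k hk => ?_, ?_, ?_, ?_, ?_⟩
  · rw [hx.coeff_jetPoly, ← hx.coeff_c hn hV hk]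
    push_cast
    field_simp
  -- At `λ = i` the central value of `c` vanishes, so the derivative of `r` disappears and the
  -- constant coefficient can be isolated.
  · have hI := mem_annulus_of_norm_eq_one (ρ := ρ) Complex.norm_I
    have h1 := hx.iteratedDeriv_frakP hI hn hV
    rw [hx.iteratedDeriv_frakP_I, evalLaurent_central Complex.I_ne_zero,
      PlusLoop.eval_eq_sum _ (hx.coeff_eq_zero n 2)] at h1
    simp only [Matrix.cons_val, zpow_neg, zpow_one, Complex.inv_I, neg_add_cancel, mul_zero,
      add_zero] at h1
    have h2 : Finset.Icc 1 (n + 1) = Finset.Ico 1 (n + 1 + 1) := by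
      ext k; simp only [Finset.mem_Icc, Finset.mem_Ico]; omega
    rw [Finset.range_eq_Ico, ← Finset.sum_Ico_consecutive _ (Nat.zero_le 1) (by omega), ← h2,
      Nat.Ico_zero_eq_range, Finset.sum_range_one, pow_zero, mul_one] at h1
    simp only [hx.coeff_jetPoly]
    field_simp
    linear_combination -h1
  · ext k
    rw [hx.coeff_jetPoly, hx.iteratedDeriv_tilde_one, PlusLoop.coeff_smul]
    have : ((-1 : ℝ[X]) ^ n) = Polynomial.C ((-1 : ℝ) ^ n) := by simp
    rw [this, Polynomial.coeff_C_mul, hx.coeff_jetPoly]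
  -- An identity of Laurent polynomials follows from its values on the unit circle, where the
  -- determinant equation was differentiated.
  · refine laurent_eq_of_evalLaurent_eq fun lam hl => ?_
    have hm := mem_annulus_of_norm_eq_one (ρ := ρ) hl
    have h0 := ne_zero_of_mem_annulus hm
    rw [evalLaurent_mul h0, evalLaurent_add h0, evalLaurent_mul h0, evalLaurent_sub h0,
      evalLaurent_mul h0, evalLaurent_T h0, evalLaurent_T h0, evalLaurent_one h0,
      evalLaurent_C h0, zpow_one, hx.calKLower_eq hn hV hl,
      hx.evalLaurent_coeffJet hm 0 (hx.coeff_eq_zero n 0), hx.iteratedDeriv_abc hm hn]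
    push_cast
    rfl
  · obtain ⟨m, rfl⟩ := Nat.exists_eq_add_of_le' hn
    rfl

end Family

end DPW

end

/-! ### The theorem. -/

theorem mainTheorem11 (ρ : ℝ) [Fact (1 < ρ)] :
    (∃ x : ℝ → Param ρ, IsSolutionFamily (Real.pi / 4) x) ∧
    ∀ x : ℝ → Param ρ, IsSolutionFamily (Real.pi / 4) x →
      (∀ lam : ℂ, ρ⁻¹ ≤ ‖lam‖ → ‖lam‖ ≤ ρ → ∀ i j,
        ContDiffAt ℝ ∞ (fun t => calP (Real.pi / 4) t (x t) lam i j) 0) ∧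
      ∃ (p : Fin 3 → ℕ → ℝ[X]) (P : ℕ → Matrix (Fin 2) (Fin 2) ℂ[T;T⁻¹]),
        -- the derivatives of `a`, `b`, `c` are polynomials of degree at most `n + 1`
        (∀ n : ℕ, 1 ≤ n → ∀ i,
          (p i n).natDegree ≤ n + 1 ∧
          ∀ k, (iteratedDeriv n (fun t => (x t).tilde i) 0).coeff k = (p i n).coeff k) ∧
        -- the derivatives of `𝒫` are Laurent polynomials of degree at most `n + 1`
        (∀ n : ℕ, ∀ lam : ℂ, ρ⁻¹ ≤ ‖lam‖ → ‖lam‖ ≤ ρ → ∀ i j,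
          iteratedDeriv n (fun t => calP (Real.pi / 4) t (x t) lam i j) 0 =
            evalLaurent (P n i j) lam) ∧
        (∀ n : ℕ, 1 ≤ n → ∀ i j, LaurentDegreeLE (n + 1) (P (n + 1) i j)) ∧
        -- they are determined recursively, starting from the central values
        P 1 = ∑ i : Fin 3, scaledMatrix (central (Real.pi / 4) i)
          (omegaValue (Real.pi / 4) ![i] • frakM i) ∧
        (∀ n : ℕ, 1 ≤ n →
          iteratedDeriv n (fun t => (x t).theta) 0 = 0 ∧
          RecursionStep (Real.pi / 4) p
            (fun k => iteratedDeriv k (fun t => (x t).r) 0) P n) := by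
  obtain ⟨g, hg, -⟩ := exists_solution_family ρ
  refine ⟨⟨g, hg⟩, fun x hx => ⟨fun lam h1 h2 i j => hx.contDiffAt_calP ⟨h1, h2⟩ i j,
    jetPoly x, monodromyJet (Real.pi / 4) (jetPoly x)
      (fun k => iteratedDeriv k (fun t => (x t).r) 0), ?_, ?_, ?_, rfl, ?_⟩⟩
  · exact fun n _ i => ⟨natDegree_jetPoly x i n, fun k => (hx.coeff_jetPoly i n k).symm⟩
  · exact fun n lam h1 h2 i j =>
      (hx.evalLaurent_monodromyJet ⟨h1, h2⟩ n (fun m _ => hx.coeff_eq_zero m) i j).symm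
  · exact fun n _ i j =>
      degree_monodromyJet (fun i n => natDegree_jetPoly x i n) (Real.pi / 4) _ (n + 1) i j
  · exact fun n hn => ⟨hx.iteratedDeriv_theta hn, hx.recursionStep hn⟩
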